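/- **CLT for the iso-extremogram estimator.** *Setting.* Let $X=\{X_t(\mathbf s):(\mathbf s,t)\in\mathbb Z^2\times[0,\infty)\}$ be an $\mathbb R^k$-valued space-time process and let $A,B\subset\mathbb R^k$ be Borel sets bounded away from zero. Let $\mathbf n=(n_1,n_2,n_3)$ and $n=n_1n_2n_3$. All limits "$\mathbf n\to\infty$" are taken as every $n_i\to\infty$, in $\mathbb N^3$ or along any fixed countably generated filter (for instance a path) on $\mathbb N^3$ along which every $n_i\to\infty$. For sequences, $a\ll b$ means $a=o(b)$. Let $r_i=r_{n_i}$ be integers, $r=r_1r_2r_3$, $m_i=\lfloor n_i/r_i\rfloor$ and $D_{\mathbf n}=[m_1]\times[m_2]\times[m_3]$, where $[j]=\{1,\dots,j\}$. Let $u_n$ be real numbers that are positive for all large $n$, and let $v_n=\mathbb P(u_n^{-1}X_0(\mathbf 0)\in A)$. For $(j_1,j_2,j_3)\in D_{\mathbf n}$ the block $Y_{\mathbf n,j}$ is the $r_1\times r_2\times r_3$ array of the values $u_n^{-1}X_t(i_1,i_2)$, $(i_1,i_2,t)\in\prod_{i}\{(j_i-1)r_i+1,\dots,j_ir_i\}$,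 and $Y_{\mathbf n}=Y_{\mathbf n,(1,1,1)}$. Let $\mathbb S_h(c)$ be the set of points of the spatial grid at maximum-norm distance $h$ from $c$. The grid is $[n_1]\times[n_2]$, except in the functional below, where it is the grid $[l_1]\times[l_2]$ of the array. Let $c_{j_1j_2}=\big(\lfloor\frac{(2j_1-1)r_1+1}2\rfloor,\lfloor\frac{(2j_2-1)r_2+1}2\rfloor\big)$ and $c=c_{11}$. For an $l_1\times l_2\times l_3$ array $x$ with centre $c_x=(\lfloor\frac{l_1+1}2\rfloor,\lfloor\frac{l_2+1}2\rfloor)$ put $$f_{A,B,h_s,h_t}(x)=\sum_{\mathbf i\in\mathbb S_{h_s}(c_x)}\sum_{t=1}^{l_3-h_t}\frac{\mathbb I\{x_{(c_x,t)}\in A,\ x_{(\mathbf i,t+h_t)}\in B\}}{\#\mathbb S_{h_s}(c_x)},\qquad \mathcal F=\{f_{A,B,h_s,h_t}:h_s,h_t\in\mathbb N_0\}\cup\{f_{A,A,0,0}\}.$$ The estimator is $$\widehat{\rho^*}_{A,B}(h_s,h_t)=\frac{\sum_{(j_1,j_2)\in[m_1]\times[m_2]}\sum_{t=1}^{n_3-h_t}\sum_{\mathbf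 i\in\mathbb S_{h_s}(c_{j_1j_2})}\frac{\mathbb I\{u_n^{-1}X_{t+h_t}(\mathbf i)\in B,\ u_n^{-1}X_t(c_{j_1j_2})\in A\}}{\#\mathbb S_{h_s}(c_{j_1j_2})}}{\sum_{(j_1,j_2)\in[m_1]\times[m_2]}\sum_{t=1}^{n_3}\mathbb I\{u_n^{-1}X_t(c_{j_1j_2})\in A\}},$$ and $\rho^*_{A,B,n}(h_s,h_t)=\mathbb P(u_n^{-1}X_{h_t}(h_s\vec e_1)\in B\mid u_n^{-1}X_0(\mathbf 0)\in A)$. The iso-extremogram is $\rho^*_{A,B}(h_s,h_t)=\lim_n\rho^*_{A,B,n}(h_s,h_t)$. *Assumptions.* 1. $X$ is stationary in space and time, and (I) holds: for all Borel sets $C,D$ bounded away from zero and all $h_s,h_t\in\mathbb N_0$, the probability $\mathbb P(X_0(\mathbf 0)\in C,X_{h_t}(\mathbf s)\in D)$ is the same for all $\mathbf s\in\mathbb Z^2$ with $\|\mathbf s\|_\infty=h_s$. 2. For some $k_n\to\infty$ with $k_n=o(n)$, and for all $p$ and all $(\mathbf s_i,t_i)\in\mathbb Z^2\times[0,\infty)$,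 the measures $k_n\mathbb P(u_n^{-1}(X_{t_1}(\mathbf s_1),\dots,X_{t_p}(\mathbf s_p))\in\cdot)$ converge vaguely on $\overline{\mathbb R}^{kp}\setminus\{\mathbf 0\}$ to Radon measures $m_{(\mathbf s_1,t_1),\dots,(\mathbf s_p,t_p)}$. These are not all null and do not charge $\overline{\mathbb R}^{kp}\setminus\mathbb R^{kp}$. Moreover $m_{(\mathbf 0,0)}(A)>0$, $m_{(\mathbf 0,0)}(\partial A)=0$, and $m_{(\mathbf 0,0),(h_s\vec e_1,h_t)}(\partial(A\times B))=0$ for all $h_s,h_t\in\mathbb N_0$. Further $r\ll v_n^{-1}\ll n$, $\sqrt{nv_n}\ll r\ll nv_nr_3$, $r_i\ll n_i$ and $r_i\to\infty$ for $i=1,2,3$. 3. (Cov') For all lags in $\mathbb N_0$, $$\sum_{\mathbf i\in\mathbb S_{h_s}(c)}\sum_{\mathbf i'\in\mathbb S_{h_s'}(c)}\sum_{t=1}^{r_3-h_t}\sum_{t'=1}^{r_3-h_t'}\frac{\mathbb P\big(u_n^{-1}X_t(c),u_n^{-1}X_{t'}(c)\in A,\ u_n^{-1}X_{t+h_t}(\mathbf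 i),u_n^{-1}X_{t'+h_t'}(\mathbf i')\in B\big)}{rv_n\,\#\mathbb S_{h_s}(c)\,\#\mathbb S_{h_s'}(c)}\to\sigma_{A,B}((h_s,h_t),(h_s',h_t')),$$ $$\sum_{\mathbf i\in\mathbb S_{h_s}(c)}\sum_{t=1}^{r_3-h_t}\sum_{t'=1}^{r_3}\frac{\mathbb P\big(u_n^{-1}X_t(c),u_n^{-1}X_{t'}(c)\in A,\ u_n^{-1}X_{t+h_t}(\mathbf i)\in B\big)}{rv_n\,\#\mathbb S_{h_s}(c)}\to\sigma'_{A,B}(h_s,h_t),$$ with finite limits, and the second sum with $B$ replaced by $A$ and $(h_s,h_t)=(0,0)$ converges to a finite limit $\sigma'_{A,A}(\mathbf 0)$. (C) On the incomplete time block (an empty sum if $r_3$ divides $n_3$), $$\sum_{(j_1,j_2),(j_1',j_2')\in[m_1]\times[m_2]}\ \sum_{t,t'=m_3r_3+1}^{n_3}\mathbb P\big(u_n^{-1}X_t(c_{j_1j_2})\in A,\ u_n^{-1}X_{t'}(c_{j_1'j_2'})\in A\big)=o(nv_n).$$ (Lin) For all $f\in\mathcal F$ and $\epsilon>0$, $(rv_n)^{-1}\mathbb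 E\big[(f(Y_{\mathbf n})-\mathbb Ef(Y_{\mathbf n}))^2\,\mathbb I\{|f(Y_{\mathbf n})-\mathbb Ef(Y_{\mathbf n})|>\epsilon\sqrt{nv_n}\}\big]\to0$. ($T^*$) For all $q\in\mathbb N_0$, all $f_1,\dots,f_q\in\mathcal F$ and all $\mathbf t\in\mathbb R^q$, $$\sum_{j\in D_{\mathbf n}}\Big|\operatorname{Cov}\Big(\exp\big(\mathrm i\langle\mathbf t,\textstyle\sum_{j'>j}W_{\mathbf n,j'}\rangle\big),\exp\big(\mathrm i\langle\mathbf t,W_{\mathbf n,j}\rangle\big)\Big)\Big|\to0,$$ where $W_{\mathbf n,j}=(nv_n)^{-1/2}(f_i(Y_{\mathbf n,j})-\mathbb Ef_i(Y_{\mathbf n,j}))_{i\le q}$, $j'>j$ is the lexicographic order on $D_{\mathbf n}$, and $\operatorname{Cov}(U,V)=\mathbb E[UV]-\mathbb E[U]\mathbb E[V]$. *Conclusion.* The limits $\rho^*_{A,B}(h_s,h_t)$ exist, and for all $L_s,L_t\in\mathbb N_0$, as $\mathbf n\to\infty$, $$\frac{\sqrt{nv_n}}{r_1r_2}\Big(\widehat{\rho^*}_{A,B}(h_s,h_t)-\rho^*_{A,B,n}(h_s,h_t)\Big)_{0\le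 h_s\le L_s,\ 0\le h_t\le L_t}\ \xrightarrow{\ \mathcal D\ }\ \mathcal N(0,\Sigma_{A,B,L_s,L_t}),$$ where $\Sigma_{A,B,L_s,L_t}$ is the positive semidefinite (possibly singular) matrix with entries $$\sigma_{A,B}(\mathbf h,\mathbf h')-\rho^*_{A,B}(\mathbf h')\sigma'_{A,B}(\mathbf h)-\rho^*_{A,B}(\mathbf h)\sigma'_{A,B}(\mathbf h')+\rho^*_{A,B}(\mathbf h)\rho^*_{A,B}(\mathbf h')\sigma'_{A,A}(\mathbf 0),\qquad \mathbf h,\mathbf h'\in\{0,\dots,L_s\}\times\{0,\dots,L_t\}.$$ -/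

import Mathlib

open MeasureTheory ProbabilityTheory Filter Topology Asymptotics
open scoped NNReal ENNReal

namespace SpaceTime

noncomputable section

/-- An `ℝ^d`-valued space-time process on `ℤ² × [0, ∞)`. -/
abbrev RandomField (Ω : Type*) (d : ℕ) := ℤ × ℤ → ℝ≥0 → Ω → (Fin d → ℝ)

/-- A real functional of finite three-dimensional arrays of vectors. The first argument holds the
side lengths `(l₁, l₂, l₃)` of the array, the second one its entries, at the indices of
`[l₁] × [l₂] × [l₃]` (indices start at one; entries elsewhere are not part of the array). -/
abbrev BlockFunctional (d : ℕ) := (Fin 3 → ℕ) → (ℕ × ℕ × ℕ → (Fin d → ℝ)) → ℝ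

/-! ### Assumptions on the process -/

/-- Stationarity in space and time: finite-dimensional laws are invariant under shifts. -/
def Stationary {Ω : Type*} [MeasurableSpace Ω] {d : ℕ} (P : Measure Ω) (X : RandomField Ω d) : Prop :=
  ∀ (p : ℕ) (s : Fin p → ℤ × ℤ) (t : Fin p → ℝ≥0) (a : ℤ × ℤ) (τ : ℝ≥0),
    P.map (fun ω i => X (s i + a) (t i + τ) ω) = P.map (fun ω i => X (s i) (t i) ω)

/-- A set of vectors is bounded away from zero. -/
def BoundedAwayFromZero {d : ℕ} (C : Set (Fin d → ℝ)) : Prop :=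
  ∃ ε : ℝ, 0 < ε ∧ ∀ x ∈ C, ε ≤ ‖x‖

/-- Condition (I): for Borel sets bounded away from zero, the joint probabilities at the origin
and at the lag `(s, h_t)` depend on `s` through its maximum norm only. -/
def Isotropic {Ω : Type*} [MeasurableSpace Ω] {d : ℕ} (P : Measure Ω) (X : RandomField Ω d) : Prop :=
  ∀ C D : Set (Fin d → ℝ), MeasurableSet C → MeasurableSet D →
    BoundedAwayFromZero C → BoundedAwayFromZero D →
    ∀ (hs ht : ℕ) (s s' : ℤ × ℤ), max |s.1| |s.2| = (hs : ℤ) → max |s'.1| |s'.2| = (hs : ℤ) →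
      P {ω | X (0, 0) 0 ω ∈ C ∧ X s ht ω ∈ D} = P {ω | X (0, 0) 0 ω ∈ C ∧ X s' ht ω ∈ D}

/-- The inclusion of `(ℝ^d)^p` in its compactification `[-∞, ∞]^{dp}`. -/
def toExtended {p d : ℕ} (x : Fin p → Fin d → ℝ) : Fin p → Fin d → EReal :=
  fun i j => ((x i j : ℝ) : EReal)

/-- `k_n P(u_n⁻¹ (X_{t_1}(s_1), …, X_{t_p}(s_p)) ∈ ·)` converges vaguely on `[-∞, ∞]^{dp} ∖ {0}` to
the Radon measure `m p ((s_1, t_1), …, (s_p, t_p))`, for all finite families of space-time points.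
A measure on the punctured space is represented by a measure on `[-∞, ∞]^{dp}` without mass at `0`;
as that space is compact, the compact subsets of the punctured space are the closed sets which do
not contain `0`, and its compactly supported continuous functions are the restrictions of the
continuous functions whose closed support does not contain `0`. -/
structure VagueRegularVariation {Ω : Type*} [MeasurableSpace Ω] {d : ℕ} (P : Measure Ω)
    (X : RandomField Ω d) (u k : ℕ → ℝ)
    (m : (p : ℕ) → (Fin p → (ℤ × ℤ) × ℝ≥0) → Measure (Fin p → Fin d → EReal)) : Prop where
  no_mass_zero : ∀ p z, m p z {0} = 0
  radon : ∀ p z (K : Set (Fin p → Fin d → EReal)), IsClosed K → 0 ∉ K → m p z K < ∞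
  not_all_null : ∃ p z, m p z ≠ 0
  no_mass_infinity : ∀ p z, m p z (Set.range toExtended)ᶜ = 0
  vague : ∀ (p : ℕ) (z : Fin p → (ℤ × ℤ) × ℝ≥0) (g : (Fin p → Fin d → EReal) → ℝ),
    Continuous g → 0 ∉ tsupport g →
    Tendsto (fun n => k n *
        ∫ ω, g (toExtended (fun i => (u n)⁻¹ • X (z i).1 (z i).2 ω)) ∂P)
      atTop (𝓝 (∫ x, g x ∂(m p z)))

/-! ### Normalised observations, blocks and functionals -/

/-- The sample size `n = n₁ n₂ n₃`. -/
def sampleSize (n : Fin 3 → ℕ) : ℕ := n 0 * n 1 * n 2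

/-- The side lengths `r_i = r_{n_i}` of the blocks. -/
def blockDim (r : Fin 3 → ℕ → ℕ) (n : Fin 3 → ℕ) (i : Fin 3) : ℕ := r i (n i)

/-- The volume `r = r₁ r₂ r₃` of the blocks. -/
def blockVol (r : Fin 3 → ℕ → ℕ) (n : Fin 3 → ℕ) : ℕ :=
  blockDim r n 0 * blockDim r n 1 * blockDim r n 2

/-- The number `m_i`, the integer part of `n_i / r_i`, of complete blocks in direction `i`. -/
def numBlocks (r : Fin 3 → ℕ → ℕ) (n : Fin 3 → ℕ) (i : Fin 3) : ℕ := n i / blockDim r n i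

/-- The index set `[m₁] × [m₂] × [m₃]` of the complete blocks. -/
def blockIndices (r : Fin 3 → ℕ → ℕ) (n : Fin 3 → ℕ) : Finset (ℕ × ℕ × ℕ) :=
  Finset.Icc 1 (numBlocks r n 0) ×ˢ Finset.Icc 1 (numBlocks r n 1) ×ˢ
    Finset.Icc 1 (numBlocks r n 2)

/-- The exceedance probability `v_N = P(u_N⁻¹ X_0(0) ∈ A)`. -/
def exceedProb {Ω : Type*} [MeasurableSpace Ω] {d : ℕ} (P : Measure Ω) (X : RandomField Ω d)
    (A : Set (Fin d → ℝ)) (u : ℕ → ℝ) (N : ℕ) : ℝ :=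
  P.real {ω | (u N)⁻¹ • X (0, 0) 0 ω ∈ A}

/-- The normalised observation `u_n⁻¹ X_t(i₁, i₂)` at the point `(i₁, i₂, t)`. -/
def normalizedObs {Ω : Type*} {d : ℕ} (X : RandomField Ω d) (u : ℕ → ℝ) (n : Fin 3 → ℕ)
    (z : ℕ × ℕ × ℕ) (ω : Ω) : Fin d → ℝ :=
  (u (sampleSize n))⁻¹ • X ((z.1 : ℤ), (z.2.1 : ℤ)) (z.2.2 : ℝ≥0) ω

/-- The block `Y_{n, j₁ j₂ j₃}`: the normalised observations at the points of
`∏ i, [(j_i - 1) r_i + 1 : j_i r_i]`, indexed by `[r₁] × [r₂] × [r₃]`. -/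
def block {Ω : Type*} {d : ℕ} (X : RandomField Ω d) (u : ℕ → ℝ) (r : Fin 3 → ℕ → ℕ) (n : Fin 3 → ℕ)
    (j : ℕ × ℕ × ℕ) (ω : Ω) (z : ℕ × ℕ × ℕ) : Fin d → ℝ :=
  normalizedObs X u n ((j.1 - 1) * blockDim r n 0 + z.1,
    (j.2.1 - 1) * blockDim r n 1 + z.2.1, (j.2.2 - 1) * blockDim r n 2 + z.2.2) ω

/-- The value `f(Y_{n, j})` of a functional on a block. -/
def onBlock {Ω : Type*} {d : ℕ} (X : RandomField Ω d) (u : ℕ → ℝ) (r : Fin 3 → ℕ → ℕ)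
    (f : BlockFunctional d) (n : Fin 3 → ℕ) (j : ℕ × ℕ × ℕ) (ω : Ω) : ℝ :=
  f (blockDim r n) (block X u r n j ω)

/-- The points of `[a] × [b]` at maximum-norm distance `h` from `c`. -/
def sphere (a b h : ℕ) (c : ℕ × ℕ) : Finset (ℕ × ℕ) :=
  (Finset.Icc 1 a ×ˢ Finset.Icc 1 b).filter
    (fun i => max |(c.1 : ℤ) - (i.1 : ℤ)| |(c.2 : ℤ) - (i.2 : ℤ)| = (h : ℤ))

/-- The centre of `[a] × [b]` (with integer parts). -/
def center (a b : ℕ) : ℕ × ℕ := ((a + 1) / 2, (b + 1) / 2)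

/-- The centre `c_{j₁ j₂}` of the spatial block with index `(j₁, j₂)` and side lengths `a`, `b`. -/
def blockCenter (a b : ℕ) (j : ℕ × ℕ) : ℕ × ℕ :=
  (((2 * j.1 - 1) * a + 1) / 2, ((2 * j.2 - 1) * b + 1) / 2)

/-- The functional `f_{A, B, h₁, h₂}`. -/
def extremalFunctional {d : ℕ} (A B : Set (Fin d → ℝ)) (h₁ h₂ : ℕ) : BlockFunctional d :=
  fun l x =>
    let c := center (l 0) (l 1)
    ∑ i ∈ sphere (l 0) (l 1) h₁ c, ∑ t ∈ Finset.Icc 1 (l 2 - h₂),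
      (A ×ˢ B).indicator (fun _ => (1 : ℝ)) (x (c.1, c.2, t), x (i.1, i.2, t + h₂)) /
        ((sphere (l 0) (l 1) h₁ c).card : ℝ)

/-- The family `{f_{A, B, h_s, h_t} : h_s, h_t ≥ 0}` together with `f_{A, A, 0, 0}`. -/
def extremalFamily {d : ℕ} (A B : Set (Fin d → ℝ)) : Set (BlockFunctional d) :=
  {f | ∃ hs ht : ℕ, f = extremalFunctional A B hs ht} ∪ {extremalFunctional A A 0 0}

/-! ### The Lindeberg and dependence conditions -/

/-- `f(Y_{n, j}) - E f(Y_{n, j})`. -/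
def centered {Ω : Type*} [MeasurableSpace Ω] {d : ℕ} (P : Measure Ω) (X : RandomField Ω d)
    (u : ℕ → ℝ) (r : Fin 3 → ℕ → ℕ) (f : BlockFunctional d) (n : Fin 3 → ℕ) (j : ℕ × ℕ × ℕ)
    (ω : Ω) : ℝ :=
  onBlock X u r f n j ω - ∫ ω', onBlock X u r f n j ω' ∂P

/-- The number `n v_n`. -/
def sizeProb {Ω : Type*} [MeasurableSpace Ω] {d : ℕ} (P : Measure Ω) (X : RandomField Ω d)
    (A : Set (Fin d → ℝ)) (u : ℕ → ℝ) (n : Fin 3 → ℕ) : ℝ :=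
  (sampleSize n : ℝ) * exceedProb P X A u (sampleSize n)

/-- The number `r v_n`. -/
def volProb {Ω : Type*} [MeasurableSpace Ω] {d : ℕ} (P : Measure Ω) (X : RandomField Ω d)
    (A : Set (Fin d → ℝ)) (u : ℕ → ℝ) (r : Fin 3 → ℕ → ℕ) (n : Fin 3 → ℕ) : ℝ :=
  (blockVol r n : ℝ) * exceedProb P X A u (sampleSize n)

/-- Condition (Lin) for a family of functionals. -/
def Lindeberg {Ω : Type*} [MeasurableSpace Ω] {d : ℕ} (P : Measure Ω) (X : RandomField Ω d)
    (A : Set (Fin d → ℝ)) (u : ℕ → ℝ) (r : Fin 3 → ℕ → ℕ) (𝓁 : Filter (Fin 3 → ℕ))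
    (F : Set (BlockFunctional d)) : Prop :=
  ∀ f ∈ F, ∀ ε : ℝ, 0 < ε →
    Tendsto (fun n => (volProb P X A u r n)⁻¹ *
        ∫ ω, {ω' | ε * √(sizeProb P X A u n) < |centered P X u r f n (1, 1, 1) ω'|}.indicator
          (fun ω' => centered P X u r f n (1, 1, 1) ω' ^ 2) ω ∂P)
      𝓁 (𝓝 0)

/-- `⟨t, W_{n, j}⟩`, where `W_{n, j}` is the vector of the
`(n v_n)^{-1/2} (f_i(Y_{n, j}) - E f_i(Y_{n, j}))`. -/
def pairing {Ω : Type*} [MeasurableSpace Ω] {d : ℕ} (P : Measure Ω) (X : RandomField Ω d)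
    (A : Set (Fin d → ℝ)) (u : ℕ → ℝ) (r : Fin 3 → ℕ → ℕ) {k : ℕ} (f : Fin k → BlockFunctional d)
    (t : Fin k → ℝ) (n : Fin 3 → ℕ) (j : ℕ × ℕ × ℕ) (ω : Ω) : ℝ :=
  ∑ i, t i * ((√(sizeProb P X A u n))⁻¹ * centered P X u r (f i) n j ω)

/-- The complete blocks which come strictly after `j` in the lexicographic order. -/
def laterBlocks (r : Fin 3 → ℕ → ℕ) (n : Fin 3 → ℕ) (j : ℕ × ℕ × ℕ) : Finset (ℕ × ℕ × ℕ) :=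
  (blockIndices r n).filter (fun q => j.1 < q.1 ∨ (q.1 = j.1 ∧ j.2.1 < q.2.1) ∨
    (q.1 = j.1 ∧ q.2.1 = j.2.1 ∧ j.2.2 < q.2.2))

/-- The covariance `E[UV] - E[U] E[V]` of two complex random variables. -/
def complexCov {Ω : Type*} [MeasurableSpace Ω] (P : Measure Ω) (U V : Ω → ℂ) : ℂ :=
  (∫ ω, U ω * V ω ∂P) - (∫ ω, U ω ∂P) * ∫ ω, V ω ∂P

/-- The dependence coefficient `T*_{n, t}(f_1, …, f_k)`. -/
def depCoeff {Ω : Type*} [MeasurableSpace Ω] {d : ℕ} (P : Measure Ω) (X : RandomField Ω d)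
    (A : Set (Fin d → ℝ)) (u : ℕ → ℝ) (r : Fin 3 → ℕ → ℕ) {k : ℕ} (f : Fin k → BlockFunctional d)
    (t : Fin k → ℝ) (n : Fin 3 → ℕ) : ℝ :=
  ∑ j ∈ blockIndices r n,
    ‖complexCov P
      (fun ω => Complex.exp
        (Complex.I * ((∑ q ∈ laterBlocks r n j, pairing P X A u r f t n q ω : ℝ) : ℂ)))
      (fun ω => Complex.exp (Complex.I * ((pairing P X A u r f t n j ω : ℝ) : ℂ)))‖

/-- The first sum of condition (Cov'), for the lags `h` and `h'`. -/
def covSum {Ω : Type*} [MeasurableSpace Ω] {d : ℕ} (P : Measure Ω) (X : RandomField Ω d)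
    (A B : Set (Fin d → ℝ)) (u : ℕ → ℝ) (r : Fin 3 → ℕ → ℕ) (h h' : ℕ × ℕ) (n : Fin 3 → ℕ) : ℝ :=
  let c := center (blockDim r n 0) (blockDim r n 1)
  ∑ i ∈ sphere (n 0) (n 1) h.1 c, ∑ i' ∈ sphere (n 0) (n 1) h'.1 c,
    ∑ t ∈ Finset.Icc 1 (blockDim r n 2 - h.2), ∑ t' ∈ Finset.Icc 1 (blockDim r n 2 - h'.2),
      P.real {ω | normalizedObs X u n (c.1, c.2, t) ω ∈ A ∧
          normalizedObs X u n (c.1, c.2, t') ω ∈ A ∧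
          normalizedObs X u n (i.1, i.2, t + h.2) ω ∈ B ∧
          normalizedObs X u n (i'.1, i'.2, t' + h'.2) ω ∈ B} /
        (volProb P X A u r n * ((sphere (n 0) (n 1) h.1 c).card : ℝ) *
          ((sphere (n 0) (n 1) h'.1 c).card : ℝ))

/-- The second sum of condition (Cov'), for the lag `h`. -/
def crossCovSum {Ω : Type*} [MeasurableSpace Ω] {d : ℕ} (P : Measure Ω) (X : RandomField Ω d)
    (A B : Set (Fin d → ℝ)) (u : ℕ → ℝ) (r : Fin 3 → ℕ → ℕ) (h : ℕ × ℕ) (n : Fin 3 → ℕ) : ℝ :=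
  let c := center (blockDim r n 0) (blockDim r n 1)
  ∑ i ∈ sphere (n 0) (n 1) h.1 c,
    ∑ t ∈ Finset.Icc 1 (blockDim r n 2 - h.2), ∑ t' ∈ Finset.Icc 1 (blockDim r n 2),
      P.real {ω | normalizedObs X u n (c.1, c.2, t) ω ∈ A ∧
          normalizedObs X u n (c.1, c.2, t') ω ∈ A ∧
          normalizedObs X u n (i.1, i.2, t + h.2) ω ∈ B} /
        (volProb P X A u r n * ((sphere (n 0) (n 1) h.1 c).card : ℝ))

/-- The index set `[m₁] × [m₂]` of the spatial blocks. -/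
def spatialIndices (r : Fin 3 → ℕ → ℕ) (n : Fin 3 → ℕ) : Finset (ℕ × ℕ) :=
  Finset.Icc 1 (numBlocks r n 0) ×ˢ Finset.Icc 1 (numBlocks r n 1)

/-- The sum of condition (C), over the block centres and over the times of the incomplete time
block `[m₃ r₃ + 1 : n₃]`. -/
def incompleteSum {Ω : Type*} [MeasurableSpace Ω] {d : ℕ} (P : Measure Ω) (X : RandomField Ω d)
    (A : Set (Fin d → ℝ)) (u : ℕ → ℝ) (r : Fin 3 → ℕ → ℕ) (n : Fin 3 → ℕ) : ℝ :=
  let c := blockCenter (blockDim r n 0) (blockDim r n 1)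
  let times := Finset.Icc (numBlocks r n 2 * blockDim r n 2 + 1) (n 2)
  ∑ j ∈ spatialIndices r n, ∑ j' ∈ spatialIndices r n, ∑ t ∈ times, ∑ t' ∈ times,
    P.real {ω | normalizedObs X u n ((c j).1, (c j).2, t) ω ∈ A ∧
      normalizedObs X u n ((c j').1, (c j').2, t') ω ∈ A}

/-! ### The iso-extremogram and its estimator -/

/-- The pre-asymptotic iso-extremogram
`P(u_N⁻¹ X_{h_t}(h_s e₁) ∈ B | u_N⁻¹ X_0(0) ∈ A)`. -/
def preIsoExtremogram {Ω : Type*} [MeasurableSpace Ω] {d : ℕ} (P : Measure Ω) (X : RandomField Ω d)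
    (A B : Set (Fin d → ℝ)) (u : ℕ → ℝ) (hs ht : ℕ) (N : ℕ) : ℝ :=
  P.real {ω | (u N)⁻¹ • X (0, 0) 0 ω ∈ A ∧ (u N)⁻¹ • X ((hs : ℤ), 0) (ht : ℝ≥0) ω ∈ B} /
    P.real {ω | (u N)⁻¹ • X (0, 0) 0 ω ∈ A}

/-- The iso-extremogram: the limit of the pre-asymptotic ones (meaningful when it exists). -/
def isoExtremogram {Ω : Type*} [MeasurableSpace Ω] {d : ℕ} (P : Measure Ω) (X : RandomField Ω d)
    (A B : Set (Fin d → ℝ)) (u : ℕ → ℝ) (hs ht : ℕ) : ℝ :=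
  limUnder atTop (preIsoExtremogram P X A B u hs ht)

/-- The sample iso-extremogram. -/
def sampleIsoExtremogram {Ω : Type*} {d : ℕ} (X : RandomField Ω d)
    (A B : Set (Fin d → ℝ)) (u : ℕ → ℝ) (r : Fin 3 → ℕ → ℕ) (hs ht : ℕ) (n : Fin 3 → ℕ)
    (ω : Ω) : ℝ :=
  let c := blockCenter (blockDim r n 0) (blockDim r n 1)
  (∑ j ∈ spatialIndices r n, ∑ t ∈ Finset.Icc 1 (n 2 - ht),
      ∑ i ∈ sphere (n 0) (n 1) hs (c j),
        (A ×ˢ B).indicator (fun _ => (1 : ℝ))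
          (normalizedObs X u n ((c j).1, (c j).2, t) ω,
            normalizedObs X u n (i.1, i.2, t + ht) ω) /
          ((sphere (n 0) (n 1) hs (c j)).card : ℝ)) /
    ∑ j ∈ spatialIndices r n, ∑ t ∈ Finset.Icc 1 (n 2),
      A.indicator (fun _ => (1 : ℝ)) (normalizedObs X u n ((c j).1, (c j).2, t) ω)

/-- The asymptotic covariance matrix, from the limits `σ = σ_{A,B}`, `σ' = σ'_{A,B}`,
`σ₀ = σ'_{A,A}(0)` and the iso-extremogram `ρ`. -/
def asymptoticCov (σ : ℕ × ℕ → ℕ × ℕ → ℝ) (σ' : ℕ × ℕ → ℝ) (σ₀ : ℝ) (ρ : ℕ → ℕ → ℝ) (Ls Lt : ℕ) :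
    Matrix (Fin (Ls + 1) × Fin (Lt + 1)) (Fin (Ls + 1) × Fin (Lt + 1)) ℝ :=
  fun a b =>
    let h : ℕ × ℕ := (a.1, a.2)
    let h' : ℕ × ℕ := (b.1, b.2)
    σ h h' - ρ h'.1 h'.2 * σ' h - ρ h.1 h.2 * σ' h' + ρ h.1 h.2 * ρ h'.1 h'.2 * σ₀

/-- The rescaled estimation error
`√(n v_n) / (r₁ r₂) (ρ̂*_{A,B}(h_s, h_t) - ρ*_{A,B,n}(h_s, h_t))`, `h_s ≤ L_s`, `h_t ≤ L_t`. -/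
def rescaledError {Ω : Type*} [MeasurableSpace Ω] {d : ℕ} (P : Measure Ω) (X : RandomField Ω d)
    (A B : Set (Fin d → ℝ)) (u : ℕ → ℝ) (r : Fin 3 → ℕ → ℕ) (Ls Lt : ℕ) (n : Fin 3 → ℕ) (ω : Ω) :
    EuclideanSpace ℝ (Fin (Ls + 1) × Fin (Lt + 1)) :=
  WithLp.toLp 2 (fun a => √(sizeProb P X A u n) / ((blockDim r n 0 : ℝ) * (blockDim r n 1 : ℝ)) *
    (sampleIsoExtremogram X A B u r a.1 a.2 n ω -
      preIsoExtremogram P X A B u a.1 a.2 (sampleSize n)))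

end

end SpaceTime

namespace SpaceTime

/-! ### Characteristic functions of sums -/

/-! Write the estimator at lag h as N_h / D, and put a_n = √(n v_n)/(r₁r₂). The rescaled error is
the quotient of (n v_n)^{-1/2} (N_h − ρ_n D) by r₁r₂ D/(n v_n), so the theorem is a central limit
theorem for the first quantity followed by a Slutsky argument for the second.

Numerator. For large blocks the spheres around the centres stay inside their blocks, so N_h and D
are block sums of f_{A,B,h} and f_{A,A,0,0} up to boundary terms. These terms are bounded by
exceedance counts: those of the last h_t times of each block are negligible because √(n v_n) ≪ r,
those of the incomplete time block because of (C) (`tendstoZeroInProb_blockRemainder`). By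
stationarity and isotropy the block means are (r₃ − h_t) v_n ρ_n and r₃ v_n, so they cancel in N_h −
ρ_n D up to a bias of the same negligible order. What remains is S_h − ρ S_A, where S_h and S_A are
the normalised centred block sums (`blockSum`).

Limit law of the block sums. Condition (T*) replaces the characteristic function of a linear
combination of block sums by a product over blocks (`norm_integral_exp_sum_sub_prod_le`), which is a
power because the blocks are identically distributed. (Cov') gives its limiting variance, since
centring changes second moments by at most (r v_n)² = o(r v_n), and (Lin) gives the Gaussian limit
(`tendsto_charFun_pow`). The result is `tendsto_charFun_blockSum`.

Denominator. It equals e_n + T_n/a_n, where e_n → 1 is the fraction of the sample covered by blocks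
and T_n = S_A + o_P(1). If σ'_{A,A}(0) > 0, the Lindeberg condition itself forces a_n → ∞
(`tendsto_scale_atTop`), so the denominator tends to 1. If σ'_{A,A}(0) = 0, the domination 0 ≤
f_{A,B,h} ≤ f_{A,A,0,0} makes all limiting variances vanish, and T_n → 0 in probability. The error
is trivially at most a_n, so it can only be non-negligible where a_n is bounded below, and there the
denominator is again close to 1 (`tendstoZeroInProb_ratio`).

Regular variation enters through a portmanteau argument on the punctured compactification: it gives
the limits ρ and the eventual positivity of v_n. -/

lemma norm_exp_I_mul_ofReal (x : ℝ) : ‖Complex.exp (Complex.I * (x : ℂ))‖ = 1 := by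
  rw [mul_comm]; exact Complex.norm_exp_ofReal_mul_I x

lemma integrable_exp_I_mul {Ω : Type*} [MeasurableSpace Ω] (P : Measure Ω) [IsFiniteMeasure P]
    {ξ : Ω → ℝ} (hξ : Measurable ξ) :
    Integrable (fun ω => Complex.exp (Complex.I * (ξ ω : ℂ))) P := by
  refine Integrable.of_bound (C := 1) (by fun_prop) (ae_of_all _ fun ω => ?_)
  rw [norm_exp_I_mul_ofReal]

lemma norm_integral_exp_I_mul_le_one {Ω : Type*} [MeasurableSpace Ω] (P : Measure Ω)
    [IsProbabilityMeasure P] (ξ : Ω → ℝ) :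
    ‖∫ ω, Complex.exp (Complex.I * (ξ ω : ℂ)) ∂P‖ ≤ 1 := by
  refine (norm_integral_le_integral_norm _).trans ?_
  simp

/-- The characteristic function of a sum differs from the product of the characteristic functions
by at most the sum of the covariances between each term and the sum of the later terms. -/
lemma norm_integral_exp_sum_sub_prod_le {Ω ι L : Type*} [MeasurableSpace Ω] [LinearOrder L]
    [DecidableEq ι] (e : ι → L) (he : Function.Injective e) (P : Measure Ω)
    [IsProbabilityMeasure P] (ξ : ι → Ω → ℝ) (D : Finset ι) :
    ‖(∫ ω, Complex.exp (Complex.I * ((∑ j ∈ D, ξ j ω : ℝ) : ℂ)) ∂P) -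
        ∏ j ∈ D, ∫ ω, Complex.exp (Complex.I * (ξ j ω : ℂ)) ∂P‖ ≤
      ∑ j ∈ D, ‖complexCov P
        (fun ω => Complex.exp (Complex.I * ((∑ q ∈ D with e j < e q, ξ q ω : ℝ) : ℂ)))
        (fun ω => Complex.exp (Complex.I * (ξ j ω : ℂ)))‖ := by
  -- Inserting the smallest index last makes all old indices later than the new one and leaves the
  -- later sets of the old indices unchanged.
  induction D using Finset.induction_on_min_value e with
  | empty => simp
  | insert a s ha hmin ih =>
    have hlt : ∀ x ∈ s, e a < e x := fun x hx =>
      lt_of_le_of_ne (hmin x hx) fun h => ha (he h ▸ hx)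
    have h1 : (insert a s).filter (fun q => e a < e q) = s := by
      ext q
      simp only [Finset.mem_filter, Finset.mem_insert]
      constructor
      · rintro ⟨rfl | h, h'⟩
        · exact absurd h' (lt_irrefl _)
        · exact h
      · exact fun h => ⟨Or.inr h, hlt q h⟩
    have h2 : ∀ j ∈ s, (insert a s).filter (fun q => e j < e q) =
        s.filter (fun q => e j < e q) := by
      intro j hj
      rw [Finset.filter_insert, if_neg (not_lt.2 (hmin j hj))]
    rw [Finset.sum_insert ha, Finset.prod_insert ha, h1, Finset.sum_congr rfl
      (fun j hj => by rw [h2 j hj])]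
    set U : Ω → ℂ := fun ω => Complex.exp (Complex.I * ((∑ q ∈ s, ξ q ω : ℝ) : ℂ)) with hU
    set V : Ω → ℂ := fun ω => Complex.exp (Complex.I * (ξ a ω : ℂ)) with hV
    have h3 : (∫ ω, Complex.exp (Complex.I * ((∑ j ∈ insert a s, ξ j ω : ℝ) : ℂ)) ∂P)
        = ∫ ω, U ω * V ω ∂P := by
      refine integral_congr_ae (ae_of_all _ fun ω => ?_)
      simp only [hU, hV, ← Complex.exp_add, Finset.sum_insert ha]
      push_cast
      ring_nf
    -- Splitting off one factor costs one covariance; the remaining error is multiplied by E V,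
    -- whose modulus is at most 1, so errors add up without growing.
    have h4 : (∫ ω, U ω * V ω ∂P) - (∫ ω, V ω ∂P) *
        ∏ j ∈ s, ∫ ω, Complex.exp (Complex.I * (ξ j ω : ℂ)) ∂P =
        complexCov P U V + (∫ ω, V ω ∂P) *
          ((∫ ω, U ω ∂P) - ∏ j ∈ s, ∫ ω, Complex.exp (Complex.I * (ξ j ω : ℂ)) ∂P) := by
      rw [complexCov]; ring
    rw [h3, h4]
    refine (norm_add_le _ _).trans (add_le_add le_rfl ?_)
    rw [norm_mul]
    calc _ ≤ 1 * _ := mul_le_mul_of_nonneg_right (norm_integral_exp_I_mul_le_one P _)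
            (norm_nonneg _)
      _ ≤ _ := by rw [one_mul]; exact ih

/-- For |x| ≤ ε the cubic remainder is at most ε x². For |x| > ε the crude bound 2 + |x| + x²/2 is
absorbed into x² using 1 ≤ x²/ε² and |x| ≤ x²/ε, which is where the constant comes from. -/
lemma norm_exp_I_mul_sub_taylor_le {ε : ℝ} (hε : 0 < ε) (hε1 : ε ≤ 1) (x : ℝ) :
    ‖Complex.exp (Complex.I * (x : ℂ)) - (1 + Complex.I * (x : ℂ) - (x : ℂ) ^ 2 / 2)‖ ≤
      ε * x ^ 2 + (2 / ε ^ 2 + 1 / ε + 1) * ({y : ℝ | ε < |y|}.indicator (fun y => y ^ 2) x) := by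
  by_cases hx : ε < |x|
  · rw [Set.indicator_of_mem (by exact hx)]
    have h1 : ‖Complex.exp (Complex.I * (x : ℂ)) - (1 + Complex.I * (x : ℂ) - (x : ℂ) ^ 2 / 2)‖ ≤
        1 + (1 + |x| + |x| ^ 2 / 2) := by
      refine (norm_sub_le _ _).trans (add_le_add (norm_exp_I_mul_ofReal x).le ?_)
      refine (norm_sub_le _ _).trans (add_le_add ((norm_add_le _ _).trans ?_) ?_)
      · simp
      · simp
    have h2 : 1 ≤ |x| / ε := by rw [one_le_div hε]; exact hx.le
    have h3 : (1 : ℝ) ≤ x ^ 2 / ε ^ 2 := by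
      rw [← sq_abs, ← div_pow]; exact one_le_pow₀ h2
    have h4 : |x| ≤ x ^ 2 / ε := by
      rw [← sq_abs, le_div_iff₀ hε, sq]
      exact mul_le_mul_of_nonneg_left hx.le (abs_nonneg x)
    have h5 : 0 ≤ ε * x ^ 2 := by positivity
    have h6 : (2 / ε ^ 2 + 1 / ε + 1) * x ^ 2 = 2 * (x ^ 2 / ε ^ 2) + x ^ 2 / ε + x ^ 2 := by ring
    rw [h6]
    rw [sq_abs] at h1
    nlinarith [sq_nonneg x]
  · rw [Set.indicator_of_notMem (by exact hx), mul_zero, add_zero]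
    push Not at hx
    have hn : ‖Complex.I * (x : ℂ)‖ = |x| := by simp
    have h1 := Complex.exp_bound (x := Complex.I * (x : ℂ)) (hn.trans_le (hx.trans hε1))
      (n := 3) (by norm_num)
    have h2 : ∑ m ∈ Finset.range 3, (Complex.I * (x : ℂ)) ^ m / (m.factorial : ℂ) =
        1 + Complex.I * (x : ℂ) - (x : ℂ) ^ 2 / 2 := by
      simp only [Finset.sum_range_succ, Finset.sum_range_zero, mul_pow, Complex.I_sq]
      simp [Nat.factorial]
      ring
    rw [h2, hn] at h1
    refine h1.trans ?_
    have h3 : |x| ^ 3 ≤ ε * x ^ 2 := by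
      rw [← sq_abs x, pow_succ, mul_comm]
      exact mul_le_mul_of_nonneg_right hx (sq_nonneg _)
    have h4 : (((3 : ℕ).succ : ℝ) * (((3 : ℕ).factorial : ℝ) * (3 : ℕ))⁻¹) ≤ 1 := by
      norm_num [Nat.factorial]
    calc _ ≤ |x| ^ 3 * 1 := mul_le_mul_of_nonneg_left h4 (by positivity)
      _ ≤ _ := by rw [mul_one]; exact h3

lemma norm_charFun_sub_taylor_le {Ω : Type*} [MeasurableSpace Ω] (P : Measure Ω)
    [IsProbabilityMeasure P] {ξ : Ω → ℝ} (hξ : MemLp ξ 2 P) (hm : Measurable ξ)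
    (h0 : ∫ ω, ξ ω ∂P = 0) {ε : ℝ} (hε : 0 < ε) (hε1 : ε ≤ 1) :
    ‖(∫ ω, Complex.exp (Complex.I * (ξ ω : ℂ)) ∂P) - (1 - ((∫ ω, ξ ω ^ 2 ∂P : ℝ) : ℂ) / 2)‖ ≤
      ε * (∫ ω, ξ ω ^ 2 ∂P) + (2 / ε ^ 2 + 1 / ε + 1) *
        ∫ ω, {ω' | ε < |ξ ω'|}.indicator (fun ω' => ξ ω' ^ 2) ω ∂P := by
  have hi2 : Integrable (fun ω => ξ ω ^ 2) P := hξ.integrable_sq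
  have hi1 : Integrable ξ P := hξ.integrable (by norm_num)
  have hms : MeasurableSet {ω' | ε < |ξ ω'|} := measurableSet_lt measurable_const hm.abs
  have hi3 : Integrable ({ω' | ε < |ξ ω'|}.indicator (fun ω' => ξ ω' ^ 2)) P :=
    hi2.indicator hms
  have hi1c : Integrable (fun ω => (ξ ω : ℂ)) P := hi1.ofReal
  have hi2c : Integrable (fun ω => (ξ ω : ℂ) ^ 2) P := by
    have := hi2.ofReal (𝕜 := ℂ)
    simpa using this
  have e1 : (∫ ω, (ξ ω : ℂ) ∂P) = 0 := by rw [integral_complex_ofReal, h0]; simp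
  have e2 : (∫ ω, (ξ ω : ℂ) ^ 2 ∂P) = ((∫ ω, ξ ω ^ 2 ∂P : ℝ) : ℂ) := by
    rw [← integral_complex_ofReal]; simp
  have hiA : Integrable (fun ω => 1 + Complex.I * (ξ ω : ℂ)) P :=
    (integrable_const _).add (hi1c.const_mul _)
  have hiT : Integrable (fun ω => (1 + Complex.I * (ξ ω : ℂ) - (ξ ω : ℂ) ^ 2 / 2)) P :=
    hiA.sub (hi2c.div_const _)
  have e3 : (∫ ω, (1 + Complex.I * (ξ ω : ℂ) - (ξ ω : ℂ) ^ 2 / 2) ∂P) =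
      1 - ((∫ ω, ξ ω ^ 2 ∂P : ℝ) : ℂ) / 2 := by
    rw [integral_sub hiA (hi2c.div_const _),
      integral_add (integrable_const _) (hi1c.const_mul _), integral_const_mul, e1,
      integral_div, e2]
    simp
  rw [← e3, ← integral_sub (integrable_exp_I_mul P hm) hiT]
  refine (norm_integral_le_integral_norm _).trans ?_
  rw [← integral_const_mul, ← integral_const_mul, ← integral_add (hi2.const_mul _)
    (hi3.const_mul _)]
  refine integral_mono ((integrable_exp_I_mul P hm).sub hiT).norm
    ((hi2.const_mul _).add (hi3.const_mul _)) fun ω => ?_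
  exact norm_exp_I_mul_sub_taylor_le hε hε1 (ξ ω)

lemma norm_pow_sub_pow_le_mul {a b : ℂ} (ha : ‖a‖ ≤ 1) (hb : ‖b‖ ≤ 1) (n : ℕ) :
    ‖a ^ n - b ^ n‖ ≤ n * ‖a - b‖ := by
  induction n with
  | zero => simp
  | succ n ih =>
    have h : a ^ (n + 1) - b ^ (n + 1) = a * (a ^ n - b ^ n) + (a - b) * b ^ n := by ring
    rw [h]
    refine (norm_add_le _ _).trans ?_
    rw [norm_mul, norm_mul, norm_pow]
    have h1 : ‖a‖ * ‖a ^ n - b ^ n‖ ≤ 1 * (n * ‖a - b‖) :=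
      mul_le_mul ha ih (norm_nonneg _) zero_le_one
    have h2 : ‖a - b‖ * ‖b‖ ^ n ≤ ‖a - b‖ * 1 :=
      mul_le_mul_of_nonneg_left (pow_le_one₀ (norm_nonneg _) hb) (norm_nonneg _)
    push_cast
    linarith

lemma abs_exp_neg_sub_le {x : ℝ} (hx : 0 ≤ x) : |Real.exp (-x) - (1 - x)| ≤ x ^ 2 := by
  have h1 := Real.add_one_le_exp (-x)
  rw [abs_of_nonneg (by linarith)]
  by_cases h : x ≤ 1
  · have := Real.abs_exp_sub_one_sub_id_le (x := -x) (by rwa [abs_neg, abs_of_nonneg hx])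
    have h2 := le_abs_self (Real.exp (-x) - 1 - -x)
    nlinarith
  · have : Real.exp (-x) ≤ 1 := Real.exp_le_one_iff.2 (by linarith)
    nlinarith

/-- Lindeberg's central limit theorem for powers of characteristic functions. -/
lemma tendsto_charFun_pow {Ω ι : Type*} [MeasurableSpace Ω] (P : Measure Ω)
    [IsProbabilityMeasure P] {l : Filter ι} {ξ : ι → Ω → ℝ} {N : ι → ℕ} {V : ℝ}
    (hm : ∀ᶠ n in l, Measurable (ξ n)) (hξ : ∀ᶠ n in l, MemLp (ξ n) 2 P)
    (h0 : ∀ᶠ n in l, ∫ ω, ξ n ω ∂P = 0)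
    (hN : Tendsto N l atTop)
    (hV : Tendsto (fun n => (N n : ℝ) * ∫ ω, ξ n ω ^ 2 ∂P) l (𝓝 V))
    (hL : ∀ ε : ℝ, 0 < ε → Tendsto (fun n => (N n : ℝ) *
      ∫ ω, {ω' | ε < |ξ n ω'|}.indicator (fun ω' => ξ n ω' ^ 2) ω ∂P) l (𝓝 0)) :
    Tendsto (fun n => (∫ ω, Complex.exp (Complex.I * (ξ n ω : ℂ)) ∂P) ^ N n) l
      (𝓝 (Complex.exp (-(V : ℂ) / 2))) := by
  set s : ι → ℝ := fun n => ∫ ω, ξ n ω ^ 2 ∂P with hs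
  have hs0 : ∀ n, 0 ≤ s n := fun n => integral_nonneg fun ω => sq_nonneg _
  set φ : ι → ℂ := fun n => ∫ ω, Complex.exp (Complex.I * (ξ n ω : ℂ)) ∂P with hφ
  have hNr : Tendsto (fun n => (N n : ℝ)) l atTop := tendsto_natCast_atTop_atTop.comp hN
  -- The powers are compared with those of exp(−s/2), whose N-th power is exp(−N s/2) exactly.
  have hmain : Tendsto (fun n => ((Real.exp (-(s n / 2)) : ℝ) : ℂ) ^ N n) l
      (𝓝 (Complex.exp (-(V : ℂ) / 2))) := by
    have h1 : ∀ n, ((Real.exp (-(s n / 2)) : ℝ) : ℂ) ^ N n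
        = ((Real.exp (-((N n : ℝ) * s n) / 2) : ℝ) : ℂ) := by
      intro n
      rw [← Complex.ofReal_pow, ← Real.exp_nat_mul]
      congr 2; ring
    simp_rw [h1]
    have h2 : Complex.exp (-(V : ℂ) / 2) = ((Real.exp (-V / 2) : ℝ) : ℂ) := by push_cast; rfl
    rw [h2]
    exact (Complex.continuous_ofReal.tendsto _).comp
      ((Real.continuous_exp.tendsto _).comp (hV.neg.div_const 2))
  -- This is N times the error of replacing exp(−s/2) by 1 − s/2; it equals (N s)²/(4N), and N s
  -- stays bounded.
  have hsq : Tendsto (fun n => (N n : ℝ) * (s n / 2) ^ 2) l (𝓝 0) := by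
    have h1 : Tendsto (fun n => ((N n : ℝ) * s n) ^ 2 / 4 * ((N n : ℝ))⁻¹) l (𝓝 (V ^ 2 / 4 * 0)) :=
      ((hV.pow 2).div_const 4).mul (tendsto_inv_atTop_zero.comp hNr)
    rw [mul_zero] at h1
    refine h1.congr' ?_
    filter_upwards [hN.eventually_ge_atTop 1] with n hn
    have : (N n : ℝ) ≠ 0 := by positivity
    field_simp
    ring
  have hdiff : Tendsto (fun n => φ n ^ N n - ((Real.exp (-(s n / 2)) : ℝ) : ℂ) ^ N n) l (𝓝 0) := by
    rw [tendsto_zero_iff_norm_tendsto_zero]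
    refine tendsto_order.2 ⟨fun a ha => Eventually.of_forall fun n => ha.trans_le (norm_nonneg _),
      fun δ hδ => ?_⟩
    have hV0 : 0 < |V| + 1 := by positivity
    -- Eventually N s < |V| + 1, so the non-truncated part of the Taylor error costs at most δ/4;
    -- the cap at 1 is required by the Taylor bound.
    set ε : ℝ := min 1 (δ / 4 / (|V| + 1)) with hε
    have hε0 : 0 < ε := lt_min one_pos (by positivity)
    have hε1 : ε ≤ 1 := min_le_left _ _
    have hε2 : ε * (|V| + 1) ≤ δ / 4 := by
      rw [← le_div_iff₀ hV0]; exact min_le_right _ _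
    have hLε := (hL ε hε0).const_mul (2 / ε ^ 2 + 1 / ε + 1)
    rw [mul_zero] at hLε
    filter_upwards [hm, hξ, h0, hsq.eventually (gt_mem_nhds (show (0 : ℝ) < δ / 4 by positivity)),
      hLε.eventually (gt_mem_nhds (show (0 : ℝ) < δ / 4 by positivity)),
      hV.eventually (gt_mem_nhds (show V < |V| + 1 by linarith [le_abs_self V]))]
      with n n1 n2 n3 n4 n5 n6
    have hb : ‖((Real.exp (-(s n / 2)) : ℝ) : ℂ)‖ ≤ 1 := by
      rw [Complex.norm_real, Real.norm_eq_abs, abs_of_pos (Real.exp_pos _)]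
      exact Real.exp_le_one_iff.2 (by linarith [hs0 n])
    refine (norm_pow_sub_pow_le_mul (norm_integral_exp_I_mul_le_one P _) hb (N n)).trans_lt ?_
    have t1 := norm_charFun_sub_taylor_le P n2 n1 n3 hε0 hε1
    have t2 : ‖((Real.exp (-(s n / 2)) : ℝ) : ℂ) - (1 - ((s n : ℝ) : ℂ) / 2)‖ ≤ (s n / 2) ^ 2 := by
      have : ((Real.exp (-(s n / 2)) : ℝ) : ℂ) - (1 - ((s n : ℝ) : ℂ) / 2) =
          ((Real.exp (-(s n / 2)) - (1 - s n / 2) : ℝ) : ℂ) := by push_cast; ring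
      rw [this, Complex.norm_real, Real.norm_eq_abs]
      exact abs_exp_neg_sub_le (by linarith [hs0 n])
    have t3 : ‖φ n - ((Real.exp (-(s n / 2)) : ℝ) : ℂ)‖ ≤ _ :=
      norm_sub_le_norm_sub_add_norm_sub (φ n) (1 - ((s n : ℝ) : ℂ) / 2) _
    rw [norm_sub_rev (1 - ((s n : ℝ) : ℂ) / 2)] at t3
    have t4 := t3.trans (add_le_add t1 t2)
    have hN0 : (0 : ℝ) ≤ N n := Nat.cast_nonneg _
    calc (N n : ℝ) * ‖φ n - ((Real.exp (-(s n / 2)) : ℝ) : ℂ)‖ ≤ (N n : ℝ) * _ :=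
          mul_le_mul_of_nonneg_left t4 hN0
      _ = ε * (N n * s n) + (2 / ε ^ 2 + 1 / ε + 1) * (N n *
            ∫ ω, {ω' | ε < |ξ n ω'|}.indicator (fun ω' => ξ n ω' ^ 2) ω ∂P) +
            N n * (s n / 2) ^ 2 := by ring
      _ ≤ ε * (|V| + 1) + δ / 4 + δ / 4 := by
          refine add_le_add (add_le_add ?_ n5.le) n4.le
          exact mul_le_mul_of_nonneg_left n6.le hε0.le
      _ < δ := by linarith
  simpa using hdiff.add hmain

/-! ### Convergence and boundedness in probability -/

/-- Convergence to zero in probability. -/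
def TendstoZeroInProb {Ω ι : Type*} [MeasurableSpace Ω] (P : Measure Ω) (l : Filter ι)
    (f : ι → Ω → ℝ) : Prop :=
  ∀ ε : ℝ, 0 < ε → Tendsto (fun n => P.real {ω | ε ≤ |f n ω|}) l (𝓝 0)

/-- Boundedness in probability. -/
def BoundedInProb {Ω ι : Type*} [MeasurableSpace Ω] (P : Measure Ω) (l : Filter ι)
    (f : ι → Ω → ℝ) : Prop :=
  ∀ η : ℝ, 0 < η → ∃ K : ℝ, 0 < K ∧ ∀ᶠ n in l, P.real {ω | K ≤ |f n ω|} ≤ η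

section InProb

variable {Ω ι : Type*} [MeasurableSpace Ω] {P : Measure Ω} {l : Filter ι} {f g : ι → Ω → ℝ}

lemma tendstoZeroInProb_of_eventually_le
    (h : ∀ ε : ℝ, 0 < ε → ∀ η : ℝ, 0 < η → ∀ᶠ n in l, P.real {ω | ε ≤ |f n ω|} ≤ η) :
    TendstoZeroInProb P l f := by
  intro ε hε
  refine tendsto_order.2 ⟨fun a ha => Eventually.of_forall fun n => ha.trans_le measureReal_nonneg,
    fun δ hδ => ?_⟩
  filter_upwards [h ε hε (δ / 2) (by positivity)] with n hn
  linarith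

lemma TendstoZeroInProb.eventually_le (h : TendstoZeroInProb P l f) {ε η : ℝ} (hε : 0 < ε)
    (hη : 0 < η) : ∀ᶠ n in l, P.real {ω | ε ≤ |f n ω|} ≤ η :=
  ((h ε hε).eventually (gt_mem_nhds hη)).mono fun _ hn => hn.le

lemma TendstoZeroInProb.congr' (hf : TendstoZeroInProb P l f)
    (h : ∀ᶠ n in l, ∀ ω, g n ω = f n ω) : TendstoZeroInProb P l g := by
  intro ε hε
  refine (hf ε hε).congr' ?_
  filter_upwards [h] with n hn
  simp_rw [hn]

lemma tendstoZeroInProb_of_tendsto {c : ι → ℝ} (hc : Tendsto c l (𝓝 0)) :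
    TendstoZeroInProb P l (fun n (_ : Ω) => c n) := by
  refine tendstoZeroInProb_of_eventually_le fun ε hε η hη => ?_
  have h := hc.abs
  rw [abs_zero] at h
  filter_upwards [h.eventually (gt_mem_nhds hε)] with n hn
  have : {ω : Ω | ε ≤ |c n|} = ∅ := by
    ext ω; simpa using hn
  rw [this]
  simpa using hη.le

lemma TendstoZeroInProb.boundedInProb (hf : TendstoZeroInProb P l f) : BoundedInProb P l f :=
  fun _ hη => ⟨1, one_pos, hf.eventually_le one_pos hη⟩

lemma tendstoZeroInProb_of_integral_abs {b : ι → ℝ} (hb : Tendsto b l (𝓝 0))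
    (hf : ∀ᶠ n in l, Integrable (f n) P ∧ ∫ ω, |f n ω| ∂P ≤ b n) : TendstoZeroInProb P l f := by
  refine tendstoZeroInProb_of_eventually_le fun ε hε η hη => ?_
  filter_upwards [hf, hb.eventually (gt_mem_nhds (show 0 < ε * η by positivity))] with n h1 h2
  have h3 := mul_meas_ge_le_integral_of_nonneg (μ := P) (ae_of_all _ fun ω => abs_nonneg (f n ω))
    h1.1.abs ε
  have h4 : ε * P.real {ω | ε ≤ |f n ω|} ≤ ε * η := h3.trans (h1.2.trans h2.le)
  exact le_of_mul_le_mul_left h4 hε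

variable [IsProbabilityMeasure P]

lemma measureReal_le_add_of_subset_union {s t t' : Set Ω} {η : ℝ} (h : s ⊆ t ∪ t')
    (ht : P.real t ≤ η / 2) (ht' : P.real t' ≤ η / 2) : P.real s ≤ η := by
  have := (measureReal_mono h (measure_ne_top P _)).trans (measureReal_union_le t t')
  linarith

lemma TendstoZeroInProb.add (hf : TendstoZeroInProb P l f) (hg : TendstoZeroInProb P l g) :
    TendstoZeroInProb P l (fun n ω => f n ω + g n ω) := by
  refine tendstoZeroInProb_of_eventually_le fun ε hε η hη => ?_
  filter_upwards [hf.eventually_le (half_pos hε) (half_pos hη),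
    hg.eventually_le (half_pos hε) (half_pos hη)] with n h1 h2
  refine measureReal_le_add_of_subset_union (fun ω hω => ?_) h1 h2
  by_contra hcon
  simp only [Set.mem_union, Set.mem_ofPred_eq, not_or, not_le] at hcon hω
  linarith [abs_add_le (f n ω) (g n ω)]

lemma BoundedInProb.mul_tendsto_zero (hf : BoundedInProb P l f) {c : ι → ℝ}
    (hc : Tendsto c l (𝓝 0)) : TendstoZeroInProb P l (fun n ω => c n * f n ω) := by
  refine tendstoZeroInProb_of_eventually_le fun ε hε η hη => ?_
  obtain ⟨K, hK, hb⟩ := hf η hη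
  have h := hc.abs
  rw [abs_zero] at h
  filter_upwards [hb, h.eventually (gt_mem_nhds (show 0 < ε / K by positivity))] with n h1 h2
  refine (measureReal_mono (fun ω hω => ?_) (measure_ne_top P _)).trans h1
  simp only [Set.mem_ofPred_eq, abs_mul] at hω ⊢
  rw [lt_div_iff₀ hK] at h2
  by_contra hcon
  push Not at hcon
  have := mul_le_mul_of_nonneg_left hcon.le (abs_nonneg (c n))
  linarith

lemma BoundedInProb.add (hf : BoundedInProb P l f) (hg : BoundedInProb P l g) :
    BoundedInProb P l (fun n ω => f n ω + g n ω) := by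
  intro η hη
  obtain ⟨K, hK, hf'⟩ := hf (η / 2) (half_pos hη)
  obtain ⟨K', hK', hg'⟩ := hg (η / 2) (half_pos hη)
  refine ⟨K + K', by positivity, ?_⟩
  filter_upwards [hf', hg'] with n h1 h2
  refine measureReal_le_add_of_subset_union (fun ω hω => ?_) h1 h2
  by_contra hcon
  simp only [Set.mem_union, Set.mem_ofPred_eq, not_or, not_le] at hcon hω
  linarith [abs_add_le (f n ω) (g n ω)]

lemma BoundedInProb.const_mul (hf : BoundedInProb P l f) (c : ℝ) :
    BoundedInProb P l (fun n ω => c * f n ω) := by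
  intro η hη
  obtain ⟨K, hK, hf'⟩ := hf η hη
  refine ⟨(|c| + 1) * K, by positivity, ?_⟩
  filter_upwards [hf'] with n h1
  refine (measureReal_mono (fun ω hω => ?_) (measure_ne_top P _)).trans h1
  simp only [Set.mem_ofPred_eq, abs_mul] at hω ⊢
  by_contra hcon
  push Not at hcon
  have h2 := mul_le_mul_of_nonneg_left hcon.le (abs_nonneg c)
  linarith

/-- Slutsky's lemma for ratios whose denominators tend to one. -/
lemma tendstoZeroInProb_ratio_sub {Y G T X : ι → Ω → ℝ} {a e : ι → ℝ}
    (hY : ∀ᶠ n in l, ∀ ω, e n + T n ω / a n ≠ 0 → Y n ω = G n ω / (e n + T n ω / a n))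
    (he : Tendsto e l (𝓝 1)) (ha : Tendsto a l atTop) (hT : BoundedInProb P l T)
    (hX : BoundedInProb P l X) (hG : TendstoZeroInProb P l (fun n ω => G n ω - X n ω)) :
    TendstoZeroInProb P l (fun n ω => Y n ω - X n ω) := by
  have hδ : TendstoZeroInProb P l (fun n ω => (e n + T n ω / a n) - 1) := by
    have h1 := hT.mul_tendsto_zero (tendsto_inv_atTop_zero.comp ha)
    have h2 : Tendsto (fun n => e n - 1) l (𝓝 0) := by simpa using he.sub_const 1
    refine ((tendstoZeroInProb_of_tendsto (P := P) h2).add h1).congr' (Eventually.of_forall ?_)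
    intro n ω
    simp only [Function.comp_apply]
    ring
  have hGb : BoundedInProb P l G := by
    have := hX.add hG.boundedInProb
    simpa using this
  have key : TendstoZeroInProb P l (fun n ω => Y n ω - G n ω) := by
    refine tendstoZeroInProb_of_eventually_le fun ε hε η hη => ?_
    obtain ⟨K, hK, hb⟩ := hGb (η / 2) (half_pos hη)
    -- The bound 1/2 keeps D above 1/2; the bound ε/(4K) makes |G||D − 1| smaller than ε/4, hence
    -- smaller than ε D.
    have hκ : 0 < min (1 / 2) (ε / (4 * K)) := lt_min (by norm_num) (by positivity)
    filter_upwards [hY, hb, hδ.eventually_le hκ (half_pos hη)] with n h1 h2 h3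
    refine measureReal_le_add_of_subset_union (fun ω hω => ?_) h2 h3
    by_contra hcon
    simp only [Set.mem_union, Set.mem_ofPred_eq, not_or, not_le] at hcon hω
    obtain ⟨c1, c2⟩ := hcon
    set D := e n + T n ω / a n with hD
    have c3 := c2.trans_le (min_le_left _ _)
    have c4 := c2.trans_le (min_le_right _ _)
    have hD0 : 1 / 2 < D := by
      have := (abs_lt.1 c3).1; linarith
    have hDne : D ≠ 0 := by linarith
    rw [h1 ω hDne] at hω
    have e1 : G n ω / D - G n ω = -(G n ω * (D - 1)) / D := by field_simp; ring
    rw [e1, abs_div, abs_neg, abs_mul, abs_of_pos (by linarith : 0 < D),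
      le_div_iff₀ (by linarith)] at hω
    rw [lt_div_iff₀ (by positivity)] at c4
    have e2 : |G n ω| * |D - 1| ≤ K * |D - 1| := mul_le_mul_of_nonneg_right c1.le (abs_nonneg _)
    nlinarith
  refine (key.add hG).congr' (Eventually.of_forall fun n ω => ?_)
  ring

/-- Ratios whose numerators are negligible are negligible when they are also bounded by the scale
of the fluctuations of their denominators. -/
lemma tendstoZeroInProb_ratio {Y G T : ι → Ω → ℝ} {a e : ι → ℝ}
    (hY : ∀ᶠ n in l, ∀ ω, e n + T n ω / a n ≠ 0 → Y n ω = G n ω / (e n + T n ω / a n))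
    (he : Tendsto e l (𝓝 1)) (hYa : ∀ᶠ n in l, ∀ ω, |Y n ω| ≤ a n)
    (hT : TendstoZeroInProb P l T) (hG : TendstoZeroInProb P l G) :
    TendstoZeroInProb P l Y := by
  refine tendstoZeroInProb_of_eventually_le fun ε hε η hη => ?_
  filter_upwards [hY, hYa, hT.eventually_le (show 0 < ε / 4 by positivity) (half_pos hη),
    hG.eventually_le (half_pos hε) (half_pos hη),
    he.eventually (lt_mem_nhds (show (3 / 4 : ℝ) < 1 by norm_num))] with n h1 h2 h3 h4 h5
  refine measureReal_le_add_of_subset_union (fun ω hω => ?_) h3 h4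
  by_contra hcon
  simp only [Set.mem_union, Set.mem_ofPred_eq, not_or, not_le] at hcon hω
  obtain ⟨c1, c2⟩ := hcon
  -- No growth of a is assumed: where |Y| ≥ ε, the bound |Y| ≤ a already keeps a away from zero, so
  -- a small T gives a small T / a.
  have ha : ε ≤ a n := hω.trans (h2 ω)
  have ha0 : 0 < a n := hε.trans_le ha
  have c3 : |T n ω / a n| < 1 / 4 := by
    rw [abs_div, abs_of_pos ha0, div_lt_iff₀ ha0]
    linarith
  have hD : 1 / 2 < e n + T n ω / a n := by
    have := (abs_lt.1 c3).1; linarith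
  rw [h1 ω (by linarith), abs_div, abs_of_pos (by linarith : 0 < e n + T n ω / a n),
    le_div_iff₀ (by linarith)] at hω
  nlinarith

/-- Lévy's continuity theorem for random vectors along a countably generated filter. -/
lemma tendstoInDistribution_of_charFun {E : Type*} [NormedAddCommGroup E] [InnerProductSpace ℝ E]
    [FiniteDimensional ℝ E] [MeasurableSpace E] [BorelSpace E] [l.IsCountablyGenerated]
    {Z : ι → Ω → E} (hZ : ∀ n, Measurable (Z n)) (ν : Measure E) [IsProbabilityMeasure ν]
    (h : ∀ t : E, Tendsto (fun n => ∫ ω, Complex.exp (Complex.I * ((inner ℝ (Z n ω) t : ℝ) : ℂ)) ∂P)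
      l (𝓝 (charFun ν t))) :
    TendstoInDistribution Z l id (fun _ => P) ν := by
  refine ⟨fun n => (hZ n).aemeasurable, aemeasurable_id, ?_⟩
  -- Countable generation reduces convergence along the filter to convergence along sequences, where
  -- Lévy's theorem applies.
  refine tendsto_of_seq_tendsto fun u hu => ?_
  refine ProbabilityMeasure.tendsto_iff_tendsto_charFun.2 fun t => ?_
  simp only [ProbabilityMeasure.coe_mk, Measure.map_id]
  refine ((h t).comp hu).congr fun n => ?_
  change ∫ ω, Complex.exp (Complex.I * ((inner ℝ (Z (u n) ω) t : ℝ) : ℂ)) ∂P =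
    charFun (P.map (Z (u n))) t
  rw [charFun_apply, integral_map (hZ _).aemeasurable (by fun_prop)]
  simp only [mul_comm]

lemma limsup_measure_le_of_charFun_gaussian [l.IsCountablyGenerated] {V : ℝ≥0}
    (hf : ∀ n, Measurable (f n))
    (h : ∀ s : ℝ, Tendsto (fun n => ∫ ω, Complex.exp (Complex.I * ((s * f n ω : ℝ) : ℂ)) ∂P) l
      (𝓝 (Complex.exp (-((s ^ 2 * V : ℝ) : ℂ) / 2)))) {F : Set ℝ} (hF : IsClosed F) :
    l.limsup (fun n => P {ω | f n ω ∈ F}) ≤ gaussianReal 0 V F := by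
  have h1 : TendstoInDistribution f l id (fun _ => P) (gaussianReal 0 V) := by
    refine tendstoInDistribution_of_charFun hf _ fun t => ?_
    have e1 : charFun (gaussianReal 0 V) t = Complex.exp (-((t ^ 2 * V : ℝ) : ℂ) / 2) := by
      rw [charFun_gaussianReal]
      congr 1
      push_cast
      ring
    rw [e1]
    refine (h t).congr fun n => ?_
    simp
  have h2 := ProbabilityMeasure.limsup_measure_closed_le_of_tendsto h1.tendsto hF
  simp only [ProbabilityMeasure.coe_mk, Measure.map_id] at h2
  refine le_trans (le_of_eq ?_) h2
  congr 1
  ext n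
  rw [Measure.map_apply (hf n) hF.measurableSet]
  rfl

lemma eventually_measureReal_le_of_charFun_gaussian [l.IsCountablyGenerated] {V : ℝ≥0}
    (hf : ∀ n, Measurable (f n))
    (h : ∀ s : ℝ, Tendsto (fun n => ∫ ω, Complex.exp (Complex.I * ((s * f n ω : ℝ) : ℂ)) ∂P) l
      (𝓝 (Complex.exp (-((s ^ 2 * V : ℝ) : ℂ) / 2)))) {K η : ℝ}
    (hK : (gaussianReal 0 V).real {x | K ≤ |x|} < η) :
    ∀ᶠ n in l, P.real {ω | K ≤ |f n ω|} ≤ η := by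
  have h1 := limsup_measure_le_of_charFun_gaussian hf h
    (F := {x | K ≤ |x|}) (isClosed_le continuous_const continuous_abs)
  have h2 : gaussianReal 0 V {x | K ≤ |x|} < ENNReal.ofReal η :=
    (ENNReal.lt_ofReal_iff_toReal_lt (measure_ne_top _ _)).2 hK
  filter_upwards [eventually_lt_of_limsup_lt (h1.trans_lt h2)] with n hn
  exact ((ENNReal.lt_ofReal_iff_toReal_lt (measure_ne_top _ _)).1 hn).le

/-- Tightness from convergence in law: the portmanteau bound on the closed sets {k ≤ |x|} compares
the tails with those of the limit, which decrease to zero as k grows. -/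
lemma boundedInProb_of_charFun_gaussian [l.IsCountablyGenerated] {V : ℝ≥0}
    (hf : ∀ n, Measurable (f n))
    (h : ∀ s : ℝ, Tendsto (fun n => ∫ ω, Complex.exp (Complex.I * ((s * f n ω : ℝ) : ℂ)) ∂P) l
      (𝓝 (Complex.exp (-((s ^ 2 * V : ℝ) : ℂ) / 2)))) :
    BoundedInProb P l f := by
  intro η hη
  have h1 : Tendsto (fun k : ℕ => (gaussianReal 0 V).real {x | (k : ℝ) ≤ |x|}) atTop (𝓝 0) := by
    have h2 : Tendsto (fun k : ℕ => gaussianReal 0 V {x | (k : ℝ) ≤ |x|}) atTop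
        (𝓝 (gaussianReal 0 V (⋂ k : ℕ, {x : ℝ | (k : ℝ) ≤ |x|}))) := by
      refine tendsto_measure_iInter_atTop (fun k => ?_) (fun a b hab x hx => ?_)
        ⟨0, measure_ne_top _ _⟩
      · exact (measurableSet_le measurable_const measurable_id.abs).nullMeasurableSet
      · simp only [Set.mem_ofPred_eq] at hx ⊢
        exact le_trans (by exact_mod_cast hab) hx
    have h3 : (⋂ k : ℕ, {x : ℝ | (k : ℝ) ≤ |x|}) = ∅ := by
      ext x
      simp only [Set.mem_iInter, Set.mem_ofPred_eq, Set.mem_empty_iff_false, iff_false, not_forall,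
        not_le]
      exact exists_nat_gt |x|
    rw [h3, measure_empty] at h2
    have := (ENNReal.tendsto_toReal ENNReal.zero_ne_top).comp h2
    simpa [Measure.real, Function.comp_def] using this
  obtain ⟨k, hk, hk1⟩ := ((h1.eventually (gt_mem_nhds hη)).and (eventually_ge_atTop 1)).exists
  exact ⟨k, by exact_mod_cast hk1, eventually_measureReal_le_of_charFun_gaussian hf h hk⟩

/-- The degenerate case V = 0: the limit law is the Dirac mass at zero, which does not charge {ε ≤
|x|}. -/
lemma tendstoZeroInProb_of_charFun [l.IsCountablyGenerated] (hf : ∀ n, Measurable (f n))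
    (h : ∀ s : ℝ, Tendsto (fun n => ∫ ω, Complex.exp (Complex.I * ((s * f n ω : ℝ) : ℂ)) ∂P) l
      (𝓝 1)) :
    TendstoZeroInProb P l f := by
  refine tendstoZeroInProb_of_eventually_le fun ε hε η hη => ?_
  refine eventually_measureReal_le_of_charFun_gaussian (V := 0) hf (by simpa using h) ?_
  have hms : MeasurableSet {x : ℝ | ε ≤ |x|} := measurableSet_le measurable_const (by fun_prop)
  rw [gaussianReal_zero_var, measureReal_def, Measure.dirac_apply' _ hms]
  simpa [hε] using hη

lemma tendstoInMeasure_euclidean {κ : Type*} [Fintype κ] {Z : ι → Ω → EuclideanSpace ℝ κ}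
    (h : ∀ a, TendstoZeroInProb P l (fun n ω => Z n ω a)) : TendstoInMeasure P Z l 0 := by
  rw [tendstoInMeasure_iff_measureReal_norm]
  intro ε hε
  -- Adding one to the cardinality makes card · c < ε strict and covers an empty index type.
  set c : ℝ := ε / (Fintype.card κ + 1) with hc
  have hc0 : 0 < c := by positivity
  have h1 : Tendsto (fun n => ∑ a, P.real {ω | c ≤ |Z n ω a|}) l (𝓝 0) := by
    have := tendsto_finsetSum (Finset.univ : Finset κ) fun a _ => h a c hc0
    simpa using this
  refine squeeze_zero (fun n => measureReal_nonneg) (fun n => ?_) h1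
  refine (measureReal_mono (fun ω hω => ?_) (measure_ne_top P _)).trans
    (measureReal_biUnion_finset_le (Finset.univ : Finset κ) fun a => {ω | c ≤ |Z n ω a|})
  simp only [Pi.zero_apply, sub_zero, Set.mem_ofPred_eq, Finset.mem_univ, Set.iUnion_true,
    Set.mem_iUnion] at hω ⊢
  by_contra hcon
  push Not at hcon
  have h2 : ‖Z n ω‖ ≤ ∑ a, |Z n ω a| := by
    rw [EuclideanSpace.norm_eq]
    refine Real.sqrt_le_iff.2 ⟨Finset.sum_nonneg fun a _ => abs_nonneg _, ?_⟩
    simp only [Real.norm_eq_abs]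
    exact Finset.sum_sq_le_sq_sum_of_nonneg fun a _ => abs_nonneg _
  have h3 : ∑ a, |Z n ω a| ≤ ∑ _a : κ, c := Finset.sum_le_sum fun a _ => (hcon a).le
  rw [Finset.sum_const, nsmul_eq_mul, Finset.card_univ] at h3
  have h4 : (Fintype.card κ : ℝ) * c < ε := by
    rw [hc, mul_div_assoc', div_lt_iff₀ (by positivity)]
    nlinarith
  linarith

end InProb

/-! ### Vague convergence and continuity sets -/

lemma integrable_of_support {S : Type*} [MeasurableSpace S] {μ : Measure S} {h : S → ℝ}
    (hm : Measurable h) (h01 : ∀ x, h x ∈ Set.Icc (0 : ℝ) 1) {W : Set S} (hW : MeasurableSet W)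
    (hWf : μ W ≠ ∞) (h0 : ∀ x ∉ W, h x = 0) : Integrable h μ := by
  refine ((integrable_indicator_iff hW).2 (integrableOn_const (C := (1 : ℝ)) hWf)).mono'
    hm.aestronglyMeasurable (ae_of_all _ fun x => ?_)
  rw [Real.norm_eq_abs, abs_of_nonneg (h01 x).1]
  by_cases hx : x ∈ W
  · rw [Set.indicator_of_mem hx]; exact (h01 x).2
  · rw [h0 x hx, Set.indicator_of_notMem hx]

lemma integral_le_measureReal {S : Type*} [MeasurableSpace S] {μ : Measure S} {h : S → ℝ}
    (hm : Measurable h) (h01 : ∀ x, h x ∈ Set.Icc (0 : ℝ) 1) {W : Set S} (hW : MeasurableSet W)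
    (hWf : μ W ≠ ∞) (h0 : ∀ x ∉ W, h x = 0) : ∫ x, h x ∂μ ≤ μ.real W := by
  rw [← integral_indicator_one hW]
  refine integral_mono (integrable_of_support hm h01 hW hWf h0)
    ((integrable_indicator_iff hW).2 (integrableOn_const hWf)) fun x => ?_
  by_cases hx : x ∈ W
  · rw [Set.indicator_of_mem hx]; exact (h01 x).2
  · rw [h0 x hx, Set.indicator_of_notMem hx]

lemma measureReal_le_integral {S : Type*} [MeasurableSpace S] {μ : Measure S} {h : S → ℝ}
    (hi : Integrable h μ) (h01 : ∀ x, h x ∈ Set.Icc (0 : ℝ) 1) {K : Set S} (hK : MeasurableSet K)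
    (hKf : μ K ≠ ∞) (h1 : ∀ x ∈ K, h x = 1) : μ.real K ≤ ∫ x, h x ∂μ := by
  rw [← integral_indicator_one hK]
  refine integral_mono ((integrable_indicator_iff hK).2 (integrableOn_const hKf)) hi fun x => ?_
  by_cases hx : x ∈ K
  · rw [Set.indicator_of_mem hx, h1 x hx]; rfl
  · rw [Set.indicator_of_notMem hx]; exact (h01 x).1

section Vague

variable {S : Type*} [TopologicalSpace S] [CompactSpace S] [T2Space S] [SecondCountableTopology S]
  [MeasurableSpace S] [BorelSpace S] {μ : Measure S} {o : S}

/-- The measure may be infinite near `o`, so regularity is used only after restriction to a closed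
neighbourhood of F that avoids `o`, where the mass is finite. An Urysohn function for F inside a
slightly larger open set then works. -/
lemma exists_continuous_ge_of_isClosed (hrad : ∀ K : Set S, IsClosed K → o ∉ K → μ K < ∞)
    {F : Set S} (hF : IsClosed F) (ho : o ∉ F) {ε : ℝ} (hε : 0 < ε) :
    ∃ g : C(S, ℝ), (∀ x, g x ∈ Set.Icc (0 : ℝ) 1) ∧ (∀ x ∈ F, g x = 1) ∧ o ∉ tsupport g ∧
      ∫ x, g x ∂μ ≤ μ.real F + ε := by
  have : TopologicalSpace.MetrizableSpace S :=
    TopologicalSpace.metrizableSpace_of_t3_secondCountable S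
  obtain ⟨U, hU, hFU, hUo⟩ := normal_exists_closure_subset hF (isOpen_compl_singleton (x := o))
    (fun x hx hxo => ho (hxo ▸ hx))
  have hUo' : o ∉ closure U := fun h => hUo h rfl
  have hfin := hrad _ isClosed_closure hUo'
  have : IsFiniteMeasure (μ.restrict (closure U)) := ⟨by simpa using hfin⟩
  obtain ⟨W, hFW, hW, hμW⟩ := F.exists_isOpen_le_add (μ.restrict (closure U))
    (ENNReal.ofReal_pos.2 hε).ne'
  obtain ⟨g, hg0, hg1, hg⟩ := exists_continuous_zero_one_of_isClosed
    (hW.inter hU).isClosed_compl hF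
    (Set.disjoint_left.2 fun x hx hxF => hx ⟨hFW hxF, hFU hxF⟩)
  have hsupp : ∀ x ∉ W ∩ U, g x = 0 := fun x hx => hg0 hx
  have hle : μ (W ∩ U) ≤ μ F + ENNReal.ofReal ε := by
    calc μ (W ∩ U) ≤ μ (W ∩ closure U) :=
          measure_mono (Set.inter_subset_inter_right _ subset_closure)
      _ = μ.restrict (closure U) W := (Measure.restrict_apply hW.measurableSet).symm
      _ ≤ _ := hμW.trans (add_le_add_left (Measure.restrict_apply_le _ _) _)
  have hFf : μ F ≠ ∞ := (hrad F hF ho).ne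
  have hsum : μ F + ENNReal.ofReal ε ≠ ∞ := ENNReal.add_ne_top.2 ⟨hFf, ENNReal.ofReal_ne_top⟩
  have hWf : μ (W ∩ U) ≠ ∞ := ne_top_of_le_ne_top hsum hle
  refine ⟨g, hg, fun x hx => hg1 hx, fun h => hUo' ?_, ?_⟩
  · refine closure_mono (fun x hx => ?_) h
    by_contra hxU
    exact hx (hsupp x fun h' => hxU h'.2)
  · refine (integral_le_measureReal g.continuous.measurable hg (hW.inter hU).measurableSet hWf
      hsupp).trans ?_
    have := ENNReal.toReal_mono hsum hle
    rwa [ENNReal.toReal_add hFf ENNReal.ofReal_ne_top, ENNReal.toReal_ofReal hε.le] at this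

/-- The closure of O has finite mass, so O is approximated from inside by a closed set K, and an
Urysohn function equal to 1 on K and to 0 off O is taken. -/
lemma exists_continuous_le_of_isOpen (hrad : ∀ K : Set S, IsClosed K → o ∉ K → μ K < ∞)
    {O : Set S} (hO : IsOpen O) (ho : o ∉ closure O) {ε : ℝ} (hε : 0 < ε) :
    ∃ g : C(S, ℝ), (∀ x, g x ∈ Set.Icc (0 : ℝ) 1) ∧ (∀ x ∉ O, g x = 0) ∧ o ∉ tsupport g ∧
      μ.real O - ε ≤ ∫ x, g x ∂μ := by
  have : TopologicalSpace.MetrizableSpace S :=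
    TopologicalSpace.metrizableSpace_of_t3_secondCountable S
  have hfin := hrad _ isClosed_closure ho
  have : IsFiniteMeasure (μ.restrict (closure O)) := ⟨by simpa using hfin⟩
  have hr : ∀ s ⊆ O, MeasurableSet s → μ.restrict (closure O) s = μ s := fun s hs hsm => by
    rw [Measure.restrict_apply hsm, Set.inter_eq_left.2 (hs.trans subset_closure)]
  obtain ⟨K, hKO, hK, hμK⟩ := hO.measurableSet.exists_isClosed_lt_add
    (μ := μ.restrict (closure O)) (measure_ne_top _ _) (ENNReal.ofReal_pos.2 hε).ne'
  rw [hr O subset_rfl hO.measurableSet, hr K hKO hK.measurableSet] at hμK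
  obtain ⟨g, hg0, hg1, hg⟩ := exists_continuous_zero_one_of_isClosed hO.isClosed_compl hK
    (Set.disjoint_left.2 fun x hx hxF => hx (hKO hxF))
  have hsupp : ∀ x ∉ O, g x = 0 := fun x hx => hg0 hx
  have hOf : μ O ≠ ∞ := ne_top_of_le_ne_top hfin.ne (measure_mono subset_closure)
  have hKf : μ K ≠ ∞ := ne_top_of_le_ne_top hOf (measure_mono hKO)
  refine ⟨g, hg, hsupp, fun h => ho ?_, ?_⟩
  · refine closure_mono (fun x hx => ?_) h
    by_contra hxO
    exact hx (hsupp x hxO)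
  · have h1 := measureReal_le_integral (integrable_of_support g.continuous.measurable hg
      hO.measurableSet hOf hsupp) hg hK.measurableSet hKf (fun x hx => hg1 hx)
    have := ENNReal.toReal_mono (ENNReal.add_ne_top.2 ⟨hKf, ENNReal.ofReal_ne_top⟩) hμK.le
    rw [ENNReal.toReal_add hKf ENNReal.ofReal_ne_top, ENNReal.toReal_ofReal hε.le] at this
    have e1 : μ.real O = (μ O).toReal := rfl
    have e2 : μ.real K = (μ K).toReal := rfl
    linarith

/-- The portmanteau theorem for vague convergence on a punctured compact space. -/
lemma tendsto_mul_measureReal_of_vague {Ω : Type*} [MeasurableSpace Ω] (P : Measure Ω)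
    [IsProbabilityMeasure P] {Z : ℕ → Ω → S} {k : ℕ → ℝ}
    (hrad : ∀ K : Set S, IsClosed K → o ∉ K → μ K < ∞) (hZ : ∀ n, Measurable (Z n))
    (hk : ∀ᶠ n in atTop, 0 ≤ k n)
    (hv : ∀ g : S → ℝ, Continuous g → o ∉ tsupport g →
      Tendsto (fun n => k n * ∫ ω, g (Z n ω) ∂P) atTop (𝓝 (∫ x, g x ∂μ)))
    {E : Set S} (hE : ∀ n, MeasurableSet (Z n ⁻¹' E)) (ho : o ∉ closure E)
    (hfr : μ (frontier E) = 0) :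
    Tendsto (fun n => k n * P.real (Z n ⁻¹' E)) atTop (𝓝 (μ.real E)) := by
  -- With a null frontier, E, its interior and its closure have the same mass, so the two continuous
  -- approximations squeeze to one value.
  have hcl : μ (closure E) ≤ μ (interior E) := by
    rw [closure_eq_interior_union_frontier]
    exact (measure_union_le _ _).trans (by rw [hfr, add_zero])
  have hEc : μ E = μ (closure E) :=
    le_antisymm (measure_mono subset_closure) (hcl.trans (measure_mono interior_subset))
  have hEi : μ E = μ (interior E) :=
    le_antisymm ((measure_mono subset_closure).trans hcl) (measure_mono interior_subset)
  have hoi : o ∉ closure (interior E) := fun h => ho (closure_mono interior_subset h)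
  refine tendsto_order.2 ⟨fun a ha => ?_, fun b hb => ?_⟩
  · obtain ⟨g, hg, hg0, hgo, hgi⟩ := exists_continuous_le_of_isOpen hrad isOpen_interior hoi
      (half_pos (sub_pos.2 ha))
    have h1 : a < ∫ x, g x ∂μ := by
      have : μ.real E = μ.real (interior E) := by simp only [measureReal_def, hEi]
      linarith
    filter_upwards [hk, (hv g g.continuous hgo).eventually (lt_mem_nhds h1)] with n h2 h3
    refine h3.trans_le (mul_le_mul_of_nonneg_left ?_ h2)
    exact integral_le_measureReal (g.continuous.measurable.comp (hZ n)) (fun ω => hg _) (hE n)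
      (measure_ne_top _ _) fun ω hω => hg0 _ fun h => hω (show Z n ω ∈ E from interior_subset h)
  · obtain ⟨g, hg, hg1, hgo, hgi⟩ := exists_continuous_ge_of_isClosed hrad isClosed_closure ho
      (half_pos (sub_pos.2 hb))
    have h1 : ∫ x, g x ∂μ < b := by
      have : μ.real E = μ.real (closure E) := by simp only [measureReal_def, hEc]
      linarith
    filter_upwards [hk, (hv g g.continuous hgo).eventually (gt_mem_nhds h1)] with n h2 h3
    refine (mul_le_mul_of_nonneg_left ?_ h2).trans_lt h3
    refine measureReal_le_integral ?_ (fun ω => hg _) (hE n) (measure_ne_top _ _)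
      fun ω hω => hg1 _ (subset_closure hω)
    exact integrable_of_support (g.continuous.measurable.comp (hZ n)) (fun ω => hg _)
      MeasurableSet.univ (measure_ne_top _ _) fun ω hω => absurd (Set.mem_univ ω) hω

end Vague

/-! ### Existence of the iso-extremogram -/

lemma isOpenEmbedding_toExtended (p d : ℕ) :
    IsOpenEmbedding (toExtended : (Fin p → Fin d → ℝ) → Fin p → Fin d → EReal) := by
  exact IsOpenEmbedding.piMap fun _ => IsOpenEmbedding.piMap fun _ => EReal.isOpenEmbedding_coe

/-- A single component bounded away from zero suffices, since a box constraining that component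
alone is a neighbourhood of 0. For pairs in A × B it is therefore enough to use A. -/
lemma zero_notMem_closure_toExtended {p d : ℕ} {E : Set (Fin p → Fin d → ℝ)} (i : Fin p) {ε : ℝ}
    (hε : 0 < ε) (hE : ∀ x ∈ E, ε ≤ ‖x i‖) : 0 ∉ closure (toExtended '' E) := by
  have hU : IsOpen {y : Fin p → Fin d → EReal | ∀ j, y i j ∈ Set.Ioo ((-ε : ℝ) : EReal) (ε : ℝ)} := by
    simp only [Set.ofPred_forall]
    exact isOpen_iInter_of_finite fun j => isOpen_Ioo.preimage (by fun_prop)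
  intro h
  obtain ⟨y, hyU, x, hxE, rfl⟩ := mem_closure_iff.1 h _ hU (fun j => by
    constructor
    · exact EReal.coe_lt_coe_iff.2 (neg_lt_zero.2 hε)
    · exact EReal.coe_lt_coe_iff.2 hε)
  have : ‖x i‖ < ε := by
    refine (pi_norm_lt_iff hε).2 fun j => ?_
    have := hyU j
    simp only [toExtended, Set.mem_Ioo, EReal.coe_lt_coe_iff] at this
    rw [Real.norm_eq_abs, abs_lt]
    exact this
  exact absurd (hE x hxE) (not_le.2 this)

section Tail

variable {Ω : Type*} [MeasurableSpace Ω] {P : Measure Ω} [IsProbabilityMeasure P] {d : ℕ}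
  {X : RandomField Ω d} {u k : ℕ → ℝ}
  {m : (p : ℕ) → (Fin p → (ℤ × ℤ) × ℝ≥0) → Measure (Fin p → Fin d → EReal)}

lemma VagueRegularVariation.tendsto_measureReal (hm : VagueRegularVariation P X u k m)
    (hX : ∀ s t, Measurable (X s t)) (hk : Tendsto k atTop atTop) {p : ℕ}
    (z : Fin p → (ℤ × ℤ) × ℝ≥0) {E : Set (Fin p → Fin d → ℝ)} (hE : MeasurableSet E) (i : Fin p)
    {ε : ℝ} (hε : 0 < ε) (hE0 : ∀ x ∈ E, ε ≤ ‖x i‖)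
    (hfr : m p z (toExtended '' frontier E) = 0) :
    Tendsto (fun n => k n * P.real {ω | (fun i => (u n)⁻¹ • X (z i).1 (z i).2 ω) ∈ E}) atTop
      (𝓝 ((m p z).real (toExtended '' E))) := by
  have hemb := isOpenEmbedding_toExtended p d
  have hpre : ∀ n, (fun ω => toExtended (fun i => (u n)⁻¹ • X (z i).1 (z i).2 ω)) ⁻¹'
      (toExtended '' E) = {ω | (fun i => (u n)⁻¹ • X (z i).1 (z i).2 ω) ∈ E} := by
    intro n
    ext ω
    exact hemb.injective.mem_set_image
  have hmeas : ∀ n, Measurable (fun ω (i : Fin p) => (u n)⁻¹ • X (z i).1 (z i).2 ω) := fun n =>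
    measurable_pi_lambda _ fun i => (hX (z i).1 (z i).2).const_smul ((u n)⁻¹)
  -- In the compactification the frontier of the image consists of the image of the frontier,
  -- because the embedding is open, and of points at infinity, which carry no mass.
  have hfr' : m p z (frontier (toExtended '' E)) = 0 := by
    refine measure_mono_null ?_ (measure_union_null hfr (hm.no_mass_infinity p z))
    intro y hy
    by_cases hyr : y ∈ Set.range (toExtended : (Fin p → Fin d → ℝ) → _)
    · obtain ⟨x, rfl⟩ := hyr
      left
      refine ⟨x, ?_, rfl⟩
      have h1 := hemb.isOpenMap.preimage_frontier_eq_frontier_preimage hemb.continuous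
        (toExtended '' E)
      rw [Set.preimage_image_eq _ hemb.injective] at h1
      rw [← h1]
      exact hy
    · exact Or.inr hyr
  have h := tendsto_mul_measureReal_of_vague P (hm.radon p z)
    (fun n => hemb.continuous.measurable.comp (hmeas n)) (hk.eventually_ge_atTop 0)
    (fun g hg hg0 => hm.vague p z g hg hg0) (E := toExtended '' E)
    (fun n => by
      change MeasurableSet ((fun ω => toExtended (fun i => (u n)⁻¹ • X (z i).1 (z i).2 ω)) ⁻¹'
        (toExtended '' E))
      rw [hpre n]
      exact hmeas n hE)
    (zero_notMem_closure_toExtended i hε hE0) hfr'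
  refine h.congr fun n => ?_
  rw [← hpre n]
  rfl

/-- The limit is the mass of A, finite by the Radon property. Its positivity makes v_n eventually
positive and allows division by it in the conditional probabilities. -/
lemma VagueRegularVariation.tendsto_exceedProb (hm : VagueRegularVariation P X u k m)
    (hX : ∀ s t, Measurable (X s t)) (hk : Tendsto k atTop atTop) {A : Set (Fin d → ℝ)}
    (hA : MeasurableSet A) (hA0 : BoundedAwayFromZero A)
    (hmA : 0 < m 1 ![((0, 0), 0)] (toExtended '' {x | x 0 ∈ A}))
    (hmA' : m 1 ![((0, 0), 0)] (toExtended '' frontier {x | x 0 ∈ A}) = 0) :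
    ∃ α : ℝ, 0 < α ∧ Tendsto (fun n => k n * exceedProb P X A u n) atTop (𝓝 α) := by
  obtain ⟨ε, hε, hA0⟩ := hA0
  have hE : MeasurableSet {x : Fin 1 → Fin d → ℝ | x 0 ∈ A} := measurable_pi_apply 0 hA
  refine ⟨_, ENNReal.toReal_pos hmA.ne' ?_, ?_⟩
  · exact ((measure_mono subset_closure).trans_lt (hm.radon _ _ _ isClosed_closure
      (zero_notMem_closure_toExtended 0 hε fun x hx => hA0 _ hx))).ne
  · refine (hm.tendsto_measureReal hX hk ![((0, 0), 0)] hE 0 hε (fun x hx => hA0 _ hx)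
      hmA').congr fun n => ?_
    simp [exceedProb]

/-- Numerator and denominator both converge after multiplication by k_n, which cancels in the
quotient. -/
lemma VagueRegularVariation.tendsto_preIsoExtremogram (hm : VagueRegularVariation P X u k m)
    (hX : ∀ s t, Measurable (X s t)) (hk : Tendsto k atTop atTop) {A B : Set (Fin d → ℝ)}
    (hA : MeasurableSet A) (hB : MeasurableSet B) (hA0 : BoundedAwayFromZero A)
    (hmA : 0 < m 1 ![((0, 0), 0)] (toExtended '' {x | x 0 ∈ A}))
    (hmA' : m 1 ![((0, 0), 0)] (toExtended '' frontier {x | x 0 ∈ A}) = 0) (hs ht : ℕ)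
    (hmAB : m 2 ![((0, 0), 0), (((hs : ℤ), 0), (ht : ℝ≥0))]
      (toExtended '' frontier {x | x 0 ∈ A ∧ x 1 ∈ B}) = 0) :
    Tendsto (preIsoExtremogram P X A B u hs ht) atTop (𝓝 (isoExtremogram P X A B u hs ht)) := by
  refine tendsto_nhds_limUnder ?_
  obtain ⟨α, hα, hα'⟩ := hm.tendsto_exceedProb hX hk hA hA0 hmA hmA'
  obtain ⟨ε, hε, hA0⟩ := hA0
  have hE : MeasurableSet {x : Fin 2 → Fin d → ℝ | x 0 ∈ A ∧ x 1 ∈ B} :=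
    (measurable_pi_apply 0 hA).inter (measurable_pi_apply 1 hB)
  have h2 := hm.tendsto_measureReal hX hk _ hE 0 hε (fun x hx => hA0 _ hx.1) hmAB
  refine ⟨_, (h2.div hα' hα.ne').congr' ?_⟩
  filter_upwards [hk.eventually_gt_atTop 0] with n hn
  simp only [Pi.div_apply]
  rw [mul_div_mul_left _ _ hn.ne']
  simp [preIsoExtremogram, exceedProb]

end Tail

/-! ### Spheres and block centres -/

lemma mem_sphere {a b h : ℕ} {c i : ℕ × ℕ} : i ∈ sphere a b h c ↔
    ((1 ≤ i.1 ∧ i.1 ≤ a) ∧ 1 ≤ i.2 ∧ i.2 ≤ b) ∧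
      max |(c.1 : ℤ) - (i.1 : ℤ)| |(c.2 : ℤ) - (i.2 : ℤ)| = (h : ℤ) := by
  simp [sphere]

/-- Spheres which lie inside a box are translates of the spheres of the box. -/
lemma sum_sphere_shift {M : Type*} [AddCommMonoid M] {a b a' b' h : ℕ} {c s : ℕ × ℕ}
    (hc1 : h < c.1) (hc2 : h < c.2) (h1 : c.1 + h ≤ a') (h2 : c.2 + h ≤ b') (h3 : s.1 + a' ≤ a)
    (h4 : s.2 + b' ≤ b) (f : ℕ × ℕ → M) :
    ∑ i ∈ sphere a b h (s.1 + c.1, s.2 + c.2), f i =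
      ∑ i ∈ sphere a' b' h c, f (s.1 + i.1, s.2 + i.2) := by
  symm
  refine Finset.sum_nbij (fun i => (s.1 + i.1, s.2 + i.2)) ?_ ?_ ?_ (fun _ _ => rfl)
  · intro i hi
    rw [mem_sphere] at hi ⊢
    obtain ⟨⟨⟨p1, p2⟩, p3, p4⟩, p5⟩ := hi
    refine ⟨⟨⟨?_, ?_⟩, ?_, ?_⟩, ?_⟩
    · dsimp only; omega
    · dsimp only; omega
    · dsimp only; omega
    · dsimp only; omega
    · rw [← p5]; push_cast; congr 2 <;> ring
  · intro i _ i' _ hii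
    simp only [Prod.mk.injEq, Nat.add_left_cancel_iff] at hii
    exact Prod.ext hii.1 hii.2
  · intro i hi
    rw [Finset.mem_coe, mem_sphere] at hi
    obtain ⟨⟨⟨p1, p2⟩, p3, p4⟩, p5⟩ := hi
    have q1 := abs_le.1 ((le_max_left _ _).trans p5.le)
    have q2 := abs_le.1 ((le_max_right _ _).trans p5.le)
    push_cast at q1 q2
    refine ⟨(i.1 - s.1, i.2 - s.2), ?_, ?_⟩
    · rw [Finset.mem_coe, mem_sphere]
      refine ⟨⟨⟨?_, ?_⟩, ?_, ?_⟩, ?_⟩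
      · dsimp only; omega
      · dsimp only; omega
      · dsimp only; omega
      · dsimp only; omega
      · rw [← p5]
        dsimp only
        congr 2 <;> omega
    · refine Prod.ext ?_ ?_ <;> (dsimp only; omega)

lemma sphere_card_pos {a b h : ℕ} {c : ℕ × ℕ} (hc1 : 1 ≤ c.1) (hc2 : 1 ≤ c.2) (h1 : c.1 + h ≤ a)
    (h2 : c.2 ≤ b) : 0 < (sphere a b h c).card := by
  refine Finset.card_pos.2 ⟨(c.1 + h, c.2), ?_⟩
  rw [mem_sphere]
  refine ⟨⟨⟨by dsimp only; omega, h1⟩, hc2, h2⟩, ?_⟩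
  push_cast
  simp

lemma sphere_zero {a b : ℕ} {c : ℕ × ℕ} (hc1 : 1 ≤ c.1) (hc2 : 1 ≤ c.2) (h1 : c.1 ≤ a)
    (h2 : c.2 ≤ b) : sphere a b 0 c = {c} := by
  ext i
  rw [mem_sphere, Finset.mem_singleton]
  constructor
  · rintro ⟨_, h⟩
    have q1 := abs_le.1 ((le_max_left _ _).trans h.le)
    have q2 := abs_le.1 ((le_max_right _ _).trans h.le)
    refine Prod.ext ?_ ?_ <;> omega
  · rintro rfl
    exact ⟨⟨⟨hc1, h1⟩, hc2, h2⟩, by simp⟩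

/-- Since (2q − 1)a + 1 = (a + 1) + 2(q − 1)a, the integer part commutes with the shift: the
estimator and the block functionals look at the same centres. -/
lemma blockCenter_eq {a b : ℕ} {j : ℕ × ℕ} (h1 : 1 ≤ j.1) (h2 : 1 ≤ j.2) :
    blockCenter a b j = ((j.1 - 1) * a + (center a b).1, (j.2 - 1) * b + (center a b).2) := by
  have key : ∀ q a : ℕ, 1 ≤ q → ((2 * q - 1) * a + 1) / 2 = (q - 1) * a + (a + 1) / 2 := by
    intro q a hq
    obtain ⟨p, rfl⟩ := Nat.exists_eq_add_of_le hq
    have : (2 * (1 + p) - 1) * a + 1 = (a + 1) + 2 * (p * a) := by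
      have : 2 * (1 + p) - 1 = 2 * p + 1 := by omega
      rw [this]; ring
    rw [this, Nat.add_mul_div_left _ _ two_pos]
    simp [add_comm]
  simp [blockCenter, center, key _ _ h1, key _ _ h2]

/-! ### Sums over times -/

lemma sum_Icc_blocks {M : Type*} [AddCommMonoid M] (f : ℕ → M) (m r : ℕ) :
    ∑ t ∈ Finset.Icc 1 (m * r), f t =
      ∑ k ∈ Finset.Icc 1 m, ∑ t ∈ Finset.Icc 1 r, f ((k - 1) * r + t) := by
  induction m with
  | zero => simp
  | succ m ih =>
    rw [Finset.sum_Icc_succ_top (by omega), ← ih]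
    have h : Finset.Icc 1 ((m + 1) * r) =
        Finset.Icc 1 (m * r) ∪ (Finset.Icc 1 r).image (fun t => m * r + t) := by
      ext t
      have e : (m + 1) * r = m * r + r := by ring
      simp only [Finset.mem_Icc, Finset.mem_union, Finset.mem_image, e]
      constructor
      · rintro ⟨h1, h2⟩
        by_cases h3 : t ≤ m * r
        · exact Or.inl ⟨h1, h3⟩
        · exact Or.inr ⟨t - m * r, by omega, by omega⟩
      · rintro (h1 | ⟨s, h1, rfl⟩) <;> omega
    rw [h, Finset.sum_union, Finset.sum_image (by intro a _ b _ hab; simpa using hab)]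
    · simp
    · rw [Finset.disjoint_left]
      intro t ht ht'
      simp only [Finset.mem_Icc, Finset.mem_image] at ht ht'
      obtain ⟨s, h1, rfl⟩ := ht'
      omega

lemma sum_Icc_split {M : Type*} [AddCommMonoid M] (f : ℕ → M) {a b : ℕ} (h : a ≤ b) :
    ∑ t ∈ Finset.Icc 1 b, f t = ∑ t ∈ Finset.Icc 1 a, f t + ∑ t ∈ Finset.Icc (a + 1) b, f t := by
  have h' : Finset.Icc 1 b = Finset.Icc 1 a ∪ Finset.Icc (a + 1) b := by
    ext t; simp only [Finset.mem_Icc, Finset.mem_union]; omega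
  rw [h', Finset.sum_union]
  rw [Finset.disjoint_left]
  intro t ht ht'
  simp only [Finset.mem_Icc] at ht ht'
  omega

/-- Restricting a sum over times to the complete blocks, without the last `h` times of each block,
loses at most the sum over these times and over the incomplete block. -/
lemma sum_blocks_error {g a : ℕ → ℝ} (hg : ∀ t, 0 ≤ g t) (hga : ∀ t, g t ≤ a t) {n m r h : ℕ}
    (hmr : m * r ≤ n) :
    0 ≤ ∑ t ∈ Finset.Icc 1 (n - h), g t -
        ∑ k ∈ Finset.Icc 1 m, ∑ t ∈ Finset.Icc 1 (r - h), g ((k - 1) * r + t) ∧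
      ∑ t ∈ Finset.Icc 1 (n - h), g t -
        ∑ k ∈ Finset.Icc 1 m, ∑ t ∈ Finset.Icc 1 (r - h), g ((k - 1) * r + t) ≤
      ∑ k ∈ Finset.Icc 1 m, ∑ t ∈ Finset.Icc (r - h + 1) r, a ((k - 1) * r + t) +
        ∑ t ∈ Finset.Icc (m * r + 1) n, a t := by
  -- Extending g by zero after time n − h lets all sums be compared over the full range up to n.
  set G : ℕ → ℝ := fun t => if t ≤ n - h then g t else 0 with hG
  have hG0 : ∀ t, 0 ≤ G t := fun t => by simp only [hG]; split_ifs <;> simp [hg]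
  have hGa : ∀ t, G t ≤ a t := fun t => by
    simp only [hG]; split_ifs
    · exact hga t
    · exact (hg t).trans (hga t)
  have e1 : ∑ t ∈ Finset.Icc 1 (n - h), g t = ∑ t ∈ Finset.Icc 1 n, G t := by
    rw [sum_Icc_split G (Nat.sub_le n h)]
    have z : ∑ t ∈ Finset.Icc (n - h + 1) n, G t = 0 := by
      refine Finset.sum_eq_zero fun t ht => ?_
      simp only [hG]
      rw [if_neg]
      simp only [Finset.mem_Icc] at ht
      omega
    rw [z, add_zero]
    refine Finset.sum_congr rfl fun t ht => ?_
    simp only [hG]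
    rw [if_pos (Finset.mem_Icc.1 ht).2]
  -- The shortened blocks end at times at most m r − h ≤ n − h, so the truncation does not affect
  -- them.
  have e2 : ∑ k ∈ Finset.Icc 1 m, ∑ t ∈ Finset.Icc 1 (r - h), g ((k - 1) * r + t) =
      ∑ k ∈ Finset.Icc 1 m, ∑ t ∈ Finset.Icc 1 (r - h), G ((k - 1) * r + t) := by
    refine Finset.sum_congr rfl fun k hk => Finset.sum_congr rfl fun t ht => ?_
    simp only [hG]
    rw [if_pos]
    simp only [Finset.mem_Icc] at hk ht
    have : (k - 1) * r + r ≤ m * r := by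
      calc (k - 1) * r + r = (k - 1 + 1) * r := by ring
        _ ≤ m * r := Nat.mul_le_mul_right r (by omega)
    omega
  have e3 : ∑ t ∈ Finset.Icc 1 n, G t =
      ∑ k ∈ Finset.Icc 1 m, ∑ t ∈ Finset.Icc 1 (r - h), G ((k - 1) * r + t) +
      (∑ k ∈ Finset.Icc 1 m, ∑ t ∈ Finset.Icc (r - h + 1) r, G ((k - 1) * r + t) +
        ∑ t ∈ Finset.Icc (m * r + 1) n, G t) := by
    rw [sum_Icc_split G hmr, sum_Icc_blocks, ← add_assoc, ← Finset.sum_add_distrib]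
    congr 1
    refine Finset.sum_congr rfl fun k _ => ?_
    exact sum_Icc_split (fun t => G ((k - 1) * r + t)) (Nat.sub_le r h)
  rw [e1, e2, e3, add_sub_cancel_left]
  constructor
  · exact add_nonneg (Finset.sum_nonneg fun k _ => Finset.sum_nonneg fun t _ => hG0 _)
      (Finset.sum_nonneg fun t _ => hG0 _)
  · exact add_le_add (Finset.sum_le_sum fun k _ => Finset.sum_le_sum fun t _ => hGa _)
      (Finset.sum_le_sum fun t _ => hGa _)

/-! ### Laws of the observations -/

section Laws

variable {Ω : Type*} [MeasurableSpace Ω] {P : Measure Ω} {d : ℕ} {X : RandomField Ω d} {A B : Set (Fin d → ℝ)} {u : ℕ → ℝ} {r : Fin 3 → ℕ → ℕ} {n : Fin 3 → ℕ}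

lemma measurable_normalizedObs (hX : ∀ s t, Measurable (X s t)) (z : ℕ × ℕ × ℕ) :
    Measurable (normalizedObs X u n z) :=
  (hX ((z.1 : ℤ), (z.2.1 : ℤ)) (z.2.2 : ℝ≥0)).const_smul ((u (sampleSize n))⁻¹)

lemma measurable_block (hX : ∀ s t, Measurable (X s t)) (j : ℕ × ℕ × ℕ) :
    Measurable (block X u r n j) :=
  measurable_pi_lambda _ fun _ => measurable_normalizedObs hX _

/-- Stationarity speaks of finite families only; laws of infinite arrays agree as soon as all their
finite restrictions do. The map φ below rescales by the threshold and relabels the indices. -/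
lemma map_normalizedObs_shift [IsProbabilityMeasure P] (hX : ∀ s t, Measurable (X s t))
    (hstat : Stationary P X) (s : ℕ × ℕ × ℕ) :
    P.map (fun ω z => normalizedObs X u n (s.1 + z.1, s.2.1 + z.2.1, s.2.2 + z.2.2) ω) =
      P.map (fun ω (z : ℕ × ℕ × ℕ) => normalizedObs X u n z ω) := by
  refine (map_eq_iff_forall_finset_map_restrict_eq
    (X := fun (z : ℕ × ℕ × ℕ) ω =>
      normalizedObs X u n (s.1 + z.1, s.2.1 + z.2.1, s.2.2 + z.2.2) ω)
    (Y := fun (z : ℕ × ℕ × ℕ) ω => normalizedObs X u n z ω)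
    (measurable_pi_lambda _ fun _ => measurable_normalizedObs hX _).aemeasurable
    (measurable_pi_lambda _ fun _ => measurable_normalizedObs hX _).aemeasurable).2 fun I => ?_
  let e := I.equivFin
  let φ : (Fin I.card → Fin d → ℝ) → (I → Fin d → ℝ) := fun x z => (u (sampleSize n))⁻¹ • x (e z)
  have hφ : Measurable φ :=
    measurable_pi_lambda _ fun z => (measurable_pi_apply (e z)).const_smul ((u (sampleSize n))⁻¹)
  have h := hstat I.card (fun i => (((e.symm i).1.1 : ℤ), ((e.symm i).1.2.1 : ℤ)))
    (fun i => ((e.symm i).1.2.2 : ℝ≥0)) ((s.1 : ℤ), (s.2.1 : ℤ)) (s.2.2 : ℝ≥0)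
  have h' := congrArg (Measure.map φ) h
  rw [Measure.map_map hφ (measurable_pi_lambda _ fun _ => hX _ _),
    Measure.map_map hφ (measurable_pi_lambda _ fun _ => hX _ _)] at h'
  convert h' using 2
  · ext ω z
    simp [φ, normalizedObs, add_comm]
  · ext ω z
    simp [φ, normalizedObs]

lemma identDistrib_block [IsProbabilityMeasure P] (hX : ∀ s t, Measurable (X s t))
    (hstat : Stationary P X) (j : ℕ × ℕ × ℕ) :
    IdentDistrib (block X u r n j) (block X u r n (1, 1, 1)) P P where
  aemeasurable_fst := (measurable_block hX j).aemeasurable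
  aemeasurable_snd := (measurable_block hX _).aemeasurable
  map_eq := by
    have h1 := map_normalizedObs_shift (u := u) (n := n) hX hstat
      ((j.1 - 1) * blockDim r n 0, (j.2.1 - 1) * blockDim r n 1, (j.2.2 - 1) * blockDim r n 2)
    have h2 := map_normalizedObs_shift (u := u) (n := n) hX hstat
      ((1 - 1) * blockDim r n 0, (1 - 1) * blockDim r n 1, (1 - 1) * blockDim r n 2)
    exact h1.trans h2.symm

lemma measureReal_normalizedObs_mem (hX : ∀ s t, Measurable (X s t)) (hstat : Stationary P X)
    (hA : MeasurableSet A) (z : ℕ × ℕ × ℕ) :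
    P.real {ω | normalizedObs X u n z ω ∈ A} = exceedProb P X A u (sampleSize n) := by
  have h := hstat 1 (fun _ => (0, 0)) (fun _ => 0) ((z.1 : ℤ), (z.2.1 : ℤ)) (z.2.2 : ℝ≥0)
  have hm : MeasurableSet {x : Fin 1 → Fin d → ℝ | (u (sampleSize n))⁻¹ • x 0 ∈ A} :=
    ((measurable_pi_apply 0).const_smul ((u (sampleSize n))⁻¹)) hA
  have h' := congrArg (fun μ : Measure (Fin 1 → Fin d → ℝ) => μ.real
    {x | (u (sampleSize n))⁻¹ • x 0 ∈ A}) h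
  rw [map_measureReal_apply (measurable_pi_lambda _ fun _ => hX _ _) hm,
    map_measureReal_apply (measurable_pi_lambda _ fun _ => hX _ _) hm] at h'
  simpa [normalizedObs, exceedProb, Set.preimage] using h'

lemma measurableSet_smul_mem {c : ℝ} (hA : MeasurableSet A) :
    MeasurableSet {x : Fin d → ℝ | c • x ∈ A} :=
  (measurable_id.const_smul c) hA

lemma boundedAwayFromZero_smul {c : ℝ} (hc : 0 < c) (hA : BoundedAwayFromZero A) :
    BoundedAwayFromZero {x : Fin d → ℝ | c • x ∈ A} := by
  obtain ⟨ε, hε, h⟩ := hA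
  refine ⟨ε / c, by positivity, fun x hx => ?_⟩
  have := h _ hx
  rwa [norm_smul, Real.norm_eq_abs, abs_of_pos hc, mul_comm, ← div_le_iff₀ hc] at this

/-- Stationarity moves c to the origin, then isotropy moves i − c to (h_s, 0). Isotropy is applied
to the preimages of A and B under the rescaling, which remain bounded away from zero because the
threshold is positive. -/
lemma measureReal_normalizedObs_mem_and (hX : ∀ s t, Measurable (X s t)) (hstat : Stationary P X)
    (hiso : Isotropic P X) (hA : MeasurableSet A) (hB : MeasurableSet B)
    (hA0 : BoundedAwayFromZero A) (hB0 : BoundedAwayFromZero B) (hu : 0 < u (sampleSize n))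
    {c i : ℕ × ℕ} {hs ht : ℕ}
    (hci : max |(c.1 : ℤ) - (i.1 : ℤ)| |(c.2 : ℤ) - (i.2 : ℤ)| = (hs : ℤ)) (t : ℕ) :
    P.real {ω | normalizedObs X u n (c.1, c.2, t) ω ∈ A ∧
        normalizedObs X u n (i.1, i.2, t + ht) ω ∈ B} =
      P.real {ω | (u (sampleSize n))⁻¹ • X (0, 0) 0 ω ∈ A ∧
        (u (sampleSize n))⁻¹ • X ((hs : ℤ), 0) (ht : ℝ≥0) ω ∈ B} := by
  have h := hstat 2 ![(0, 0), ((i.1 : ℤ) - c.1, (i.2 : ℤ) - c.2)] ![0, (ht : ℝ≥0)]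
    ((c.1 : ℤ), (c.2 : ℤ)) (t : ℝ≥0)
  have hm : MeasurableSet {x : Fin 2 → Fin d → ℝ | (u (sampleSize n))⁻¹ • x 0 ∈ A ∧
      (u (sampleSize n))⁻¹ • x 1 ∈ B} :=
    (((measurable_pi_apply 0).const_smul ((u (sampleSize n))⁻¹)) hA).inter
      (((measurable_pi_apply 1).const_smul ((u (sampleSize n))⁻¹)) hB)
  have h' := congrArg (fun μ : Measure (Fin 2 → Fin d → ℝ) => μ.real
    {x | (u (sampleSize n))⁻¹ • x 0 ∈ A ∧ (u (sampleSize n))⁻¹ • x 1 ∈ B}) h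
  rw [map_measureReal_apply (measurable_pi_lambda _ fun _ => hX _ _) hm,
    map_measureReal_apply (measurable_pi_lambda _ fun _ => hX _ _) hm] at h'
  have h2 := hiso _ _ (measurableSet_smul_mem (c := (u (sampleSize n))⁻¹) hA)
    (measurableSet_smul_mem (c := (u (sampleSize n))⁻¹) hB)
    (boundedAwayFromZero_smul (inv_pos.2 hu) hA0) (boundedAwayFromZero_smul (inv_pos.2 hu) hB0)
    hs ht ((i.1 : ℤ) - c.1, (i.2 : ℤ) - c.2) ((hs : ℤ), 0)
    (by rw [← hci, abs_sub_comm (c.1 : ℤ), abs_sub_comm (c.2 : ℤ)]) (by simp)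
  have h3 := congrArg ENNReal.toReal h2
  refine Eq.trans ?_ h3
  refine Eq.trans ?_ (h'.trans ?_)
  · simp [normalizedObs, Set.preimage, add_comm]
  · simp [measureReal_def, Set.preimage]

end Laws

/-! ### Values and moments of the extremal functionals on blocks -/

/-- The blocks have sides which are large compared to the lag `(hs, ht)` and small compared to the
observation window. -/
structure LargeBlocks (r : Fin 3 → ℕ → ℕ) (n : Fin 3 → ℕ) (hs ht : ℕ) : Prop where
  side0 : 2 * hs + 2 ≤ blockDim r n 0
  side1 : 2 * hs + 2 ≤ blockDim r n 1
  one_le : 1 ≤ blockDim r n 2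
  lag : ht ≤ blockDim r n 2
  le : ∀ i, blockDim r n i ≤ n i

/-- The contribution of the centre `c` and of the time `t` to the extremal functionals. -/
noncomputable def lagTerm {Ω : Type*} {d : ℕ} (X : RandomField Ω d) (A C : Set (Fin d → ℝ))
    (u : ℕ → ℝ) (hs ht : ℕ) (n : Fin 3 → ℕ) (c : ℕ × ℕ) (t : ℕ) (ω : Ω) : ℝ :=
  ∑ i ∈ sphere (n 0) (n 1) hs c, (A ×ˢ C).indicator (fun _ => (1 : ℝ))
    (normalizedObs X u n (c.1, c.2, t) ω, normalizedObs X u n (i.1, i.2, t + ht) ω) /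
      ((sphere (n 0) (n 1) hs c).card : ℝ)

section Geometry

variable {r : Fin 3 → ℕ → ℕ} {n : Fin 3 → ℕ} {hs ht : ℕ}

lemma LargeBlocks.zero (h : LargeBlocks r n hs ht) : LargeBlocks r n 0 0 :=
  ⟨by have := h.side0; omega, by have := h.side1; omega, h.one_le, Nat.zero_le _, h.le⟩

/-- The side bound 2 h_s + 2 is what makes the sphere of radius h_s fit in the block despite the
integer part in the centre. -/
lemma LargeBlocks.center_fst (h : LargeBlocks r n hs ht) :
    hs < (center (blockDim r n 0) (blockDim r n 1)).1 ∧
      (center (blockDim r n 0) (blockDim r n 1)).1 + hs ≤ blockDim r n 0 := by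
  have := h.side0
  simp only [center]
  omega

lemma LargeBlocks.center_snd (h : LargeBlocks r n hs ht) :
    hs < (center (blockDim r n 0) (blockDim r n 1)).2 ∧
      (center (blockDim r n 0) (blockDim r n 1)).2 + hs ≤ blockDim r n 1 := by
  have := h.side1
  simp only [center]
  omega

lemma LargeBlocks.numBlocks_pos (h : LargeBlocks r n hs ht) (i : Fin 3) :
    1 ≤ numBlocks r n i := by
  have h0 := h.side0
  have h1 := h.side1
  have h2 := h.one_le
  refine (Nat.one_le_div_iff ?_).2 (h.le i)
  fin_cases i <;> simp <;> omega

lemma LargeBlocks.one_mem (h : LargeBlocks r n hs ht) : (1, 1, 1) ∈ blockIndices r n := by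
  simp [blockIndices, h.numBlocks_pos]

lemma shift_add_side_le {i : Fin 3} {q : ℕ} (h1 : 1 ≤ q) (h2 : q ≤ numBlocks r n i) :
    (q - 1) * blockDim r n i + blockDim r n i ≤ n i := by
  calc (q - 1) * blockDim r n i + blockDim r n i = (q - 1 + 1) * blockDim r n i := by ring
    _ ≤ numBlocks r n i * blockDim r n i := Nat.mul_le_mul_right _ (by omega)
    _ ≤ n i := Nat.div_mul_le_self _ _

lemma mem_spatialIndices {j : ℕ × ℕ} : j ∈ spatialIndices r n ↔
    (1 ≤ j.1 ∧ j.1 ≤ numBlocks r n 0) ∧ 1 ≤ j.2 ∧ j.2 ≤ numBlocks r n 1 := by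
  simp [spatialIndices]

lemma sum_blockIndices {M : Type*} [AddCommMonoid M] (f : ℕ × ℕ × ℕ → M) :
    ∑ j ∈ blockIndices r n, f j =
      ∑ j ∈ spatialIndices r n, ∑ k ∈ Finset.Icc 1 (numBlocks r n 2), f (j.1, j.2, k) := by
  rw [blockIndices, spatialIndices, Finset.sum_product, Finset.sum_product]
  refine Finset.sum_congr rfl fun a _ => ?_
  rw [Finset.sum_product]

/-- The sphere around a block centre does not leave its block, so it makes no difference whether it
is cut out of the whole grid, as in the estimator, or out of the block, as in the functional. -/
lemma LargeBlocks.sum_sphere (h : LargeBlocks r n hs ht) {j : ℕ × ℕ}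
    (hj : j ∈ spatialIndices r n) {M : Type*} [AddCommMonoid M] (f : ℕ × ℕ → M) :
    ∑ i ∈ sphere (n 0) (n 1) hs (blockCenter (blockDim r n 0) (blockDim r n 1) j), f i =
      ∑ i ∈ sphere (blockDim r n 0) (blockDim r n 1) hs
        (center (blockDim r n 0) (blockDim r n 1)),
        f ((j.1 - 1) * blockDim r n 0 + i.1, (j.2 - 1) * blockDim r n 1 + i.2) := by
  rw [mem_spatialIndices] at hj
  rw [blockCenter_eq hj.1.1 hj.2.1]
  exact sum_sphere_shift (s := ((j.1 - 1) * blockDim r n 0, (j.2 - 1) * blockDim r n 1))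
    h.center_fst.1 h.center_snd.1 h.center_fst.2 h.center_snd.2
    (shift_add_side_le hj.1.1 hj.1.2) (shift_add_side_le hj.2.1 hj.2.2) f

lemma LargeBlocks.card_sphere (h : LargeBlocks r n hs ht) {j : ℕ × ℕ}
    (hj : j ∈ spatialIndices r n) :
    (sphere (n 0) (n 1) hs (blockCenter (blockDim r n 0) (blockDim r n 1) j)).card =
      (sphere (blockDim r n 0) (blockDim r n 1) hs
        (center (blockDim r n 0) (blockDim r n 1))).card := by
  rw [Finset.card_eq_sum_ones, Finset.card_eq_sum_ones, h.sum_sphere hj]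

lemma LargeBlocks.card_sphere_pos (h : LargeBlocks r n hs ht) {j : ℕ × ℕ}
    (hj : j ∈ spatialIndices r n) :
    0 < (sphere (n 0) (n 1) hs (blockCenter (blockDim r n 0) (blockDim r n 1) j)).card := by
  rw [h.card_sphere hj]
  have h1 := h.center_fst
  have h2 := h.center_snd
  exact sphere_card_pos (by omega) (by omega) (by omega) (by omega)

lemma LargeBlocks.one_mem_spatial (h : LargeBlocks r n hs ht) : (1, 1) ∈ spatialIndices r n := by
  simp [spatialIndices, h.numBlocks_pos]

lemma blockCenter_one (a b : ℕ) : blockCenter a b (1, 1) = center a b := by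
  simp [blockCenter, center]

lemma LargeBlocks.sphere_zero_eq (h : LargeBlocks r n hs ht) {j : ℕ × ℕ}
    (hj : j ∈ spatialIndices r n) :
    sphere (n 0) (n 1) 0 (blockCenter (blockDim r n 0) (blockDim r n 1) j) =
      {blockCenter (blockDim r n 0) (blockDim r n 1) j} := by
  have h1 := h.center_fst
  have h2 := h.center_snd
  have hj' := mem_spatialIndices.1 hj
  rw [blockCenter_eq hj'.1.1 hj'.2.1]
  have h3 := shift_add_side_le hj'.1.1 hj'.1.2
  have h4 := shift_add_side_le hj'.2.1 hj'.2.2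
  exact sphere_zero (by dsimp only; omega) (by dsimp only; omega) (by dsimp only; omega)
    (by dsimp only; omega)

end Geometry

section Moments

variable {Ω : Type*} {d : ℕ} {X : RandomField Ω d} {A B C C' : Set (Fin d → ℝ)} {u : ℕ → ℝ}
  {r : Fin 3 → ℕ → ℕ} {n : Fin 3 → ℕ} {hs ht hs' ht' : ℕ}

lemma lagTerm_nonneg (c : ℕ × ℕ) (t : ℕ) (ω : Ω) : 0 ≤ lagTerm X A C u hs ht n c t ω :=
  Finset.sum_nonneg fun _ _ => div_nonneg (Set.indicator_nonneg (fun _ _ => zero_le_one) _)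
    (Nat.cast_nonneg _)

/-- An average of indicators, each below that of an exceedance at the centre. This domination
controls the boundary terms, the limiting variances and the size of the estimator. -/
lemma lagTerm_le (c : ℕ × ℕ) (t : ℕ) (ω : Ω) : lagTerm X A C u hs ht n c t ω ≤
    A.indicator (fun _ => (1 : ℝ)) (normalizedObs X u n (c.1, c.2, t) ω) := by
  set a := A.indicator (fun _ => (1 : ℝ)) (normalizedObs X u n (c.1, c.2, t) ω) with ha
  have ha0 : 0 ≤ a := Set.indicator_nonneg (fun _ _ => zero_le_one) _
  have h1 : lagTerm X A C u hs ht n c t ω ≤ ∑ _i ∈ sphere (n 0) (n 1) hs c,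
      a / ((sphere (n 0) (n 1) hs c).card : ℝ) := by
    refine Finset.sum_le_sum fun _ _ => div_le_div_of_nonneg_right ?_ (Nat.cast_nonneg _)
    rw [ha]
    by_cases h : normalizedObs X u n (c.1, c.2, t) ω ∈ A
    · rw [Set.indicator_of_mem h]
      exact Set.indicator_le_self' (fun _ _ => zero_le_one) _
    · rw [Set.indicator_of_notMem h, Set.indicator_of_notMem (fun h' => h h'.1)]
  refine h1.trans ?_
  rw [Finset.sum_const, nsmul_eq_mul]
  -- On an empty sphere the sum is empty, hence zero, and the bound is trivial.
  rcases Nat.eq_zero_or_pos (sphere (n 0) (n 1) hs c).card with h | h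
  · rw [h]; simpa using ha0
  · have : ((sphere (n 0) (n 1) hs c).card : ℝ) ≠ 0 := by positivity
    rw [mul_div_cancel₀ _ this]

lemma LargeBlocks.lagTerm_self (h : LargeBlocks r n hs ht) {j : ℕ × ℕ}
    (hj : j ∈ spatialIndices r n) (t : ℕ) (ω : Ω) :
    lagTerm X A A u 0 0 n (blockCenter (blockDim r n 0) (blockDim r n 1) j) t ω =
      A.indicator (fun _ => (1 : ℝ)) (normalizedObs X u n
        ((blockCenter (blockDim r n 0) (blockDim r n 1) j).1,
          (blockCenter (blockDim r n 0) (blockDim r n 1) j).2, t) ω) := by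
  rw [lagTerm, h.sphere_zero_eq hj, Finset.sum_singleton, add_zero]
  by_cases h1 : normalizedObs X u n
    ((blockCenter (blockDim r n 0) (blockDim r n 1) j).1,
      (blockCenter (blockDim r n 0) (blockDim r n 1) j).2, t) ω ∈ A <;> simp [h1]

/-- Puts the functional in the global coordinates of the estimator, so that both become sums of the
same `lagTerm`s. -/
lemma LargeBlocks.onBlock_eq (h : LargeBlocks r n hs ht) {j : ℕ × ℕ × ℕ}
    (hj : (j.1, j.2.1) ∈ spatialIndices r n) (ω : Ω) :
    onBlock X u r (extremalFunctional A C hs ht) n j ω =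
      ∑ t ∈ Finset.Icc 1 (blockDim r n 2 - ht), lagTerm X A C u hs ht n
        (blockCenter (blockDim r n 0) (blockDim r n 1) (j.1, j.2.1))
        ((j.2.2 - 1) * blockDim r n 2 + t) ω := by
  have hj' := mem_spatialIndices.1 hj
  simp only [onBlock, extremalFunctional]
  rw [Finset.sum_comm]
  refine Finset.sum_congr rfl fun t _ => ?_
  rw [lagTerm, h.card_sphere hj, h.sum_sphere hj, blockCenter_eq hj'.1.1 hj'.2.1]
  refine Finset.sum_congr rfl fun i _ => ?_
  simp only [block, add_assoc]

lemma mem_blockIndices_spatial {j : ℕ × ℕ × ℕ} (hj : j ∈ blockIndices r n) :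
    (j.1, j.2.1) ∈ spatialIndices r n := by
  simp only [blockIndices, Finset.mem_product] at hj
  simp only [spatialIndices, Finset.mem_product]
  exact ⟨hj.1, hj.2.1⟩

lemma onBlock_nonneg (j : ℕ × ℕ × ℕ) (ω : Ω) :
    0 ≤ onBlock X u r (extremalFunctional A C hs ht) n j ω :=
  Finset.sum_nonneg fun _ _ => Finset.sum_nonneg fun _ _ =>
    div_nonneg (Set.indicator_nonneg (fun _ _ => zero_le_one) _) (Nat.cast_nonneg _)

lemma LargeBlocks.onBlock_le (h : LargeBlocks r n hs ht) {j : ℕ × ℕ × ℕ}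
    (hj : j ∈ blockIndices r n) (ω : Ω) :
    onBlock X u r (extremalFunctional A C hs ht) n j ω ≤
      onBlock X u r (extremalFunctional A A 0 0) n j ω := by
  have hj' := mem_blockIndices_spatial hj
  rw [h.onBlock_eq hj', h.zero.onBlock_eq hj']
  refine (Finset.sum_le_sum fun t _ => lagTerm_le _ _ _).trans ?_
  simp only [h.zero.lagTerm_self hj']
  exact Finset.sum_le_sum_of_subset_of_nonneg
    (Finset.Icc_subset_Icc_right (by omega))
    fun t _ _ => Set.indicator_nonneg (fun _ _ => zero_le_one) _

lemma abs_onBlock_le (j : ℕ × ℕ × ℕ) (ω : Ω) :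
    |onBlock X u r (extremalFunctional A C hs ht) n j ω| ≤
      ∑ _i ∈ sphere (blockDim r n 0) (blockDim r n 1) hs
          (center (blockDim r n 0) (blockDim r n 1)),
        ∑ _t ∈ Finset.Icc 1 (blockDim r n 2 - ht), (1 : ℝ) := by
  rw [abs_of_nonneg (onBlock_nonneg j ω)]
  refine Finset.sum_le_sum fun i hi => Finset.sum_le_sum fun t _ => ?_
  have hc : (1 : ℝ) ≤ ((sphere (blockDim r n 0) (blockDim r n 1) hs
      (center (blockDim r n 0) (blockDim r n 1))).card : ℝ) := by
    exact_mod_cast Finset.card_pos.2 ⟨i, hi⟩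
  rw [div_le_one (by linarith)]
  exact (Set.indicator_le_self' (fun _ _ => zero_le_one) _).trans hc

variable [MeasurableSpace Ω]

lemma measurable_lagTerm (hX : ∀ s t, Measurable (X s t)) (hA : MeasurableSet A)
    (hC : MeasurableSet C) (c : ℕ × ℕ) (t : ℕ) : Measurable (lagTerm X A C u hs ht n c t) := by
  refine Finset.measurable_fun_sum _ fun i _ => Measurable.div_const ?_ _
  exact (measurable_const.indicator (hA.prod hC)).comp
    ((measurable_normalizedObs hX _).prodMk (measurable_normalizedObs hX _))

lemma measurable_extremalFunctional (hA : MeasurableSet A) (hC : MeasurableSet C)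
    (l : Fin 3 → ℕ) : Measurable (extremalFunctional A C hs ht l) := by
  refine Finset.measurable_fun_sum _ fun i _ => Finset.measurable_fun_sum _ fun t _ =>
    Measurable.div_const ?_ _
  exact (measurable_const.indicator (hA.prod hC)).comp
    ((measurable_pi_apply _).prodMk (measurable_pi_apply _))

lemma measurable_onBlock (hX : ∀ s t, Measurable (X s t)) (hA : MeasurableSet A)
    (hC : MeasurableSet C) (j : ℕ × ℕ × ℕ) :
    Measurable (onBlock X u r (extremalFunctional A C hs ht) n j) :=
  (measurable_extremalFunctional hA hC _).comp (measurable_block hX j)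

variable {P : Measure Ω}

lemma integral_indicator_normalizedObs (hX : ∀ s t, Measurable (X s t)) (hstat : Stationary P X)
    (hA : MeasurableSet A) (z : ℕ × ℕ × ℕ) :
    ∫ ω, A.indicator (fun _ => (1 : ℝ)) (normalizedObs X u n z ω) ∂P =
      exceedProb P X A u (sampleSize n) := by
  have hm : MeasurableSet {ω | normalizedObs X u n z ω ∈ A} := measurable_normalizedObs hX z hA
  rw [← measureReal_normalizedObs_mem hX hstat hA z, ← integral_indicator_one hm]
  rfl

lemma preIsoExtremogram_self (hv : exceedProb P X A u (sampleSize n) ≠ 0) :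
    preIsoExtremogram P X A A u 0 0 (sampleSize n) = 1 := by
  rw [exceedProb] at hv
  simp [preIsoExtremogram, div_self hv]

variable [IsProbabilityMeasure P]

lemma integrable_indicator_normalizedObs (hX : ∀ s t, Measurable (X s t)) (hA : MeasurableSet A)
    (z : ℕ × ℕ × ℕ) :
    Integrable (fun ω => A.indicator (fun _ => (1 : ℝ)) (normalizedObs X u n z ω)) P := by
  refine Integrable.of_bound (C := 1) ((measurable_const.indicator hA).comp
    (measurable_normalizedObs hX z)).aestronglyMeasurable (ae_of_all _ fun ω => ?_)
  by_cases h : normalizedObs X u n z ω ∈ A <;> simp [h]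

lemma integrable_lagTerm (hX : ∀ s t, Measurable (X s t)) (hA : MeasurableSet A)
    (hC : MeasurableSet C) (c : ℕ × ℕ) (t : ℕ) :
    Integrable (lagTerm X A C u hs ht n c t) P :=
  (integrable_indicator_normalizedObs hX hA (c.1, c.2, t)).mono'
    (measurable_lagTerm hX hA hC c t).aestronglyMeasurable (ae_of_all _ fun ω => by
      rw [Real.norm_eq_abs, abs_of_nonneg (lagTerm_nonneg c t ω)]
      exact lagTerm_le c t ω)

/-- By isotropy every point of the sphere contributes the same joint probability, and the division
by the number of points turns the sum into that probability. -/
lemma integral_lagTerm (hX : ∀ s t, Measurable (X s t)) (hstat : Stationary P X)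
    (hiso : Isotropic P X) (hA : MeasurableSet A) (hC : MeasurableSet C)
    (hA0 : BoundedAwayFromZero A) (hC0 : BoundedAwayFromZero C) (hu : 0 < u (sampleSize n))
    (hv : exceedProb P X A u (sampleSize n) ≠ 0) (c : ℕ × ℕ) (t : ℕ)
    (hc : 0 < (sphere (n 0) (n 1) hs c).card) :
    ∫ ω, lagTerm X A C u hs ht n c t ω ∂P = exceedProb P X A u (sampleSize n) *
      preIsoExtremogram P X A C u hs ht (sampleSize n) := by
  have hset : ∀ i : ℕ × ℕ, MeasurableSet {ω | normalizedObs X u n (c.1, c.2, t) ω ∈ A ∧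
      normalizedObs X u n (i.1, i.2, t + ht) ω ∈ C} := fun i =>
    (measurable_normalizedObs hX _ hA).inter (measurable_normalizedObs hX _ hC)
  have hind : ∀ i : ℕ × ℕ, (fun ω => (A ×ˢ C).indicator (fun _ => (1 : ℝ))
      (normalizedObs X u n (c.1, c.2, t) ω, normalizedObs X u n (i.1, i.2, t + ht) ω)) =
      {ω | normalizedObs X u n (c.1, c.2, t) ω ∈ A ∧
        normalizedObs X u n (i.1, i.2, t + ht) ω ∈ C}.indicator 1 := fun i => by
    ext ω
    by_cases h1 : normalizedObs X u n (c.1, c.2, t) ω ∈ A <;>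
      by_cases h2 : normalizedObs X u n (i.1, i.2, t + ht) ω ∈ C <;> simp [Set.indicator, h1, h2]
  simp only [lagTerm]
  rw [integral_finsetSum]
  · have h1 : ∀ i ∈ sphere (n 0) (n 1) hs c, ∫ ω, (A ×ˢ C).indicator (fun _ => (1 : ℝ))
        (normalizedObs X u n (c.1, c.2, t) ω, normalizedObs X u n (i.1, i.2, t + ht) ω) /
          ((sphere (n 0) (n 1) hs c).card : ℝ) ∂P =
        exceedProb P X A u (sampleSize n) * preIsoExtremogram P X A C u hs ht (sampleSize n) /
          ((sphere (n 0) (n 1) hs c).card : ℝ) := by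
      intro i hi
      rw [integral_div, hind i, integral_indicator_one (hset i),
        measureReal_normalizedObs_mem_and hX hstat hiso hA hC hA0 hC0 hu (mem_sphere.1 hi).2]
      congr 1
      rw [preIsoExtremogram, ← exceedProb, mul_div_cancel₀ _ hv]
    rw [Finset.sum_congr rfl h1, Finset.sum_const, nsmul_eq_mul, mul_div_cancel₀]
    positivity
  · intro i _
    refine Integrable.div_const ?_ _
    rw [hind i]
    exact (integrable_const (1 : ℝ)).indicator (hset i)

lemma memLp_onBlock (hX : ∀ s t, Measurable (X s t)) (hA : MeasurableSet A)
    (hC : MeasurableSet C) (j : ℕ × ℕ × ℕ) :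
    MemLp (onBlock X u r (extremalFunctional A C hs ht) n j) 2 P :=
  MemLp.of_bound (measurable_onBlock hX hA hC j).aestronglyMeasurable _
    (ae_of_all _ fun ω => abs_onBlock_le j ω)

/-- The deficit h_t against the full time length r₃ is the only bias left when ρ_n times the mean of
the exceedance functional is subtracted. -/
lemma LargeBlocks.integral_onBlock (h : LargeBlocks r n hs ht) (hX : ∀ s t, Measurable (X s t))
    (hstat : Stationary P X) (hiso : Isotropic P X) (hA : MeasurableSet A) (hC : MeasurableSet C)
    (hA0 : BoundedAwayFromZero A) (hC0 : BoundedAwayFromZero C) (hu : 0 < u (sampleSize n))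
    (hv : exceedProb P X A u (sampleSize n) ≠ 0) {j : ℕ × ℕ × ℕ} (hj : j ∈ blockIndices r n) :
    ∫ ω, onBlock X u r (extremalFunctional A C hs ht) n j ω ∂P =
      ((blockDim r n 2 : ℝ) - ht) * (exceedProb P X A u (sampleSize n) *
        preIsoExtremogram P X A C u hs ht (sampleSize n)) := by
  have hj' := mem_blockIndices_spatial hj
  simp only [h.onBlock_eq hj']
  rw [integral_finsetSum _ fun t _ => integrable_lagTerm hX hA hC _ _,
    Finset.sum_congr rfl fun t _ => integral_lagTerm hX hstat hiso hA hC hA0 hC0 hu hv _ _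
      (h.card_sphere_pos hj'), Finset.sum_const, nsmul_eq_mul, Nat.card_Icc]
  congr 1
  rw [Nat.add_sub_cancel, Nat.cast_sub h.lag]

lemma LargeBlocks.integral_onBlock_self (h : LargeBlocks r n hs ht)
    (hX : ∀ s t, Measurable (X s t)) (hstat : Stationary P X) (hiso : Isotropic P X)
    (hA : MeasurableSet A) (hA0 : BoundedAwayFromZero A) (hu : 0 < u (sampleSize n))
    (hv : exceedProb P X A u (sampleSize n) ≠ 0) {j : ℕ × ℕ × ℕ} (hj : j ∈ blockIndices r n) :
    ∫ ω, onBlock X u r (extremalFunctional A A 0 0) n j ω ∂P =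
      (blockDim r n 2 : ℝ) * exceedProb P X A u (sampleSize n) := by
  rw [h.zero.integral_onBlock hX hstat hiso hA hA hA0 hA0 hu hv hj, preIsoExtremogram_self hv]
  simp

lemma indicator_prod_mul_indicator_prod (x y x' y' : Fin d → ℝ) :
    (A ×ˢ C).indicator (fun _ => (1 : ℝ)) (x, y) * (A ×ˢ C').indicator (fun _ => (1 : ℝ)) (x', y') =
      {p : (Fin d → ℝ) × (Fin d → ℝ) × (Fin d → ℝ) × (Fin d → ℝ) |
        p.1 ∈ A ∧ p.2.1 ∈ A ∧ p.2.2.1 ∈ C ∧ p.2.2.2 ∈ C'}.indicator (fun _ => (1 : ℝ))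
        (x, x', y, y') := by
  by_cases h1 : x ∈ A <;> by_cases h2 : y ∈ C <;> by_cases h3 : x' ∈ A <;>
    by_cases h4 : y' ∈ C' <;> simp [Set.indicator, h1, h2, h3, h4]

/-- A product of indicators is the indicator of a joint event, so the raw second moments of the
functionals on a block are exactly the sums that (Cov') normalises. -/
lemma LargeBlocks.integral_onBlock_mul (h : LargeBlocks r n hs ht) (h' : LargeBlocks r n hs' ht')
    (hX : ∀ s t, Measurable (X s t)) (hA : MeasurableSet A) (hC : MeasurableSet C)
    (hC' : MeasurableSet C') :
    ∫ ω, onBlock X u r (extremalFunctional A C hs ht) n (1, 1, 1) ω *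
        onBlock X u r (extremalFunctional A C' hs' ht') n (1, 1, 1) ω ∂P =
      ∑ i ∈ sphere (n 0) (n 1) hs (center (blockDim r n 0) (blockDim r n 1)),
        ∑ i' ∈ sphere (n 0) (n 1) hs' (center (blockDim r n 0) (blockDim r n 1)),
        ∑ t ∈ Finset.Icc 1 (blockDim r n 2 - ht), ∑ t' ∈ Finset.Icc 1 (blockDim r n 2 - ht'),
          P.real {ω |
            normalizedObs X u n ((center (blockDim r n 0) (blockDim r n 1)).1,
              (center (blockDim r n 0) (blockDim r n 1)).2, t) ω ∈ A ∧
            normalizedObs X u n ((center (blockDim r n 0) (blockDim r n 1)).1,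
              (center (blockDim r n 0) (blockDim r n 1)).2, t') ω ∈ A ∧
            normalizedObs X u n (i.1, i.2, t + ht) ω ∈ C ∧
            normalizedObs X u n (i'.1, i'.2, t' + ht') ω ∈ C'} /
          (((sphere (n 0) (n 1) hs (center (blockDim r n 0) (blockDim r n 1))).card : ℝ) *
            ((sphere (n 0) (n 1) hs' (center (blockDim r n 0) (blockDim r n 1))).card : ℝ)) := by
  have h1 : ∀ ω, onBlock X u r (extremalFunctional A C hs ht) n (1, 1, 1) ω = _ := fun ω =>
    h.onBlock_eq (j := (1, 1, 1)) h.one_mem_spatial ω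
  have h2 : ∀ ω, onBlock X u r (extremalFunctional A C' hs' ht') n (1, 1, 1) ω = _ := fun ω =>
    h'.onBlock_eq (j := (1, 1, 1)) h.one_mem_spatial ω
  simp only [h1, h2, blockCenter_one, lagTerm, Nat.sub_self, zero_mul, zero_add]
  set c := center (blockDim r n 0) (blockDim r n 1) with hc
  have h3 : ∀ ω, _ = _ := fun ω => Finset.sum_comm (s := Finset.Icc 1 (blockDim r n 2 - ht))
    (t := sphere (n 0) (n 1) hs c) (f := fun t i => (A ×ˢ C).indicator (fun _ => (1 : ℝ))
      (normalizedObs X u n (c.1, c.2, t) ω, normalizedObs X u n (i.1, i.2, t + ht) ω) /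
        ((sphere (n 0) (n 1) hs c).card : ℝ))
  have h4 : ∀ ω, _ = _ := fun ω => Finset.sum_comm (s := Finset.Icc 1 (blockDim r n 2 - ht'))
    (t := sphere (n 0) (n 1) hs' c) (f := fun t i => (A ×ˢ C').indicator (fun _ => (1 : ℝ))
      (normalizedObs X u n (c.1, c.2, t) ω, normalizedObs X u n (i.1, i.2, t + ht') ω) /
        ((sphere (n 0) (n 1) hs' c).card : ℝ))
  simp only [h3, h4, Finset.sum_mul_sum, div_mul_div_comm, indicator_prod_mul_indicator_prod]
  have hset : ∀ (i i' : ℕ × ℕ) (t t' : ℕ), MeasurableSet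
      {ω | normalizedObs X u n (c.1, c.2, t) ω ∈ A ∧ normalizedObs X u n (c.1, c.2, t') ω ∈ A ∧
        normalizedObs X u n (i.1, i.2, t + ht) ω ∈ C ∧
        normalizedObs X u n (i'.1, i'.2, t' + ht') ω ∈ C'} := fun i i' t t' =>
    (measurable_normalizedObs hX _ hA).inter ((measurable_normalizedObs hX _ hA).inter
      ((measurable_normalizedObs hX _ hC).inter (measurable_normalizedObs hX _ hC')))
  have hind : ∀ (i i' : ℕ × ℕ) (t t' : ℕ), Integrable (fun ω =>
      {p : (Fin d → ℝ) × (Fin d → ℝ) × (Fin d → ℝ) × (Fin d → ℝ) |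
        p.1 ∈ A ∧ p.2.1 ∈ A ∧ p.2.2.1 ∈ C ∧ p.2.2.2 ∈ C'}.indicator (fun _ => (1 : ℝ))
        (normalizedObs X u n (c.1, c.2, t) ω, normalizedObs X u n (c.1, c.2, t') ω,
          normalizedObs X u n (i.1, i.2, t + ht) ω,
          normalizedObs X u n (i'.1, i'.2, t' + ht') ω) /
        (((sphere (n 0) (n 1) hs c).card : ℝ) * ((sphere (n 0) (n 1) hs' c).card : ℝ))) P :=
    fun i i' t t' => ((integrable_const (1 : ℝ)).indicator (hset i i' t t')).div_const _
  rw [integral_finsetSum _ fun i _ => integrable_finsetSum _ fun i' _ =>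
    integrable_finsetSum _ fun t _ => integrable_finsetSum _ fun t' _ => hind i i' t t']
  refine Finset.sum_congr rfl fun i _ => ?_
  rw [integral_finsetSum _ fun i' _ =>
    integrable_finsetSum _ fun t _ => integrable_finsetSum _ fun t' _ => hind i i' t t']
  refine Finset.sum_congr rfl fun i' _ => ?_
  rw [integral_finsetSum _ fun t _ => integrable_finsetSum _ fun t' _ => hind i i' t t']
  refine Finset.sum_congr rfl fun t _ => ?_
  rw [integral_finsetSum _ fun t' _ => hind i i' t t']
  refine Finset.sum_congr rfl fun t' _ => ?_
  rw [integral_div, ← integral_indicator_one (hset i i' t t')]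
  rfl

lemma LargeBlocks.covSum_eq (h : LargeBlocks r n hs ht) (h' : LargeBlocks r n hs' ht')
    (hX : ∀ s t, Measurable (X s t)) (hA : MeasurableSet A) (hB : MeasurableSet B) :
    covSum P X A B u r (hs, ht) (hs', ht') n =
      (∫ ω, onBlock X u r (extremalFunctional A B hs ht) n (1, 1, 1) ω *
        onBlock X u r (extremalFunctional A B hs' ht') n (1, 1, 1) ω ∂P) /
        volProb P X A u r n := by
  rw [h.integral_onBlock_mul h' hX hA hB hB]
  simp only [covSum, Finset.sum_div, div_div]
  refine Finset.sum_congr rfl fun i _ => Finset.sum_congr rfl fun i' _ =>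
    Finset.sum_congr rfl fun t _ => Finset.sum_congr rfl fun t' _ => ?_
  congr 1
  ring

lemma LargeBlocks.crossCovSum_eq (h : LargeBlocks r n hs ht)
    (hX : ∀ s t, Measurable (X s t)) (hA : MeasurableSet A) (hC : MeasurableSet C) :
    crossCovSum P X A C u r (hs, ht) n =
      (∫ ω, onBlock X u r (extremalFunctional A C hs ht) n (1, 1, 1) ω *
        onBlock X u r (extremalFunctional A A 0 0) n (1, 1, 1) ω ∂P) /
        volProb P X A u r n := by
  rw [h.integral_onBlock_mul h.zero hX hA hC hA]
  have hs0 := h.sphere_zero_eq h.one_mem_spatial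
  rw [blockCenter_one] at hs0
  simp only [crossCovSum, Finset.sum_div, div_div, hs0, Finset.sum_singleton,
    Finset.card_singleton, Nat.cast_one, mul_one, Nat.sub_zero, add_zero]
  refine Finset.sum_congr rfl fun i _ => Finset.sum_congr rfl fun t _ =>
    Finset.sum_congr rfl fun t' _ => ?_
  congr 1
  -- For `f_{A,A,0,0}` the fourth event is the second one again: the sphere is the centre and the
  -- lag is zero.
  · congr 1
    ext ω
    simp only [Set.mem_ofPred_eq]
    tauto
  · ring

/-- The number of exceedances at the block centres during the incomplete time block. -/
noncomputable def incompleteCount {Ω : Type*} {d : ℕ} (X : RandomField Ω d)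
    (A : Set (Fin d → ℝ)) (u : ℕ → ℝ) (r : Fin 3 → ℕ → ℕ) (n : Fin 3 → ℕ) (ω : Ω) : ℝ :=
  ∑ j ∈ spatialIndices r n, ∑ t ∈ Finset.Icc (numBlocks r n 2 * blockDim r n 2 + 1) (n 2),
    A.indicator (fun _ => (1 : ℝ)) (normalizedObs X u n
      ((blockCenter (blockDim r n 0) (blockDim r n 1) j).1,
        (blockCenter (blockDim r n 0) (blockDim r n 1) j).2, t) ω)

lemma memLp_incompleteCount (hX : ∀ s t, Measurable (X s t)) (hA : MeasurableSet A) :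
    MemLp (incompleteCount X A u r n) 2 P := by
  refine memLp_finsetSum _ fun j _ => memLp_finsetSum _ fun t _ => ?_
  refine MemLp.of_bound ((measurable_const.indicator hA).comp
    (measurable_normalizedObs hX _)).aestronglyMeasurable 1 (ae_of_all _ fun ω => ?_)
  rw [Real.norm_eq_abs,
    abs_of_nonneg (Set.indicator_nonneg (fun _ _ => zero_le_one) _)]
  exact Set.indicator_le_self' (fun _ _ => zero_le_one) _

/-- Identifies the sum in (C) as a second moment, so that (C) bounds the count of the incomplete
block in mean square. -/
lemma integral_incompleteCount_sq (hX : ∀ s t, Measurable (X s t)) (hA : MeasurableSet A) :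
    ∫ ω, incompleteCount X A u r n ω ^ 2 ∂P = incompleteSum P X A u r n := by
  simp only [incompleteCount, incompleteSum, sq, Finset.sum_mul_sum]
  have hmul : ∀ (z z' : ℕ × ℕ × ℕ), (fun ω =>
      A.indicator (fun _ => (1 : ℝ)) (normalizedObs X u n z ω) *
        A.indicator (fun _ => (1 : ℝ)) (normalizedObs X u n z' ω)) =
      {ω | normalizedObs X u n z ω ∈ A ∧ normalizedObs X u n z' ω ∈ A}.indicator 1 := by
    intro z z'
    ext ω
    by_cases h1 : normalizedObs X u n z ω ∈ A <;> by_cases h2 : normalizedObs X u n z' ω ∈ A <;>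
      simp [Set.indicator, h1, h2]
  have hset : ∀ (z z' : ℕ × ℕ × ℕ), MeasurableSet
      {ω | normalizedObs X u n z ω ∈ A ∧ normalizedObs X u n z' ω ∈ A} := fun z z' =>
    (measurable_normalizedObs hX z hA).inter (measurable_normalizedObs hX z' hA)
  have hint : ∀ (z z' : ℕ × ℕ × ℕ), Integrable (fun ω =>
      A.indicator (fun _ => (1 : ℝ)) (normalizedObs X u n z ω) *
        A.indicator (fun _ => (1 : ℝ)) (normalizedObs X u n z' ω)) P := fun z z' => by
    rw [hmul]
    exact (integrable_const (1 : ℝ)).indicator (hset z z')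
  rw [integral_finsetSum _ fun _ _ => integrable_finsetSum _ fun _ _ =>
    integrable_finsetSum _ fun _ _ => integrable_finsetSum _ fun _ _ => hint _ _]
  refine Finset.sum_congr rfl fun j _ => ?_
  rw [integral_finsetSum _ fun _ _ =>
    integrable_finsetSum _ fun _ _ => integrable_finsetSum _ fun _ _ => hint _ _]
  refine Finset.sum_congr rfl fun j' _ => ?_
  rw [integral_finsetSum _ fun _ _ => integrable_finsetSum _ fun _ _ => hint _ _]
  refine Finset.sum_congr rfl fun t _ => ?_
  rw [integral_finsetSum _ fun _ _ => hint _ _]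
  refine Finset.sum_congr rfl fun t' _ => ?_
  rw [hmul, integral_indicator_one (hset _ _)]

end Moments

/-! ### Asymptotics of the blocks -/

/-- The number of complete blocks. -/
noncomputable def blockCount (r : Fin 3 → ℕ → ℕ) (n : Fin 3 → ℕ) : ℕ := (blockIndices r n).card

lemma blockCount_eq (r : Fin 3 → ℕ → ℕ) (n : Fin 3 → ℕ) :
    blockCount r n = numBlocks r n 0 * numBlocks r n 1 * numBlocks r n 2 := by
  simp [blockCount, blockIndices, mul_assoc]

section Blocks

variable {r : Fin 3 → ℕ → ℕ} {𝓁 : Filter (Fin 3 → ℕ)}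

lemma eventually_largeBlocks (hr : ∀ i, Tendsto (fun n : Fin 3 → ℕ => r i (n i)) 𝓁 atTop)
    (hrn : ∀ i, (fun n : Fin 3 → ℕ => (r i (n i) : ℝ)) =o[𝓁] (fun n => (n i : ℝ))) (hs ht : ℕ) :
    ∀ᶠ n in 𝓁, LargeBlocks r n hs ht := by
  have hle : ∀ i, ∀ᶠ n : Fin 3 → ℕ in 𝓁, r i (n i) ≤ n i := fun i => by
    filter_upwards [(hrn i).bound one_pos] with n hn
    simpa using hn
  filter_upwards [(hr 0).eventually_ge_atTop (2 * hs + 2), (hr 1).eventually_ge_atTop (2 * hs + 2),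
    (hr 2).eventually_ge_atTop (ht + 1), eventually_all.2 hle] with n h0 h1 h2 h3
  exact ⟨h0, h1, le_trans (by omega) h2, le_trans (by omega) h2, h3⟩

/-- The complete blocks miss fewer than r_i points in direction i, and r_i = o(n_i). -/
lemma tendsto_numBlocks_mul_div (hr : ∀ i, Tendsto (fun n : Fin 3 → ℕ => r i (n i)) 𝓁 atTop)
    (hrn : ∀ i, (fun n : Fin 3 → ℕ => (r i (n i) : ℝ)) =o[𝓁] (fun n => (n i : ℝ))) (i : Fin 3) :
    Tendsto (fun n => (numBlocks r n i : ℝ) * (blockDim r n i : ℝ) / (n i : ℝ)) 𝓁 (𝓝 1) := by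
  have h1 : Tendsto (fun n : Fin 3 → ℕ => 1 - (r i (n i) : ℝ) / (n i : ℝ)) 𝓁 (𝓝 1) := by
    simpa using (tendsto_const_nhds (x := (1 : ℝ))).sub (hrn i).tendsto_div_nhds_zero
  have hpos : ∀ᶠ n : Fin 3 → ℕ in 𝓁, 0 < n i := by
    filter_upwards [(hr i).eventually_ge_atTop 1, (hrn i).bound one_pos] with n h1 h2
    have : r i (n i) ≤ n i := by simpa using h2
    omega
  refine tendsto_of_tendsto_of_tendsto_of_le_of_le' h1 tendsto_const_nhds ?_ ?_
  · filter_upwards [hpos, (hr i).eventually_ge_atTop 1] with n hn hr1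
    have hn' : (0 : ℝ) < n i := by exact_mod_cast hn
    rw [one_sub_div hn'.ne']
    refine div_le_div_of_nonneg_right ?_ hn'.le
    have h2 := Nat.div_add_mod (n i) (blockDim r n i)
    have h3 := Nat.mod_lt (n i) (show 0 < blockDim r n i from hr1)
    have h4 : n i ≤ numBlocks r n i * blockDim r n i + r i (n i) := by
      rw [numBlocks, mul_comm]
      change _ ≤ _ + blockDim r n i
      omega
    have h5 : (n i : ℝ) ≤ numBlocks r n i * blockDim r n i + r i (n i) := by exact_mod_cast h4
    linarith
  · filter_upwards [hpos] with n hn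
    have hn' : (0 : ℝ) < n i := by exact_mod_cast hn
    rw [div_le_one hn']
    exact_mod_cast Nat.div_mul_le_self (n i) (blockDim r n i)

lemma tendsto_numBlocks (hr : ∀ i, Tendsto (fun n : Fin 3 → ℕ => r i (n i)) 𝓁 atTop)
    (hrn : ∀ i, (fun n : Fin 3 → ℕ => (r i (n i) : ℝ)) =o[𝓁] (fun n => (n i : ℝ))) (i : Fin 3) :
    Tendsto (fun n => numBlocks r n i) 𝓁 atTop := by
  refine tendsto_atTop.2 fun K => ?_
  have hK : (0 : ℝ) < 1 / (K + 1) := by positivity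
  filter_upwards [(hr i).eventually_ge_atTop 1, (hrn i).bound hK] with n h1 h2
  simp only [Real.norm_natCast] at h2
  refine (Nat.le_div_iff_mul_le (show 0 < blockDim r n i from h1)).2 ?_
  rw [div_mul_eq_mul_div, one_mul, le_div_iff₀ (by positivity)] at h2
  have h3 : r i (n i) * (K + 1) ≤ n i := by exact_mod_cast h2
  change K * r i (n i) ≤ n i
  nlinarith

lemma tendsto_blockCount (hr : ∀ i, Tendsto (fun n : Fin 3 → ℕ => r i (n i)) 𝓁 atTop)
    (hrn : ∀ i, (fun n : Fin 3 → ℕ => (r i (n i) : ℝ)) =o[𝓁] (fun n => (n i : ℝ))) :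
    Tendsto (fun n => blockCount r n) 𝓁 atTop := by
  simp only [blockCount_eq]
  exact ((tendsto_numBlocks hr hrn 0).atTop_mul_atTop₀ (tendsto_numBlocks hr hrn 1)).atTop_mul_atTop₀
    (tendsto_numBlocks hr hrn 2)

lemma tendsto_blockCount_mul_div (hr : ∀ i, Tendsto (fun n : Fin 3 → ℕ => r i (n i)) 𝓁 atTop)
    (hrn : ∀ i, (fun n : Fin 3 → ℕ => (r i (n i) : ℝ)) =o[𝓁] (fun n => (n i : ℝ))) :
    Tendsto (fun n => (blockCount r n : ℝ) * (blockVol r n : ℝ) / (sampleSize n : ℝ)) 𝓁 (𝓝 1) := by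
  have h := ((tendsto_numBlocks_mul_div hr hrn 0).mul (tendsto_numBlocks_mul_div hr hrn 1)).mul
    (tendsto_numBlocks_mul_div hr hrn 2)
  rw [one_mul, one_mul] at h
  refine h.congr fun n => ?_
  rw [blockCount_eq, blockVol, sampleSize]
  push_cast
  rw [div_mul_div_comm, div_mul_div_comm]
  congr 1
  ring

end Blocks

/-! ### The normalised sums over blocks -/

/-- The second set of the functional with index `a`: `none` stands for `f_{A, A, 0, 0}` and `some h`
for `f_{A, B, h}`. -/
def tailSet {d : ℕ} (A B : Set (Fin d → ℝ)) (a : Option (ℕ × ℕ)) : Set (Fin d → ℝ) :=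
  a.elim A (fun _ => B)

/-- The lag of the functional with index `a`. -/
def lagOf (a : Option (ℕ × ℕ)) : ℕ × ℕ := a.getD (0, 0)

/-- The members of the family of extremal functionals. -/
noncomputable def lagFunctional {d : ℕ} (A B : Set (Fin d → ℝ)) (a : Option (ℕ × ℕ)) :
    BlockFunctional d :=
  extremalFunctional A (tailSet A B a) (lagOf a).1 (lagOf a).2

lemma lagFunctional_mem {d : ℕ} (A B : Set (Fin d → ℝ)) (a : Option (ℕ × ℕ)) :
    lagFunctional A B a ∈ extremalFamily A B := by
  cases a with
  | none => exact Or.inr rfl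
  | some h => exact Or.inl ⟨h.1, h.2, rfl⟩

/-- The limits of the normalised second moments. -/
def limitMoment (σ : ℕ × ℕ → ℕ × ℕ → ℝ) (σ' : ℕ × ℕ → ℝ) (σ₀ : ℝ) :
    Option (ℕ × ℕ) → Option (ℕ × ℕ) → ℝ
  | none, none => σ₀
  | none, some h => σ' h
  | some h, none => σ' h
  | some h, some h' => σ h h'

/-- The normalised sum over the complete blocks of the centred functional with index `a`. -/
noncomputable def blockSum {Ω : Type*} [MeasurableSpace Ω] {d : ℕ} (P : Measure Ω)
    (X : RandomField Ω d) (A B : Set (Fin d → ℝ)) (u : ℕ → ℝ) (r : Fin 3 → ℕ → ℕ)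
    (a : Option (ℕ × ℕ)) (n : Fin 3 → ℕ) (ω : Ω) : ℝ :=
  (√(sizeProb P X A u n))⁻¹ * ∑ j ∈ blockIndices r n, centered P X u r (lagFunctional A B a) n j ω

/-- The assumptions on the process, the thresholds and the block lengths which are used in the
proof of the central limit theorem. -/
structure BlockAsymptotics {Ω : Type*} [MeasurableSpace Ω] {d : ℕ} (P : Measure Ω)
    (X : RandomField Ω d) (A B : Set (Fin d → ℝ)) (u : ℕ → ℝ) (r : Fin 3 → ℕ → ℕ)
    (𝓁 : Filter (Fin 3 → ℕ)) : Prop where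
  meas : ∀ s t, Measurable (X s t)
  measA : MeasurableSet A
  measB : MeasurableSet B
  awayA : BoundedAwayFromZero A
  awayB : BoundedAwayFromZero B
  stationary : Stationary P X
  isotropic : Isotropic P X
  threshold_pos : ∀ᶠ n in 𝓁, 0 < u (sampleSize n)
  prob_pos : ∀ᶠ n in 𝓁, 0 < exceedProb P X A u (sampleSize n)
  dim : ∀ i, Tendsto (fun n : Fin 3 → ℕ => r i (n i)) 𝓁 atTop
  dim_small : ∀ i, (fun n : Fin 3 → ℕ => (r i (n i) : ℝ)) =o[𝓁] (fun n => (n i : ℝ))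
  volProb_tendsto : Tendsto (volProb P X A u r) 𝓁 (𝓝 0)
  sizeProb_tendsto : Tendsto (sizeProb P X A u) 𝓁 atTop
  sqrt_div_tendsto : Tendsto (fun n => √(sizeProb P X A u n) / (blockVol r n : ℝ)) 𝓁 (𝓝 0)

/-- The summand of largest modulus is at least the average, so it passes the threshold ε / card and
card² times its square dominates. This carries (Lin) from single functionals to linear combinations.
-/
lemma sum_sq_indicator_le {κ : Type*} [Fintype κ] (x : κ → ℝ) {ε : ℝ} (hε : 0 < ε) :
    {y : ℝ | ε < |y|}.indicator (fun y => y ^ 2) (∑ i, x i) ≤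
      (Fintype.card κ : ℝ) ^ 2 * ∑ i, {y : ℝ | ε / Fintype.card κ < |y|}.indicator
        (fun y => y ^ 2) (x i) := by
  have hnn : ∀ (δ : ℝ) (y : ℝ), 0 ≤ {y : ℝ | δ < |y|}.indicator (fun y => y ^ 2) y := fun δ y =>
    Set.indicator_nonneg (fun _ _ => sq_nonneg _) _
  by_cases h : ε < |∑ i, x i|
  · rw [Set.indicator_of_mem (by exact h)]
    have hne : Nonempty κ := by
      by_contra hne
      rw [not_nonempty_iff] at hne
      simp at h
      linarith
    obtain ⟨i, -, hi⟩ := Finset.exists_max_image Finset.univ (fun i => |x i|)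
      Finset.univ_nonempty
    have hc : (0 : ℝ) < Fintype.card κ := by exact_mod_cast Fintype.card_pos
    have h1 : |∑ i, x i| ≤ Fintype.card κ * |x i| := by
      refine (Finset.abs_sum_le_sum_abs _ _).trans ?_
      refine (Finset.sum_le_card_nsmul _ _ |x i| fun j hj => hi j hj).trans ?_
      rw [nsmul_eq_mul, Finset.card_univ]
    have h2 : ε / Fintype.card κ < |x i| := by
      rw [div_lt_iff₀ hc]; linarith
    have h3 : (∑ i, x i) ^ 2 ≤ (Fintype.card κ : ℝ) ^ 2 * x i ^ 2 := by
      rw [← sq_abs, ← sq_abs (x i), ← mul_pow]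
      exact pow_le_pow_left₀ (abs_nonneg _) h1 2
    refine h3.trans (mul_le_mul_of_nonneg_left ?_ (sq_nonneg _))
    refine le_trans ?_ (Finset.single_le_sum (fun j _ => hnn _ (x j)) (Finset.mem_univ i))
    rw [Set.indicator_of_mem (by exact h2)]
  · rw [Set.indicator_of_notMem (by exact h)]
    exact mul_nonneg (sq_nonneg _) (Finset.sum_nonneg fun i _ => hnn _ _)

section CLT

variable {Ω : Type*} [MeasurableSpace Ω] {P : Measure Ω} [IsProbabilityMeasure P] {d : ℕ}
  {X : RandomField Ω d} {A B : Set (Fin d → ℝ)} {u : ℕ → ℝ} {r : Fin 3 → ℕ → ℕ}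
  {𝓁 : Filter (Fin 3 → ℕ)} {σ : ℕ × ℕ → ℕ × ℕ → ℝ} {σ' : ℕ × ℕ → ℝ} {σ₀ : ℝ}

namespace BlockAsymptotics

variable (H : BlockAsymptotics P X A B u r 𝓁)
include H

lemma large (hs ht : ℕ) : ∀ᶠ n in 𝓁, LargeBlocks r n hs ht :=
  eventually_largeBlocks H.dim H.dim_small hs ht

lemma measurableSet_tailSet (a : Option (ℕ × ℕ)) : MeasurableSet (tailSet A B a) := by
  cases a with
  | none => exact H.measA
  | some h => exact H.measB

lemma measurable_onBlock (a : Option (ℕ × ℕ)) (n : Fin 3 → ℕ) (j : ℕ × ℕ × ℕ) :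
    Measurable (onBlock X u r (lagFunctional A B a) n j) :=
  SpaceTime.measurable_onBlock H.meas H.measA (H.measurableSet_tailSet a) j

lemma memLp_onBlock (a : Option (ℕ × ℕ)) (n : Fin 3 → ℕ) (j : ℕ × ℕ × ℕ) :
    MemLp (onBlock X u r (lagFunctional A B a) n j) 2 P :=
  SpaceTime.memLp_onBlock H.meas H.measA (H.measurableSet_tailSet a) j

lemma integrable_onBlock (a : Option (ℕ × ℕ)) (n : Fin 3 → ℕ) (j : ℕ × ℕ × ℕ) :
    Integrable (onBlock X u r (lagFunctional A B a) n j) P :=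
  (H.memLp_onBlock a n j).integrable (by norm_num)

lemma measurable_centered (a : Option (ℕ × ℕ)) (n : Fin 3 → ℕ) (j : ℕ × ℕ × ℕ) :
    Measurable (centered P X u r (lagFunctional A B a) n j) :=
  (H.measurable_onBlock a n j).sub_const _

lemma memLp_centered (a : Option (ℕ × ℕ)) (n : Fin 3 → ℕ) (j : ℕ × ℕ × ℕ) :
    MemLp (centered P X u r (lagFunctional A B a) n j) 2 P :=
  (H.memLp_onBlock a n j).sub (memLp_const _)

lemma integral_centered (a : Option (ℕ × ℕ)) (n : Fin 3 → ℕ) (j : ℕ × ℕ × ℕ) :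
    ∫ ω, centered P X u r (lagFunctional A B a) n j ω ∂P = 0 := by
  simp only [centered]
  rw [integral_sub (H.integrable_onBlock a n j) (integrable_const _)]
  simp

lemma measurable_blockSum (a : Option (ℕ × ℕ)) (n : Fin 3 → ℕ) :
    Measurable (blockSum P X A B u r a n) :=
  (Finset.measurable_fun_sum _ fun j _ => H.measurable_centered a n j).const_mul _

lemma eventually_onBlock_le (a : Option (ℕ × ℕ)) : ∀ᶠ n in 𝓁, ∀ j ∈ blockIndices r n, ∀ ω,
    0 ≤ onBlock X u r (lagFunctional A B a) n j ω ∧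
      onBlock X u r (lagFunctional A B a) n j ω ≤ onBlock X u r (lagFunctional A B none) n j ω := by
  filter_upwards [H.large (lagOf a).1 (lagOf a).2] with n hn j hj ω
  exact ⟨onBlock_nonneg _ _, hn.onBlock_le hj ω⟩

lemma eventually_integral_onBlock_none : ∀ᶠ n in 𝓁, ∀ j ∈ blockIndices r n,
    ∫ ω, onBlock X u r (lagFunctional A B none) n j ω ∂P =
      (blockDim r n 2 : ℝ) * exceedProb P X A u (sampleSize n) := by
  filter_upwards [H.large 0 0, H.threshold_pos, H.prob_pos] with n hn hu hv j hj
  exact hn.integral_onBlock_self H.meas H.stationary H.isotropic H.measA H.awayA hu hv.ne' hj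

lemma eventually_integral_onBlock_some (h : ℕ × ℕ) : ∀ᶠ n in 𝓁, ∀ j ∈ blockIndices r n,
    ∫ ω, onBlock X u r (lagFunctional A B (some h)) n j ω ∂P =
      ((blockDim r n 2 : ℝ) - h.2) * (exceedProb P X A u (sampleSize n) *
        preIsoExtremogram P X A B u h.1 h.2 (sampleSize n)) := by
  filter_upwards [H.large h.1 h.2, H.threshold_pos, H.prob_pos] with n hn hu hv j hj
  exact hn.integral_onBlock H.meas H.stationary H.isotropic H.measA H.measB H.awayA H.awayB hu
    hv.ne' hj

lemma eventually_integral_onBlock_le (a : Option (ℕ × ℕ)) : ∀ᶠ n in 𝓁,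
    0 ≤ ∫ ω, onBlock X u r (lagFunctional A B a) n (1, 1, 1) ω ∂P ∧
    ∫ ω, onBlock X u r (lagFunctional A B a) n (1, 1, 1) ω ∂P ≤
      (blockDim r n 2 : ℝ) * exceedProb P X A u (sampleSize n) := by
  filter_upwards [H.large 0 0, H.eventually_integral_onBlock_none, H.eventually_onBlock_le a]
    with n h0 h1 h2
  rw [← h1 _ h0.one_mem]
  exact ⟨integral_nonneg fun ω => (h2 _ h0.one_mem ω).1,
    integral_mono (H.integrable_onBlock a n _) (H.integrable_onBlock none n _)
      fun ω => (h2 _ h0.one_mem ω).2⟩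

lemma eventually_blockDim_two_le_vol : ∀ᶠ n in 𝓁, (blockDim r n 2 : ℝ) ≤ blockVol r n := by
  filter_upwards [H.large 0 0] with n hn
  have h0 := hn.side0
  have h1 := hn.side1
  have : 1 ≤ blockDim r n 0 * blockDim r n 1 := Nat.one_le_iff_ne_zero.2 (by positivity)
  rw [blockVol]
  exact_mod_cast Nat.le_mul_of_pos_left _ this

lemma tendsto_moment (hσ : ∀ h h', Tendsto (covSum P X A B u r h h') 𝓁 (𝓝 (σ h h')))
    (hσ' : ∀ h, Tendsto (crossCovSum P X A B u r h) 𝓁 (𝓝 (σ' h)))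
    (hσ₀ : Tendsto (crossCovSum P X A A u r (0, 0)) 𝓁 (𝓝 σ₀)) (a b : Option (ℕ × ℕ)) :
    Tendsto (fun n => (∫ ω, onBlock X u r (lagFunctional A B a) n (1, 1, 1) ω *
        onBlock X u r (lagFunctional A B b) n (1, 1, 1) ω ∂P) / volProb P X A u r n) 𝓁
      (𝓝 (limitMoment σ σ' σ₀ a b)) := by
  rcases a with _ | h <;> rcases b with _ | h'
  · refine hσ₀.congr' ?_
    filter_upwards [H.large 0 0] with n hn
    exact hn.crossCovSum_eq H.meas H.measA H.measA
  · refine (hσ' h').congr' ?_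
    filter_upwards [H.large h'.1 h'.2] with n hn
    simp_rw [mul_comm (onBlock X u r (lagFunctional A B none) n (1, 1, 1) _)]
    exact hn.crossCovSum_eq H.meas H.measA H.measB
  · refine (hσ' h).congr' ?_
    filter_upwards [H.large h.1 h.2] with n hn
    exact hn.crossCovSum_eq H.meas H.measA H.measB
  · refine (hσ h h').congr' ?_
    filter_upwards [H.large h.1 h.2, H.large h'.1 h'.2] with n hn hn'
    exact hn.covSum_eq hn' H.meas H.measA H.measB

/-- Centring is harmless: each mean is at most r₃ v_n ≤ r v_n, so the product of two means divided
by r v_n is at most r v_n, which tends to zero. -/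
lemma tendsto_cov (hσ : ∀ h h', Tendsto (covSum P X A B u r h h') 𝓁 (𝓝 (σ h h')))
    (hσ' : ∀ h, Tendsto (crossCovSum P X A B u r h) 𝓁 (𝓝 (σ' h)))
    (hσ₀ : Tendsto (crossCovSum P X A A u r (0, 0)) 𝓁 (𝓝 σ₀)) (a b : Option (ℕ × ℕ)) :
    Tendsto (fun n => (∫ ω, centered P X u r (lagFunctional A B a) n (1, 1, 1) ω *
        centered P X u r (lagFunctional A B b) n (1, 1, 1) ω ∂P) / volProb P X A u r n) 𝓁
      (𝓝 (limitMoment σ σ' σ₀ a b)) := by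
  have h1 : ∀ n, ∫ ω, centered P X u r (lagFunctional A B a) n (1, 1, 1) ω *
        centered P X u r (lagFunctional A B b) n (1, 1, 1) ω ∂P =
      ∫ ω, onBlock X u r (lagFunctional A B a) n (1, 1, 1) ω *
        onBlock X u r (lagFunctional A B b) n (1, 1, 1) ω ∂P -
      (∫ ω, onBlock X u r (lagFunctional A B a) n (1, 1, 1) ω ∂P) *
        ∫ ω, onBlock X u r (lagFunctional A B b) n (1, 1, 1) ω ∂P := fun n =>
    covariance_eq_sub (H.memLp_onBlock a n _) (H.memLp_onBlock b n _)
  have h2 : Tendsto (fun n => (∫ ω, onBlock X u r (lagFunctional A B a) n (1, 1, 1) ω ∂P) *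
        (∫ ω, onBlock X u r (lagFunctional A B b) n (1, 1, 1) ω ∂P) / volProb P X A u r n) 𝓁
      (𝓝 0) := by
    refine tendsto_of_tendsto_of_tendsto_of_le_of_le' tendsto_const_nhds H.volProb_tendsto ?_ ?_
    · filter_upwards [H.eventually_integral_onBlock_le a, H.eventually_integral_onBlock_le b,
        H.prob_pos] with n ha hb hv
      exact div_nonneg (mul_nonneg ha.1 hb.1) (mul_nonneg (Nat.cast_nonneg _) hv.le)
    · filter_upwards [H.eventually_integral_onBlock_le a, H.eventually_integral_onBlock_le b,
        H.prob_pos, H.eventually_blockDim_two_le_vol] with n ha hb hv hr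
      refine div_le_of_le_mul₀ (mul_nonneg (Nat.cast_nonneg _) hv.le)
        (mul_nonneg (Nat.cast_nonneg _) hv.le) ?_
      have hrv : (blockDim r n 2 : ℝ) * exceedProb P X A u (sampleSize n) ≤ volProb P X A u r n :=
        mul_le_mul_of_nonneg_right hr hv.le
      exact mul_le_mul (ha.2.trans hrv) (hb.2.trans hrv) hb.1
        (mul_nonneg (Nat.cast_nonneg _) hv.le)
  have h3 := (H.tendsto_moment hσ hσ' hσ₀ a b).sub h2
  rw [sub_zero] at h3
  refine h3.congr fun n => ?_
  rw [h1, sub_div]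

/-- Exchanges the normalisation by n v_n of the sum over all blocks for the normalisation by r v_n
of one block, at the cost of a factor tending to 1. -/
lemma eventually_blockCount_mul : ∀ᶠ n in 𝓁, (blockCount r n : ℝ) * (sizeProb P X A u n)⁻¹ =
    ((blockCount r n : ℝ) * (blockVol r n : ℝ) / (sampleSize n : ℝ)) *
      (volProb P X A u r n)⁻¹ := by
  filter_upwards [H.large 0 0, H.prob_pos] with n hn hv
  have h0 : (blockVol r n : ℝ) ≠ 0 := by
    have h0 := hn.side0
    have h1 := hn.side1
    have h2 := hn.one_le
    rw [blockVol]
    positivity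
  rw [sizeProb, volProb]
  by_cases hs : (sampleSize n : ℝ) = 0
  · simp [hs]
  · field_simp

lemma pairing_eq {q : ℕ} (g : Fin q → Option (ℕ × ℕ)) (t : Fin q → ℝ) (n : Fin 3 → ℕ)
    (j : ℕ × ℕ × ℕ) : Measurable (pairing P X A u r (fun i => lagFunctional A B (g i)) t n j) ∧
      MemLp (pairing P X A u r (fun i => lagFunctional A B (g i)) t n j) 2 P ∧
      ∫ ω, pairing P X A u r (fun i => lagFunctional A B (g i)) t n j ω ∂P = 0 := by
  refine ⟨?_, ?_, ?_⟩
  · exact Finset.measurable_fun_sum _ fun i _ =>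
      ((H.measurable_centered (g i) n j).const_mul _).const_mul _
  · exact memLp_finsetSum _ fun i _ => ((H.memLp_centered (g i) n j).const_mul _).const_mul _
  · simp only [pairing]
    rw [integral_finsetSum _ fun i _ => (((H.memLp_centered (g i) n j).integrable
      (by norm_num)).const_mul _).const_mul _]
    refine Finset.sum_eq_zero fun i _ => ?_
    rw [integral_const_mul, integral_const_mul, H.integral_centered, mul_zero, mul_zero]

lemma tendsto_pairing_variance
    (hσ : ∀ h h', Tendsto (covSum P X A B u r h h') 𝓁 (𝓝 (σ h h')))
    (hσ' : ∀ h, Tendsto (crossCovSum P X A B u r h) 𝓁 (𝓝 (σ' h)))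
    (hσ₀ : Tendsto (crossCovSum P X A A u r (0, 0)) 𝓁 (𝓝 σ₀)) {q : ℕ}
    (g : Fin q → Option (ℕ × ℕ)) (t : Fin q → ℝ) :
    Tendsto (fun n => (blockCount r n : ℝ) *
      ∫ ω, pairing P X A u r (fun i => lagFunctional A B (g i)) t n (1, 1, 1) ω ^ 2 ∂P) 𝓁
      (𝓝 (∑ i, ∑ j, t i * t j * limitMoment σ σ' σ₀ (g i) (g j))) := by
  have h1 := (tendsto_blockCount_mul_div H.dim H.dim_small).mul
    (tendsto_finsetSum Finset.univ fun i _ => tendsto_finsetSum Finset.univ fun j _ =>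
      (H.tendsto_cov hσ hσ' hσ₀ (g i) (g j)).const_mul (t i * t j))
  rw [one_mul] at h1
  refine h1.congr' ?_
  filter_upwards [H.eventually_blockCount_mul, H.prob_pos] with n hn hv
  have hS : 0 ≤ sizeProb P X A u n := mul_nonneg (Nat.cast_nonneg _) hv.le
  have h2 : ∫ ω, pairing P X A u r (fun i => lagFunctional A B (g i)) t n (1, 1, 1) ω ^ 2 ∂P =
      (sizeProb P X A u n)⁻¹ * ∑ i, ∑ j, t i * t j *
        ∫ ω, centered P X u r (lagFunctional A B (g i)) n (1, 1, 1) ω *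
          centered P X u r (lagFunctional A B (g j)) n (1, 1, 1) ω ∂P := by
    have hint : ∀ i j, Integrable (fun ω => t i * t j *
        (centered P X u r (lagFunctional A B (g i)) n (1, 1, 1) ω *
          centered P X u r (lagFunctional A B (g j)) n (1, 1, 1) ω)) P := fun i j =>
      ((H.memLp_centered (g i) n _).integrable_mul (H.memLp_centered (g j) n _)).const_mul _
    simp only [← integral_const_mul]
    simp only [← integral_finsetSum _ fun j _ => hint _ j]
    rw [← integral_finsetSum _ fun i _ => integrable_finsetSum _ fun j _ => hint i j,
      ← integral_const_mul]
    refine integral_congr_ae (ae_of_all _ fun ω => ?_)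
    simp only [pairing, sq]
    rw [Finset.sum_mul_sum]
    simp only [Finset.mul_sum]
    refine Finset.sum_congr rfl fun i _ => Finset.sum_congr rfl fun j _ => ?_
    have h3 : (sizeProb P X A u n)⁻¹ =
        (√(sizeProb P X A u n))⁻¹ * (√(sizeProb P X A u n))⁻¹ := by
      rw [← mul_inv, Real.mul_self_sqrt hS]
    rw [h3]
    ring
  rw [h2, ← mul_assoc, hn, mul_assoc]
  congr 1
  rw [Finset.mul_sum]
  refine Finset.sum_congr rfl fun i _ => ?_
  rw [Finset.mul_sum]
  refine Finset.sum_congr rfl fun j _ => ?_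
  ring

lemma tendsto_pairing_lindeberg (hLin : Lindeberg P X A u r 𝓁 (extremalFamily A B)) {q : ℕ}
    (g : Fin q → Option (ℕ × ℕ)) (t : Fin q → ℝ) {ε : ℝ} (hε : 0 < ε) :
    Tendsto (fun n => (blockCount r n : ℝ) * ∫ ω, {ω' | ε <
        |pairing P X A u r (fun i => lagFunctional A B (g i)) t n (1, 1, 1) ω'|}.indicator
        (fun ω' => pairing P X A u r (fun i => lagFunctional A B (g i)) t n (1, 1, 1) ω' ^ 2) ω ∂P)
      𝓁 (𝓝 0) := by
  rcases Nat.eq_zero_or_pos q with rfl | hq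
  · simp only [pairing, Finset.univ_eq_empty, Finset.sum_empty, abs_zero, not_lt.2 hε.le]
    simpa using tendsto_const_nhds
  have hq' : (0 : ℝ) < q := by exact_mod_cast hq
  -- Chosen so that a term t_i c / √(n v_n) of modulus above ε/q forces |c| > δ_i √(n v_n); the
  -- added 1 allows t_i = 0.
  set δ : Fin q → ℝ := fun i => ε / q / (|t i| + 1) with hδ
  have hδ0 : ∀ i, 0 < δ i := fun i => by positivity
  have h1 := (tendsto_blockCount_mul_div H.dim H.dim_small).mul
    (tendsto_finsetSum Finset.univ fun i _ =>
      (hLin _ (lagFunctional_mem A B (g i)) (δ i) (hδ0 i)).const_mul ((q : ℝ) ^ 2 * t i ^ 2))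
  simp only [mul_zero, Finset.sum_const_zero] at h1
  refine tendsto_of_tendsto_of_tendsto_of_le_of_le' tendsto_const_nhds h1
    (Eventually.of_forall fun n => mul_nonneg (Nat.cast_nonneg _) (integral_nonneg fun ω =>
      Set.indicator_nonneg (fun _ _ => sq_nonneg _) _)) ?_
  filter_upwards [H.eventually_blockCount_mul, H.prob_pos, H.sizeProb_tendsto.eventually_gt_atTop 0]
    with n hn hv hS
  have hsq : 0 < √(sizeProb P X A u n) := Real.sqrt_pos.2 hS
  have hint : ∀ i, Integrable ({ω' | δ i * √(sizeProb P X A u n) <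
      |centered P X u r (lagFunctional A B (g i)) n (1, 1, 1) ω'|}.indicator
        (fun ω' => centered P X u r (lagFunctional A B (g i)) n (1, 1, 1) ω' ^ 2)) P := fun i =>
    (H.memLp_centered (g i) n _).integrable_sq.indicator
      (measurableSet_lt measurable_const (H.measurable_centered (g i) n _).abs)
  have hp := H.pairing_eq g t n (1, 1, 1)
  have key : ∫ ω, {ω' | ε <
        |pairing P X A u r (fun i => lagFunctional A B (g i)) t n (1, 1, 1) ω'|}.indicator
        (fun ω' => pairing P X A u r (fun i => lagFunctional A B (g i)) t n (1, 1, 1) ω' ^ 2) ω ∂P ≤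
      ∑ i, (q : ℝ) ^ 2 * t i ^ 2 * ((sizeProb P X A u n)⁻¹ *
        ∫ ω, {ω' | δ i * √(sizeProb P X A u n) <
          |centered P X u r (lagFunctional A B (g i)) n (1, 1, 1) ω'|}.indicator
        (fun ω' => centered P X u r (lagFunctional A B (g i)) n (1, 1, 1) ω' ^ 2) ω ∂P) := by
    simp only [← integral_const_mul]
    rw [← integral_finsetSum _ fun i _ => ((hint i).const_mul _).const_mul _]
    refine integral_mono (hp.2.1.integrable_sq.indicator
      (measurableSet_lt measurable_const hp.1.abs))
      (integrable_finsetSum _ fun i _ => ((hint i).const_mul _).const_mul _) fun ω => ?_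
    have h2 := sum_sq_indicator_le (fun i => t i * ((√(sizeProb P X A u n))⁻¹ *
      centered P X u r (lagFunctional A B (g i)) n (1, 1, 1) ω)) hε
    refine h2.trans ?_
    rw [Fintype.card_fin, Finset.mul_sum]
    refine Finset.sum_le_sum fun i _ => ?_
    rw [mul_assoc]
    refine mul_le_mul_of_nonneg_left ?_ (sq_nonneg _)
    set c := centered P X u r (lagFunctional A B (g i)) n (1, 1, 1) ω with hc
    by_cases hx : ε / q < |t i * ((√(sizeProb P X A u n))⁻¹ * c)|
    · rw [Set.indicator_of_mem (by exact hx)]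
      have hmem : δ i * √(sizeProb P X A u n) < |c| := by
        rw [abs_mul, abs_mul, abs_inv, abs_of_pos hsq, ← mul_assoc, mul_comm |t i|, mul_assoc,
          inv_mul_eq_div, lt_div_iff₀ hsq] at hx
        simp only [hδ]
        rw [div_mul_eq_mul_div, div_lt_iff₀ (by positivity)]
        have := abs_nonneg c
        nlinarith
      rw [Set.indicator_of_mem (by exact hmem), mul_pow, mul_pow, inv_pow, Real.sq_sqrt hS.le]
    · rw [Set.indicator_of_notMem (by exact hx)]
      exact mul_nonneg (sq_nonneg _) (mul_nonneg (inv_nonneg.2 hS.le)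
        (Set.indicator_nonneg (fun _ _ => sq_nonneg _) _))
  refine (mul_le_mul_of_nonneg_left key (Nat.cast_nonneg _)).trans (le_of_eq ?_)
  rw [Finset.mul_sum, Finset.mul_sum]
  refine Finset.sum_congr rfl fun i _ => ?_
  set I := ∫ ω, {ω' | δ i * √(sizeProb P X A u n) <
          |centered P X u r (lagFunctional A B (g i)) n (1, 1, 1) ω'|}.indicator
        (fun ω' => centered P X u r (lagFunctional A B (g i)) n (1, 1, 1) ω' ^ 2) ω ∂P
  calc (blockCount r n : ℝ) * ((q : ℝ) ^ 2 * t i ^ 2 * ((sizeProb P X A u n)⁻¹ * I)) =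
        ((blockCount r n : ℝ) * (sizeProb P X A u n)⁻¹) * ((q : ℝ) ^ 2 * t i ^ 2 * I) := by ring
    _ = _ := by rw [hn]; ring

/-- Each pairing is the same measurable function of its block, centring constants included, so
identically distributed blocks turn the product of characteristic functions into a power. -/
lemma integral_exp_pairing_eq {q : ℕ} (g : Fin q → Option (ℕ × ℕ)) (t : Fin q → ℝ)
    (n : Fin 3 → ℕ) (j : ℕ × ℕ × ℕ) :
    ∫ ω, Complex.exp (Complex.I *
        ((pairing P X A u r (fun i => lagFunctional A B (g i)) t n j ω : ℝ) : ℂ)) ∂P =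
      ∫ ω, Complex.exp (Complex.I *
        ((pairing P X A u r (fun i => lagFunctional A B (g i)) t n (1, 1, 1) ω : ℝ) : ℂ)) ∂P := by
  have hid := identDistrib_block (u := u) (r := r) (n := n) H.meas H.stationary j
  have hmean : ∀ a, ∫ ω, onBlock X u r (lagFunctional A B a) n j ω ∂P =
      ∫ ω, onBlock X u r (lagFunctional A B a) n (1, 1, 1) ω ∂P := fun a =>
    (hid.comp (measurable_extremalFunctional H.measA (H.measurableSet_tailSet a)
      (blockDim r n))).integral_eq
  have hφ : Measurable (fun y : ℕ × ℕ × ℕ → Fin d → ℝ => Complex.exp (Complex.I *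
      ((∑ i, t i * ((√(sizeProb P X A u n))⁻¹ * (lagFunctional A B (g i) (blockDim r n) y -
        ∫ ω, onBlock X u r (lagFunctional A B (g i)) n (1, 1, 1) ω ∂P)) : ℝ) : ℂ))) := by
    have : Measurable (fun y : ℕ × ℕ × ℕ → Fin d → ℝ =>
        ∑ i, t i * ((√(sizeProb P X A u n))⁻¹ * (lagFunctional A B (g i) (blockDim r n) y -
        ∫ ω, onBlock X u r (lagFunctional A B (g i)) n (1, 1, 1) ω ∂P))) :=
      Finset.measurable_fun_sum _ fun i _ => (((measurable_extremalFunctional H.measA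
        (H.measurableSet_tailSet (g i)) (blockDim r n)).sub_const _).const_mul _).const_mul _
    fun_prop
  have h := (hid.comp hφ).integral_eq
  simp only [pairing, centered, hmean]
  exact h

/-- The central limit theorem for the linear combinations of the normalised sums over blocks. -/
lemma tendsto_charFun_blockSum
    (hσ : ∀ h h', Tendsto (covSum P X A B u r h h') 𝓁 (𝓝 (σ h h')))
    (hσ' : ∀ h, Tendsto (crossCovSum P X A B u r h) 𝓁 (𝓝 (σ' h)))
    (hσ₀ : Tendsto (crossCovSum P X A A u r (0, 0)) 𝓁 (𝓝 σ₀))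
    (hLin : Lindeberg P X A u r 𝓁 (extremalFamily A B))
    (hT : ∀ (q : ℕ) (f : Fin q → BlockFunctional d),
      (∀ i, f i ∈ extremalFamily A B) → ∀ t : Fin q → ℝ,
        Tendsto (depCoeff P X A u r f t) 𝓁 (𝓝 0))
    {q : ℕ} (g : Fin q → Option (ℕ × ℕ)) (t : Fin q → ℝ) :
    Tendsto (fun n => ∫ ω, Complex.exp (Complex.I *
        ((∑ i, t i * blockSum P X A B u r (g i) n ω : ℝ) : ℂ)) ∂P) 𝓁
      (𝓝 (Complex.exp (-((∑ i, ∑ j, t i * t j * limitMoment σ σ' σ₀ (g i) (g j) : ℝ) : ℂ) / 2))) := by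
  set f : Fin q → BlockFunctional d := fun i => lagFunctional A B (g i) with hf
  have h1 := tendsto_charFun_pow P (l := 𝓁)
    (ξ := fun n => pairing P X A u r f t n (1, 1, 1)) (N := blockCount r)
    (Eventually.of_forall fun n => (H.pairing_eq g t n (1, 1, 1)).1)
    (Eventually.of_forall fun n => (H.pairing_eq g t n (1, 1, 1)).2.1)
    (Eventually.of_forall fun n => (H.pairing_eq g t n (1, 1, 1)).2.2)
    (tendsto_blockCount H.dim H.dim_small) (H.tendsto_pairing_variance hσ hσ' hσ₀ g t)
    (fun ε hε => H.tendsto_pairing_lindeberg hLin g t hε)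
  have h2 : Tendsto (fun n => (∫ ω, Complex.exp (Complex.I *
      ((∑ i, t i * blockSum P X A B u r (g i) n ω : ℝ) : ℂ)) ∂P) -
      (∫ ω, Complex.exp (Complex.I * ((pairing P X A u r f t n (1, 1, 1) ω : ℝ) : ℂ)) ∂P) ^
        blockCount r n) 𝓁 (𝓝 0) := by
    refine squeeze_zero_norm (fun n => ?_)
      (hT q f (fun i => lagFunctional_mem A B (g i)) t)
    -- The lexicographic order as a linear order, for which the later indices are those of
    -- `laterBlocks`.
    let e : ℕ × ℕ × ℕ → ℕ ×ₗ (ℕ ×ₗ ℕ) := fun j => toLex (j.1, toLex j.2)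
    have he : Function.Injective e := fun j j' h => by
      simp only [e, toLex_inj, Prod.mk.injEq] at h
      exact Prod.ext h.1 h.2
    have h3 := norm_integral_exp_sum_sub_prod_le e he P
      (fun j => pairing P X A u r f t n j) (blockIndices r n)
    have h4 : ∀ ω, ∑ j ∈ blockIndices r n, pairing P X A u r f t n j ω =
        ∑ i, t i * blockSum P X A B u r (g i) n ω := fun ω => by
      simp only [pairing, blockSum, Finset.mul_sum]
      rw [Finset.sum_comm]
    have h5 : ∀ j, (blockIndices r n).filter (fun q => e j < e q) = laterBlocks r n j := fun j => by
      ext q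
      simp only [laterBlocks, Finset.mem_filter, e, Prod.Lex.toLex_lt_toLex]
      refine and_congr_right fun _ => ?_
      omega
    simp only [h4, h5] at h3
    rw [Finset.prod_congr rfl fun j _ => H.integral_exp_pairing_eq g t n j, Finset.prod_const] at h3
    exact h3
  simpa using h2.add h1

end BlockAsymptotics

end CLT

/-! ### Numerator and denominator of the estimator -/

/-- The sum of the terms with index `a` over the block centres and over all times. -/
noncomputable def totalSum {Ω : Type*} {d : ℕ} (X : RandomField Ω d) (A B : Set (Fin d → ℝ))
    (u : ℕ → ℝ) (r : Fin 3 → ℕ → ℕ) (a : Option (ℕ × ℕ)) (n : Fin 3 → ℕ) (ω : Ω) : ℝ :=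
  ∑ j ∈ spatialIndices r n, ∑ t ∈ Finset.Icc 1 (n 2 - (lagOf a).2),
    lagTerm X A (tailSet A B a) u (lagOf a).1 (lagOf a).2 n
      (blockCenter (blockDim r n 0) (blockDim r n 1) j) t ω

/-- The number of exceedances at the block centres during the last `h` times of the complete time
blocks. -/
noncomputable def edgeCount {Ω : Type*} {d : ℕ} (X : RandomField Ω d) (A : Set (Fin d → ℝ))
    (u : ℕ → ℝ) (r : Fin 3 → ℕ → ℕ) (h : ℕ) (n : Fin 3 → ℕ) (ω : Ω) : ℝ :=
  ∑ j ∈ spatialIndices r n, ∑ k ∈ Finset.Icc 1 (numBlocks r n 2),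
    ∑ t ∈ Finset.Icc (blockDim r n 2 - h + 1) (blockDim r n 2),
      A.indicator (fun _ => (1 : ℝ)) (normalizedObs X u n
        ((blockCenter (blockDim r n 0) (blockDim r n 1) j).1,
          (blockCenter (blockDim r n 0) (blockDim r n 1) j).2, (k - 1) * blockDim r n 2 + t) ω)

/-- The normalised difference between the sum over all times and the sum over the blocks. -/
noncomputable def blockRemainder {Ω : Type*} [MeasurableSpace Ω] {d : ℕ} (P : Measure Ω)
    (X : RandomField Ω d) (A B : Set (Fin d → ℝ)) (u : ℕ → ℝ) (r : Fin 3 → ℕ → ℕ)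
    (a : Option (ℕ × ℕ)) (n : Fin 3 → ℕ) (ω : Ω) : ℝ :=
  (√(sizeProb P X A u n))⁻¹ * (totalSum X A B u r a n ω -
    ∑ j ∈ blockIndices r n, onBlock X u r (lagFunctional A B a) n j ω)

section Totals

variable {Ω : Type*} {d : ℕ} {X : RandomField Ω d} {A B : Set (Fin d → ℝ)} {u : ℕ → ℝ}
  {r : Fin 3 → ℕ → ℕ} {n : Fin 3 → ℕ}

lemma totalSum_nonneg (a : Option (ℕ × ℕ)) (ω : Ω) : 0 ≤ totalSum X A B u r a n ω :=
  Finset.sum_nonneg fun _ _ => Finset.sum_nonneg fun _ _ => lagTerm_nonneg _ _ _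

lemma LargeBlocks.totalSum_none (h : LargeBlocks r n 0 0) (ω : Ω) :
    totalSum X A B u r none n ω = ∑ j ∈ spatialIndices r n, ∑ t ∈ Finset.Icc 1 (n 2),
      A.indicator (fun _ => (1 : ℝ)) (normalizedObs X u n
        ((blockCenter (blockDim r n 0) (blockDim r n 1) j).1,
          (blockCenter (blockDim r n 0) (blockDim r n 1) j).2, t) ω) :=
  Finset.sum_congr rfl fun _ hj => Finset.sum_congr rfl fun _ _ => h.lagTerm_self hj _ ω

lemma LargeBlocks.totalSum_le (h : LargeBlocks r n 0 0) (a : Option (ℕ × ℕ)) (ω : Ω) :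
    totalSum X A B u r a n ω ≤ totalSum X A B u r none n ω := by
  rw [h.totalSum_none]
  refine Finset.sum_le_sum fun j _ => (Finset.sum_le_sum fun t _ => lagTerm_le _ _ _).trans ?_
  exact Finset.sum_le_sum_of_subset_of_nonneg (Finset.Icc_subset_Icc_right (Nat.sub_le _ _))
    fun t _ _ => Set.indicator_nonneg (fun _ _ => zero_le_one) _

lemma LargeBlocks.sampleIsoExtremogram_eq (h : LargeBlocks r n 0 0) (l : ℕ × ℕ) (ω : Ω) :
    sampleIsoExtremogram X A B u r l.1 l.2 n ω =
      totalSum X A B u r (some l) n ω / totalSum X A B u r none n ω := by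
  rw [h.totalSum_none]
  rfl

/-- At each centre, the times missed by the block functionals lie among the last h_t times of
complete blocks or in the incomplete block, and each missed term is at most an exceedance indicator.
-/
lemma LargeBlocks.totalSum_sub (a : Option (ℕ × ℕ)) (h : LargeBlocks r n (lagOf a).1 (lagOf a).2)
    (ω : Ω) :
    0 ≤ totalSum X A B u r a n ω -
        ∑ j ∈ blockIndices r n, onBlock X u r (lagFunctional A B a) n j ω ∧
      totalSum X A B u r a n ω -
        ∑ j ∈ blockIndices r n, onBlock X u r (lagFunctional A B a) n j ω ≤
      edgeCount X A u r (lagOf a).2 n ω + incompleteCount X A u r n ω := by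
  have h1 : ∑ j ∈ blockIndices r n, onBlock X u r (lagFunctional A B a) n j ω =
      ∑ j ∈ spatialIndices r n, ∑ k ∈ Finset.Icc 1 (numBlocks r n 2),
        ∑ t ∈ Finset.Icc 1 (blockDim r n 2 - (lagOf a).2),
          lagTerm X A (tailSet A B a) u (lagOf a).1 (lagOf a).2 n
            (blockCenter (blockDim r n 0) (blockDim r n 1) j) ((k - 1) * blockDim r n 2 + t) ω := by
    rw [sum_blockIndices]
    refine Finset.sum_congr rfl fun j hj => Finset.sum_congr rfl fun k _ => ?_
    exact h.onBlock_eq (j := (j.1, j.2, k)) hj ω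
  have h2 := fun j : ℕ × ℕ => sum_blocks_error
    (g := fun t => lagTerm X A (tailSet A B a) u (lagOf a).1 (lagOf a).2 n
      (blockCenter (blockDim r n 0) (blockDim r n 1) j) t ω)
    (a := fun t => A.indicator (fun _ => (1 : ℝ)) (normalizedObs X u n
        ((blockCenter (blockDim r n 0) (blockDim r n 1) j).1,
          (blockCenter (blockDim r n 0) (blockDim r n 1) j).2, t) ω))
    (fun t => lagTerm_nonneg _ _ _) (fun t => lagTerm_le _ _ _) (h := (lagOf a).2)
    (Nat.div_mul_le_self (n 2) (blockDim r n 2))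
  rw [h1, totalSum, ← Finset.sum_sub_distrib, edgeCount, incompleteCount,
    ← Finset.sum_add_distrib]
  exact ⟨Finset.sum_nonneg fun j _ => (h2 j).1, Finset.sum_le_sum fun j _ => (h2 j).2⟩

variable [MeasurableSpace Ω]

lemma measurable_sampleIsoExtremogram (hX : ∀ s t, Measurable (X s t)) (hA : MeasurableSet A)
    (hB : MeasurableSet B) (hs ht : ℕ) :
    Measurable (sampleIsoExtremogram X A B u r hs ht n) := by
  refine Measurable.div ?_ ?_
  · exact Finset.measurable_fun_sum _ fun j _ => Finset.measurable_fun_sum _ fun t _ =>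
      measurable_lagTerm hX hA hB _ t
  · exact Finset.measurable_fun_sum _ fun j _ => Finset.measurable_fun_sum _ fun t _ =>
      (measurable_const.indicator hA).comp (measurable_normalizedObs hX _)

lemma measurable_rescaledError (P : Measure Ω) (hX : ∀ s t, Measurable (X s t))
    (hA : MeasurableSet A) (hB : MeasurableSet B) (Ls Lt : ℕ) :
    Measurable (rescaledError P X A B u r Ls Lt n) := by
  refine (WithLp.measurable_toLp 2 _).comp (measurable_pi_lambda _ fun a => ?_)
  exact ((measurable_sampleIsoExtremogram hX hA hB _ _).sub_const _).const_mul _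

lemma integral_le_sqrt_integral_sq {P : Measure Ω} [IsProbabilityMeasure P] {f : Ω → ℝ}
    (hf : MemLp f 2 P) : ∫ ω, f ω ∂P ≤ √(∫ ω, f ω ^ 2 ∂P) := by
  refine (le_abs_self _).trans (Real.abs_le_sqrt ?_)
  have h1 := variance_nonneg f P
  rw [variance_eq_sub hf] at h1
  simp only [Pi.pow_apply] at h1
  linarith

variable {P : Measure Ω} [IsProbabilityMeasure P]

lemma integrable_edgeCount (hX : ∀ s t, Measurable (X s t)) (hA : MeasurableSet A) (h : ℕ) :
    Integrable (edgeCount X A u r h n) P :=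
  integrable_finsetSum _ fun _ _ => integrable_finsetSum _ fun _ _ =>
    integrable_finsetSum _ fun _ _ => integrable_indicator_normalizedObs hX hA _

lemma integral_edgeCount (hX : ∀ s t, Measurable (X s t)) (hstat : Stationary P X)
    (hA : MeasurableSet A) {h : ℕ} (hh : h ≤ blockDim r n 2) :
    ∫ ω, edgeCount X A u r h n ω ∂P =
      (blockCount r n : ℝ) * h * exceedProb P X A u (sampleSize n) := by
  simp only [edgeCount]
  rw [integral_finsetSum _ fun _ _ => integrable_finsetSum _ fun _ _ =>
    integrable_finsetSum _ fun _ _ => integrable_indicator_normalizedObs hX hA _]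
  have h1 : ∀ j ∈ spatialIndices r n, ∫ ω, ∑ k ∈ Finset.Icc 1 (numBlocks r n 2),
      ∑ t ∈ Finset.Icc (blockDim r n 2 - h + 1) (blockDim r n 2),
      A.indicator (fun _ => (1 : ℝ)) (normalizedObs X u n
        ((blockCenter (blockDim r n 0) (blockDim r n 1) j).1,
          (blockCenter (blockDim r n 0) (blockDim r n 1) j).2,
          (k - 1) * blockDim r n 2 + t) ω) ∂P =
      (numBlocks r n 2 : ℝ) * (h * exceedProb P X A u (sampleSize n)) := by
    intro j _
    rw [integral_finsetSum _ fun _ _ =>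
      integrable_finsetSum _ fun _ _ => integrable_indicator_normalizedObs hX hA _]
    have h2 : ∀ k ∈ Finset.Icc 1 (numBlocks r n 2), ∫ ω,
      ∑ t ∈ Finset.Icc (blockDim r n 2 - h + 1) (blockDim r n 2),
      A.indicator (fun _ => (1 : ℝ)) (normalizedObs X u n
        ((blockCenter (blockDim r n 0) (blockDim r n 1) j).1,
          (blockCenter (blockDim r n 0) (blockDim r n 1) j).2,
          (k - 1) * blockDim r n 2 + t) ω) ∂P = h * exceedProb P X A u (sampleSize n) := by
      intro k _
      rw [integral_finsetSum _ fun _ _ => integrable_indicator_normalizedObs hX hA _,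
        Finset.sum_congr rfl fun t _ => integral_indicator_normalizedObs hX hstat hA _,
        Finset.sum_const, nsmul_eq_mul, Nat.card_Icc]
      congr 2
      omega
    rw [Finset.sum_congr rfl h2, Finset.sum_const, nsmul_eq_mul, Nat.card_Icc,
      Nat.add_sub_cancel]
  rw [Finset.sum_congr rfl h1, Finset.sum_const, nsmul_eq_mul, blockCount_eq, spatialIndices,
    Finset.card_product, Nat.card_Icc, Nat.card_Icc]
  push_cast
  ring

end Totals

section Limit

variable {Ω : Type*} [MeasurableSpace Ω] {P : Measure Ω} [IsProbabilityMeasure P] {d : ℕ}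
  {X : RandomField Ω d} {A B : Set (Fin d → ℝ)} {u : ℕ → ℝ} {r : Fin 3 → ℕ → ℕ}
  {𝓁 : Filter (Fin 3 → ℕ)} {σ : ℕ × ℕ → ℕ × ℕ → ℝ} {σ' : ℕ × ℕ → ℝ} {σ₀ : ℝ}

lemma TendstoZeroInProb.mul_of_abs_le_one {f : (Fin 3 → ℕ) → Ω → ℝ}
    (hf : TendstoZeroInProb P 𝓁 f) {c : (Fin 3 → ℕ) → ℝ} (hc : ∀ n, |c n| ≤ 1) :
    TendstoZeroInProb P 𝓁 (fun n ω => c n * f n ω) := by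
  refine tendstoZeroInProb_of_eventually_le fun ε hε η hη => ?_
  filter_upwards [hf.eventually_le hε hη] with n hn
  refine (measureReal_mono (fun ω hω => ?_) (measure_ne_top P _)).trans hn
  simp only [Set.mem_ofPred_eq, abs_mul] at hω ⊢
  exact hω.trans (mul_le_of_le_one_left (abs_nonneg _) (hc n))

lemma preIsoExtremogram_mem_Icc (hs ht N : ℕ) :
    0 ≤ preIsoExtremogram P X A B u hs ht N ∧ preIsoExtremogram P X A B u hs ht N ≤ 1 :=
  ⟨div_nonneg measureReal_nonneg measureReal_nonneg,
    div_le_one_of_le₀ (measureReal_mono (fun _ h => h.1) (measure_ne_top P _))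
      measureReal_nonneg⟩

namespace BlockAsymptotics

variable (H : BlockAsymptotics P X A B u r 𝓁)
include H

/-- Up to the covered fraction of the sample this is √(n v_n)/r. It bounds anything that costs a
fixed number of exceedance probabilities per block: the edge counts and the bias of the means. -/
lemma tendsto_blockCount_mul_prob : Tendsto (fun n => (√(sizeProb P X A u n))⁻¹ *
    ((blockCount r n : ℝ) * exceedProb P X A u (sampleSize n))) 𝓁 (𝓝 0) := by
  have h1 := (tendsto_blockCount_mul_div H.dim H.dim_small).mul H.sqrt_div_tendsto
  rw [mul_zero] at h1
  refine h1.congr' ?_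
  filter_upwards [H.eventually_blockCount_mul, H.sizeProb_tendsto.eventually_gt_atTop 0,
    H.prob_pos, H.large 0 0] with n hn hS hv hl
  have hsq : 0 < √(sizeProb P X A u n) := Real.sqrt_pos.2 hS
  have h2 : (blockVol r n : ℝ) ≠ 0 := by
    have h0 := hl.side0
    have h1 := hl.side1
    have h2 := hl.one_le
    rw [blockVol]
    positivity
  have h3 : ((blockCount r n : ℝ) * (blockVol r n : ℝ) / (sampleSize n : ℝ)) =
      (blockCount r n : ℝ) * (sizeProb P X A u n)⁻¹ * volProb P X A u r n := by
    rw [hn, mul_assoc, inv_mul_cancel₀, mul_one]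
    rw [volProb]
    exact mul_ne_zero h2 hv.ne'
  have h4 : sizeProb P X A u n = √(sizeProb P X A u n) * √(sizeProb P X A u n) :=
    (Real.mul_self_sqrt hS.le).symm
  rw [h3, volProb]
  set s := √(sizeProb P X A u n)
  rw [h4]
  field_simp

/-- The remainder is nonnegative and is bounded in L¹: the edge counts through their mean, the
incomplete block through the square root of its second moment and (C). -/
lemma tendstoZeroInProb_blockRemainder
    (hC : (incompleteSum P X A u r) =o[𝓁] (sizeProb P X A u)) (a : Option (ℕ × ℕ)) :
    TendstoZeroInProb P 𝓁 (blockRemainder P X A B u r a) := by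
  have h1 := (H.tendsto_blockCount_mul_prob.const_mul ((lagOf a).2 : ℝ)).add
    ((Real.continuous_sqrt.tendsto _).comp hC.tendsto_div_nhds_zero)
  rw [mul_zero, Real.sqrt_zero, add_zero] at h1
  refine tendstoZeroInProb_of_integral_abs h1 ?_
  filter_upwards [H.large (lagOf a).1 (lagOf a).2, H.sizeProb_tendsto.eventually_gt_atTop 0]
    with n hn hS
  have hsq : 0 < √(sizeProb P X A u n) := Real.sqrt_pos.2 hS
  have hI : Integrable (fun ω => totalSum X A B u r a n ω -
      ∑ j ∈ blockIndices r n, onBlock X u r (lagFunctional A B a) n j ω) P :=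
    (integrable_finsetSum _ fun _ _ => integrable_finsetSum _ fun _ _ =>
      integrable_lagTerm H.meas H.measA (H.measurableSet_tailSet a) _ _).sub
      (integrable_finsetSum _ fun j _ => H.integrable_onBlock a n j)
  have hM := memLp_incompleteCount (P := P) (u := u) (r := r) (n := n) H.meas H.measA
  refine ⟨hI.const_mul _, ?_⟩
  have h2 : ∀ ω, |blockRemainder P X A B u r a n ω| = (√(sizeProb P X A u n))⁻¹ *
      (totalSum X A B u r a n ω -
        ∑ j ∈ blockIndices r n, onBlock X u r (lagFunctional A B a) n j ω) := fun ω => by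
    rw [blockRemainder, abs_of_nonneg]
    exact mul_nonneg (inv_nonneg.2 hsq.le) (hn.totalSum_sub a ω).1
  simp only [h2]
  rw [integral_const_mul]
  have h3 : ∫ ω, (totalSum X A B u r a n ω -
      ∑ j ∈ blockIndices r n, onBlock X u r (lagFunctional A B a) n j ω) ∂P ≤
      (blockCount r n : ℝ) * (lagOf a).2 * exceedProb P X A u (sampleSize n) +
        √(incompleteSum P X A u r n) := by
    rw [← integral_edgeCount H.meas H.stationary H.measA hn.lag,
      ← integral_incompleteCount_sq H.meas H.measA]
    refine (integral_mono hI ((integrable_edgeCount H.meas H.measA _).add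
      (hM.integrable (by norm_num))) fun ω => (hn.totalSum_sub a ω).2).trans ?_
    rw [integral_add' (integrable_edgeCount H.meas H.measA _) (hM.integrable (by norm_num))]
    exact add_le_add le_rfl (integral_le_sqrt_integral_sq hM)
  refine (mul_le_mul_of_nonneg_left h3 (inv_nonneg.2 hsq.le)).trans (le_of_eq ?_)
  simp only [Function.comp_apply]
  rw [Real.sqrt_div' _ hS.le]
  ring

lemma eventually_totalSum_eq (a : Option (ℕ × ℕ)) : ∀ᶠ n in 𝓁, ∀ ω,
    (√(sizeProb P X A u n))⁻¹ * totalSum X A B u r a n ω =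
      blockSum P X A B u r a n ω + blockRemainder P X A B u r a n ω +
        (√(sizeProb P X A u n))⁻¹ * ((blockCount r n : ℝ) *
          ∫ ω, onBlock X u r (lagFunctional A B a) n (1, 1, 1) ω ∂P) := by
  refine Eventually.of_forall fun n ω => ?_
  have hmean : ∀ j, ∫ ω, onBlock X u r (lagFunctional A B a) n j ω ∂P =
      ∫ ω, onBlock X u r (lagFunctional A B a) n (1, 1, 1) ω ∂P := fun j =>
    ((identDistrib_block H.meas H.stationary j).comp (measurable_extremalFunctional H.measA
      (H.measurableSet_tailSet a) (blockDim r n))).integral_eq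
  simp only [blockSum, blockRemainder, centered, hmean, Finset.sum_sub_distrib, Finset.sum_const,
    nsmul_eq_mul]
  rw [← blockCount]
  ring

/-- The upper bound comes from 0 ≤ f_{A,B,h} ≤ f_{A,A,0,0} on the blocks. Its use is the degenerate
case: σ₀ = 0 makes every limiting variance zero. -/
lemma limitMoment_nonneg [𝓁.NeBot]
    (hσ : ∀ h h', Tendsto (covSum P X A B u r h h') 𝓁 (𝓝 (σ h h')))
    (hσ' : ∀ h, Tendsto (crossCovSum P X A B u r h) 𝓁 (𝓝 (σ' h)))
    (hσ₀ : Tendsto (crossCovSum P X A A u r (0, 0)) 𝓁 (𝓝 σ₀)) (a : Option (ℕ × ℕ)) :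
    0 ≤ limitMoment σ σ' σ₀ a a ∧ limitMoment σ σ' σ₀ a a ≤ σ₀ := by
  have hm := H.tendsto_moment hσ hσ' hσ₀
  constructor
  · refine ge_of_tendsto (hm a a) ?_
    filter_upwards [H.prob_pos] with n hv
    exact div_nonneg (integral_nonneg fun ω => mul_self_nonneg _)
      (mul_nonneg (Nat.cast_nonneg _) hv.le)
  · refine le_of_tendsto_of_tendsto (hm a a) (hm none none) ?_
    filter_upwards [H.prob_pos, H.eventually_onBlock_le a, H.large 0 0] with n hv hn hl
    refine div_le_div_of_nonneg_right ?_ (mul_nonneg (Nat.cast_nonneg _) hv.le)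
    refine integral_mono ((H.memLp_onBlock a n _).integrable_mul (H.memLp_onBlock a n _))
      ((H.memLp_onBlock none n _).integrable_mul (H.memLp_onBlock none n _)) fun ω => ?_
    have := hn _ hl.one_mem ω
    exact mul_le_mul this.2 this.2 this.1 (this.1.trans this.2)

lemma limitMoment_symm [𝓁.NeBot]
    (hσ : ∀ h h', Tendsto (covSum P X A B u r h h') 𝓁 (𝓝 (σ h h')))
    (hσ' : ∀ h, Tendsto (crossCovSum P X A B u r h) 𝓁 (𝓝 (σ' h)))
    (hσ₀ : Tendsto (crossCovSum P X A A u r (0, 0)) 𝓁 (𝓝 σ₀)) (a b : Option (ℕ × ℕ)) :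
    limitMoment σ σ' σ₀ a b = limitMoment σ σ' σ₀ b a := by
  refine tendsto_nhds_unique (H.tendsto_moment hσ hσ' hσ₀ a b) ?_
  refine (H.tendsto_moment hσ hσ' hσ₀ b a).congr fun n => ?_
  simp only [mul_comm]

lemma tendsto_charFun_blockSum_single
    (hσ : ∀ h h', Tendsto (covSum P X A B u r h h') 𝓁 (𝓝 (σ h h')))
    (hσ' : ∀ h, Tendsto (crossCovSum P X A B u r h) 𝓁 (𝓝 (σ' h)))
    (hσ₀ : Tendsto (crossCovSum P X A A u r (0, 0)) 𝓁 (𝓝 σ₀))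
    (hLin : Lindeberg P X A u r 𝓁 (extremalFamily A B))
    (hT : ∀ (q : ℕ) (f : Fin q → BlockFunctional d),
      (∀ i, f i ∈ extremalFamily A B) → ∀ t : Fin q → ℝ,
        Tendsto (depCoeff P X A u r f t) 𝓁 (𝓝 0)) (a : Option (ℕ × ℕ)) (s : ℝ) :
    Tendsto (fun n => ∫ ω, Complex.exp (Complex.I *
        ((s * blockSum P X A B u r a n ω : ℝ) : ℂ)) ∂P) 𝓁
      (𝓝 (Complex.exp (-((s ^ 2 * limitMoment σ σ' σ₀ a a : ℝ) : ℂ) / 2))) := by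
  have h := H.tendsto_charFun_blockSum hσ hσ' hσ₀ hLin hT (q := 1) (fun _ => a) (fun _ => s)
  simp only [Fin.sum_univ_one] at h
  rwa [sq]

/-- The ratio of `√(n v_n)` and of the spatial size of the blocks tends to infinity when the
fluctuations of the denominator do not vanish. -/
lemma tendsto_scale_atTop
    (hσ : ∀ h h', Tendsto (covSum P X A B u r h h') 𝓁 (𝓝 (σ h h')))
    (hσ' : ∀ h, Tendsto (crossCovSum P X A B u r h) 𝓁 (𝓝 (σ' h)))
    (hσ₀ : Tendsto (crossCovSum P X A A u r (0, 0)) 𝓁 (𝓝 σ₀))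
    (hLin : Lindeberg P X A u r 𝓁 (extremalFamily A B)) (hpos : 0 < σ₀) :
    Tendsto (fun n => √(sizeProb P X A u n) / ((blockDim r n 0 : ℝ) * (blockDim r n 1 : ℝ))) 𝓁
      atTop := by
  refine tendsto_atTop.2 fun K => ?_
  -- A Lindeberg level proportional to 1/(|K| + 1) turns the lower bound σ₀/4 for ε a_n, obtained
  -- below, into a_n > |K|.
  set ε : ℝ := σ₀ / (4 * (|K| + 1)) with hε
  have hε0 : 0 < ε := by positivity
  have hm := H.tendsto_moment hσ hσ' hσ₀ none none
  have hV := H.volProb_tendsto.const_mul 3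
  have hL := (hLin _ (lagFunctional_mem A B none) ε hε0).const_mul 2
  rw [mul_zero] at hV hL
  filter_upwards [hm.eventually (lt_mem_nhds (show σ₀ / 2 < σ₀ by linarith)),
    hV.eventually (gt_mem_nhds (show (0 : ℝ) < σ₀ / 8 by positivity)),
    hL.eventually (gt_mem_nhds (show (0 : ℝ) < σ₀ / 8 by positivity)),
    H.large 0 0, H.prob_pos, H.eventually_integral_onBlock_none,
    H.eventually_blockDim_two_le_vol] with n n1 n2 n3 hl hv n4 n5
  have hμ := n4 _ hl.one_mem
  set F := onBlock X u r (lagFunctional A B none) n (1, 1, 1) with hF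
  set c := centered P X u r (lagFunctional A B none) n (1, 1, 1) with hc
  set μ := (blockDim r n 2 : ℝ) * exceedProb P X A u (sampleSize n) with hμdef
  set s := √(sizeProb P X A u n) with hs
  have h0 : (0 : ℝ) < blockDim r n 0 := by have := hl.side0; positivity
  have h1 : (0 : ℝ) < blockDim r n 1 := by have := hl.side1; positivity
  have h2 : (0 : ℝ) < blockDim r n 2 := by exact_mod_cast hl.one_le
  have hμ0 : 0 < μ := mul_pos h2 hv
  have hs0 : 0 ≤ s := Real.sqrt_nonneg _
  have hvol : volProb P X A u r n = (blockDim r n 0 : ℝ) * (blockDim r n 1 : ℝ) * μ := by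
    rw [volProb, blockVol, hμdef]; push_cast; ring
  have hvol0 : 0 < volProb P X A u r n := by rw [hvol]; positivity
  have hμle : μ ≤ volProb P X A u r n := mul_le_mul_of_nonneg_right n5 hv.le
  have hFi : Integrable F P := H.integrable_onBlock none n _
  have hFi2 : Integrable (fun ω => F ω * F ω) P :=
    (H.memLp_onBlock none n _).integrable_mul (H.memLp_onBlock none n _)
  have hci : Integrable ({ω' | ε * s < |c ω'|}.indicator (fun ω' => c ω' ^ 2)) P :=
    (H.memLp_centered none n _).integrable_sq.indicator
      (measurableSet_lt measurable_const (H.measurable_centered none n _).abs)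
  -- Where |F − μ| ≤ ε s, one factor F is at most ε s + μ; elsewhere F² ≤ 2(F − μ)² + 2μ², and the
  -- first part is the Lindeberg term.
  have hpt : ∀ ω, F ω * F ω ≤ (ε * s + μ) * F ω +
      2 * {ω' | ε * s < |c ω'|}.indicator (fun ω' => c ω' ^ 2) ω + 2 * μ ^ 2 := by
    intro ω
    have hcF : c ω = F ω - μ := by rw [hc, centered, ← hF, hμ]
    have hF0 : 0 ≤ F ω := onBlock_nonneg _ _
    by_cases hx : ε * s < |c ω|
    · rw [Set.indicator_of_mem (by exact hx)]
      have h3 : 0 ≤ (ε * s + μ) * F ω := by positivity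
      have h4 : F ω = c ω + μ := by rw [hcF]; ring
      nlinarith [sq_nonneg (c ω - μ)]
    · rw [Set.indicator_of_notMem (by exact hx)]
      push Not at hx
      have h3 : F ω ≤ ε * s + μ := by
        have := (le_abs_self _).trans hx
        rw [hcF] at this
        linarith
      have h4 := mul_le_mul_of_nonneg_right h3 hF0
      nlinarith [sq_nonneg μ]
  have hint : ∫ ω, F ω * F ω ∂P ≤ ∫ ω, ((ε * s + μ) * F ω +
      2 * {ω' | ε * s < |c ω'|}.indicator (fun ω' => c ω' ^ 2) ω + 2 * μ ^ 2) ∂P :=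
    integral_mono hFi2 (((hFi.const_mul (ε * s + μ)).add (hci.const_mul 2)).add
      (integrable_const (2 * μ ^ 2))) hpt
  rw [integral_add (f := fun ω => (ε * s + μ) * F ω +
      2 * {ω' | ε * s < |c ω'|}.indicator (fun ω' => c ω' ^ 2) ω)
      ((hFi.const_mul (ε * s + μ)).add (hci.const_mul 2)) (integrable_const _),
    integral_add (hFi.const_mul (ε * s + μ)) (hci.const_mul 2), integral_const_mul,
    integral_const_mul, hμ] at hint
  simp only [integral_const, probReal_univ, smul_eq_mul, one_mul] at hint
  set J := ∫ ω, {ω' | ε * s < |c ω'|}.indicator (fun ω' => c ω' ^ 2) ω ∂P with hJ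
  have n1' : σ₀ / 2 < ((ε * s + μ) * μ + 2 * J + 2 * μ ^ 2) / volProb P X A u r n :=
    n1.trans_le (div_le_div_of_nonneg_right hint hvol0.le)
  -- Since r v_n = r₁r₂ μ, the first term becomes ε s/(r₁r₂). The others are each below σ₀/8 while
  -- the left side exceeds σ₀/2, so this term exceeds σ₀/4.
  have e1 : ((ε * s + μ) * μ + 2 * J + 2 * μ ^ 2) / volProb P X A u r n =
      ε * (s / ((blockDim r n 0 : ℝ) * (blockDim r n 1 : ℝ))) +
        2 * ((volProb P X A u r n)⁻¹ * J) + 3 * (μ ^ 2 / volProb P X A u r n) := by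
    have : ε * (s / ((blockDim r n 0 : ℝ) * (blockDim r n 1 : ℝ))) =
        ε * s * μ / volProb P X A u r n := by
      rw [hvol]; field_simp
    rw [this]
    ring
  have e2 : μ ^ 2 / volProb P X A u r n ≤ volProb P X A u r n := by
    rw [div_le_iff₀ hvol0, sq]
    exact mul_le_mul hμle hμle hμ0.le hvol0.le
  have e3 : σ₀ / 4 < ε * (s / ((blockDim r n 0 : ℝ) * (blockDim r n 1 : ℝ))) := by
    linarith
  have e4 : ε * (|K| + 1) = σ₀ / 4 := by rw [hε]; field_simp
  have e5 : |K| + 1 < s / ((blockDim r n 0 : ℝ) * (blockDim r n 1 : ℝ)) := by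
    rw [← e4] at e3
    exact lt_of_mul_lt_mul_left e3 hε0.le
  linarith [le_abs_self K]

/-- The rescaled errors of the estimator are asymptotically equivalent to linear combinations of the
normalised sums over blocks. -/
lemma tendstoZeroInProb_error_sub [𝓁.NeBot] [𝓁.IsCountablyGenerated]
    (hσ : ∀ h h', Tendsto (covSum P X A B u r h h') 𝓁 (𝓝 (σ h h')))
    (hσ' : ∀ h, Tendsto (crossCovSum P X A B u r h) 𝓁 (𝓝 (σ' h)))
    (hσ₀ : Tendsto (crossCovSum P X A A u r (0, 0)) 𝓁 (𝓝 σ₀))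
    (hC : (incompleteSum P X A u r) =o[𝓁] (sizeProb P X A u))
    (hLin : Lindeberg P X A u r 𝓁 (extremalFamily A B))
    (hT : ∀ (q : ℕ) (f : Fin q → BlockFunctional d),
      (∀ i, f i ∈ extremalFamily A B) → ∀ t : Fin q → ℝ,
        Tendsto (depCoeff P X A u r f t) 𝓁 (𝓝 0)) (l : ℕ × ℕ) {ρ : ℝ}
    (hρ : Tendsto (fun n => preIsoExtremogram P X A B u l.1 l.2 (sampleSize n)) 𝓁 (𝓝 ρ)) :
    TendstoZeroInProb P 𝓁 (fun n ω =>
      √(sizeProb P X A u n) / ((blockDim r n 0 : ℝ) * (blockDim r n 1 : ℝ)) *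
        (sampleIsoExtremogram X A B u r l.1 l.2 n ω -
          preIsoExtremogram P X A B u l.1 l.2 (sampleSize n)) -
      (blockSum P X A B u r (some l) n ω - ρ * blockSum P X A B u r none n ω)) := by
  set ρn : (Fin 3 → ℕ) → ℝ := fun n => preIsoExtremogram P X A B u l.1 l.2 (sampleSize n) with hρn
  set a : (Fin 3 → ℕ) → ℝ := fun n =>
    √(sizeProb P X A u n) / ((blockDim r n 0 : ℝ) * (blockDim r n 1 : ℝ)) with ha
  set e : (Fin 3 → ℕ) → ℝ := fun n =>
    (blockCount r n : ℝ) * (blockVol r n : ℝ) / (sampleSize n : ℝ) with he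
  set G : (Fin 3 → ℕ) → Ω → ℝ := fun n ω => (√(sizeProb P X A u n))⁻¹ *
    (totalSum X A B u r (some l) n ω - ρn n * totalSum X A B u r none n ω) with hG
  set T : (Fin 3 → ℕ) → Ω → ℝ := fun n ω =>
    blockSum P X A B u r none n ω + blockRemainder P X A B u r none n ω with hTdef
  have hchar := H.tendsto_charFun_blockSum_single hσ hσ' hσ₀ hLin hT
  have hb : ∀ b, BoundedInProb P 𝓁 (blockSum P X A B u r b) := fun b =>
    boundedInProb_of_charFun_gaussian
      (V := ⟨limitMoment σ σ' σ₀ b b, (H.limitMoment_nonneg hσ hσ' hσ₀ b).1⟩)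
      (H.measurable_blockSum b) (hchar b)
  have hrem := H.tendstoZeroInProb_blockRemainder hC
  have hρ1 : ∀ n, |-ρn n| ≤ 1 := fun n => by
    have := preIsoExtremogram_mem_Icc (P := P) (X := X) (A := A) (B := B) (u := u) l.1 l.2
      (sampleSize n)
    rw [abs_neg, abs_of_nonneg this.1]
    exact this.2
  -- Four errors: ρ_n against ρ, multiplied by a tight block sum; the uncancelled bias −h_t ρ_n v_n
  -- per block; and the two boundary remainders.
  have hGX : TendstoZeroInProb P 𝓁 (fun n ω => G n ω -
      (blockSum P X A B u r (some l) n ω - ρ * blockSum P X A B u r none n ω)) := by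
    have h1 : Tendsto (fun n => ρ - ρn n) 𝓁 (𝓝 0) := by
      simpa using (tendsto_const_nhds (x := ρ)).sub hρ
    have h2 : Tendsto (fun n => (√(sizeProb P X A u n))⁻¹ *
        ((blockCount r n : ℝ) * exceedProb P X A u (sampleSize n)) * (-(l.2 : ℝ) * ρn n)) 𝓁
        (𝓝 0) := by
      have := H.tendsto_blockCount_mul_prob.mul (hρ.const_mul (-(l.2 : ℝ)))
      rwa [zero_mul] at this
    refine ((((hb none).mul_tendsto_zero h1).add (tendstoZeroInProb_of_tendsto (P := P) h2)).add
      ((hrem (some l)).add ((hrem none).mul_of_abs_le_one hρ1))).congr' ?_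
    filter_upwards [H.eventually_totalSum_eq (some l), H.eventually_totalSum_eq none,
      H.eventually_integral_onBlock_none, H.eventually_integral_onBlock_some l, H.large 0 0]
      with n n1 n2 n3 n4 hl ω
    have m1 := n1 ω
    have m2 := n2 ω
    rw [n4 _ hl.one_mem] at m1
    rw [n3 _ hl.one_mem] at m2
    have m3 : G n ω = (√(sizeProb P X A u n))⁻¹ * totalSum X A B u r (some l) n ω -
        ρn n * ((√(sizeProb P X A u n))⁻¹ * totalSum X A B u r none n ω) := by
      simp only [hG]; ring
    rw [m3, m1, m2]
    ring
  have hpos : ∀ᶠ n in 𝓁, 0 < a n ∧ 0 < √(sizeProb P X A u n) ∧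
      a n * √(sizeProb P X A u n) ≠ 0 := by
    filter_upwards [H.large 0 0, H.sizeProb_tendsto.eventually_gt_atTop 0] with n hl hS
    have h0 : (0 : ℝ) < blockDim r n 0 := by have := hl.side0; positivity
    have h1 : (0 : ℝ) < blockDim r n 1 := by have := hl.side1; positivity
    have hsq : 0 < √(sizeProb P X A u n) := Real.sqrt_pos.2 hS
    have : 0 < a n := by simp only [ha]; positivity
    exact ⟨this, hsq, by positivity⟩
  -- The scale a_n √(n v_n) is n v_n/(r₁r₂), the asymptotic mean of the number of exceedances at the
  -- centres; e_n is the exact mean over complete blocks divided by this scale.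
  have hD : ∀ᶠ n in 𝓁, ∀ ω, totalSum X A B u r none n ω =
      a n * √(sizeProb P X A u n) * (e n + T n ω / a n) := by
    filter_upwards [H.eventually_totalSum_eq none, H.eventually_integral_onBlock_none, hpos,
      H.large 0 0, H.sizeProb_tendsto.eventually_gt_atTop 0] with n n2 n3 n4 hl hS ω
    have m2 := n2 ω
    rw [n3 _ hl.one_mem] at m2
    obtain ⟨p1, p2, -⟩ := n4
    have h0 : (0 : ℝ) < blockDim r n 0 := by have := hl.side0; positivity
    have h1 : (0 : ℝ) < blockDim r n 1 := by have := hl.side1; positivity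
    have hN : (sampleSize n : ℝ) ≠ 0 := fun h => by simp [sizeProb, h] at hS
    have m3 : totalSum X A B u r none n ω = √(sizeProb P X A u n) *
        ((√(sizeProb P X A u n))⁻¹ * totalSum X A B u r none n ω) := by
      field_simp
    have m4 : a n * √(sizeProb P X A u n) * (T n ω / a n) = √(sizeProb P X A u n) * T n ω := by
      field_simp
    have m5 : a n * √(sizeProb P X A u n) * e n = (blockCount r n : ℝ) *
        ((blockDim r n 2 : ℝ) * exceedProb P X A u (sampleSize n)) := by
      have : a n * √(sizeProb P X A u n) = sizeProb P X A u n /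
          ((blockDim r n 0 : ℝ) * (blockDim r n 1 : ℝ)) := by
        simp only [ha]
        rw [div_mul_eq_mul_div, Real.mul_self_sqrt hS.le]
      rw [this]
      simp only [he, sizeProb, blockVol]
      push_cast
      field_simp
    rw [m3, m2, mul_add (a n * √(sizeProb P X A u n)) (e n), m4, m5]
    simp only [hTdef]
    field_simp
    ring
  -- Nonvanishing is needed: without exceedances the estimator is 0 by the convention for division,
  -- and subtracting ρ_n no longer gives this quotient.
  have hY : ∀ᶠ n in 𝓁, ∀ ω, e n + T n ω / a n ≠ 0 →
      a n * (sampleIsoExtremogram X A B u r l.1 l.2 n ω - ρn n) =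
        G n ω / (e n + T n ω / a n) := by
    filter_upwards [hD, hpos, H.large 0 0] with n n1 n2 hl ω hne
    obtain ⟨p1, p2, p3⟩ := n2
    have hDne : totalSum X A B u r none n ω ≠ 0 := by
      rw [n1 ω]; exact mul_ne_zero p3 hne
    rw [hl.sampleIsoExtremogram_eq]
    have q1 : totalSum X A B u r (some l) n ω / totalSum X A B u r none n ω - ρn n =
        √(sizeProb P X A u n) * G n ω / totalSum X A B u r none n ω := by
      simp only [hG]
      field_simp
    rw [q1, n1 ω]
    field_simp
  -- Both the estimator and ρ_n lie in [0, 1].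
  have hYa : ∀ᶠ n in 𝓁, ∀ ω,
      |a n * (sampleIsoExtremogram X A B u r l.1 l.2 n ω - ρn n)| ≤ a n := by
    filter_upwards [hpos, H.large 0 0] with n n1 hl ω
    rw [abs_mul, abs_of_pos n1.1, hl.sampleIsoExtremogram_eq]
    refine mul_le_of_le_one_right n1.1.le ?_
    have q1 := preIsoExtremogram_mem_Icc (P := P) (X := X) (A := A) (B := B) (u := u) l.1 l.2
      (sampleSize n)
    have q2 : 0 ≤ totalSum X A B u r (some l) n ω / totalSum X A B u r none n ω :=
      div_nonneg (totalSum_nonneg _ _) (totalSum_nonneg _ _)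
    have q3 : totalSum X A B u r (some l) n ω / totalSum X A B u r none n ω ≤ 1 :=
      div_le_one_of_le₀ (hl.totalSum_le _ _) (totalSum_nonneg _ _)
    rw [abs_le]
    constructor <;> linarith [q1.1, q1.2]
  have he1 : Tendsto e 𝓁 (𝓝 1) := tendsto_blockCount_mul_div H.dim H.dim_small
  -- For σ₀ > 0 the scale a_n diverges. For σ₀ = 0 it may stay bounded, but then all block sums
  -- vanish in probability and the a priori bound on the error takes over.
  rcases (H.limitMoment_nonneg hσ hσ' hσ₀ none).1.lt_or_eq with hpos0 | hzero
  · refine tendstoZeroInProb_ratio_sub hY he1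
      (H.tendsto_scale_atTop hσ hσ' hσ₀ hLin hpos0) ((hb none).add (hrem none).boundedInProb) ?_ hGX
    have := (hb (some l)).add ((hb none).const_mul (-ρ))
    simpa [sub_eq_add_neg] using this
  · have hz : ∀ b, TendstoZeroInProb P 𝓁 (blockSum P X A B u r b) := fun b => by
      have h0 : limitMoment σ σ' σ₀ b b = 0 := by
        have h1 := H.limitMoment_nonneg hσ hσ' hσ₀ b
        have h2 : (0 : ℝ) = σ₀ := hzero
        exact le_antisymm (h2 ▸ h1.2) h1.1
      refine tendstoZeroInProb_of_charFun (H.measurable_blockSum b) fun s => ?_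
      simpa [h0] using hchar b s
    have hXz : TendstoZeroInProb P 𝓁 (fun n ω =>
        blockSum P X A B u r (some l) n ω - ρ * blockSum P X A B u r none n ω) := by
      have h1 : TendstoZeroInProb P 𝓁 (fun n ω => (-ρ) * blockSum P X A B u r none n ω) := by
        refine tendstoZeroInProb_of_charFun
          (fun n => (H.measurable_blockSum none n).const_mul _) fun s => ?_
        have h0 : limitMoment σ σ' σ₀ none none = 0 := hzero.symm
        simpa [h0, mul_assoc] using hchar none (s * (-ρ))
      exact ((hz (some l)).add h1).congr' (Eventually.of_forall fun n ω => by ring)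
    have hGz : TendstoZeroInProb P 𝓁 G :=
      (hGX.add hXz).congr' (Eventually.of_forall fun n ω => by ring)
    have hYz := tendstoZeroInProb_ratio hY he1 hYa ((hz none).add (hrem none)) hGz
    have hXz' : TendstoZeroInProb P 𝓁 (fun n ω => (-1 : ℝ) *
        (blockSum P X A B u r (some l) n ω - ρ * blockSum P X A B u r none n ω)) :=
      hXz.mul_of_abs_le_one (c := fun _ => -1) (fun _ => by simp)
    exact (hYz.add hXz').congr' (Eventually.of_forall fun n ω => by ring)

end BlockAsymptotics

end Limit

/-! ### Linear combinations of the errors and the multivariate limit. -/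

lemma tendsto_sampleSize {𝓁 : Filter (Fin 3 → ℕ)}
    (h𝓁 : ∀ i, Tendsto (fun n : Fin 3 → ℕ => n i) 𝓁 atTop) : Tendsto sampleSize 𝓁 atTop :=
  ((h𝓁 0).atTop_mul_atTop₀ (h𝓁 1)).atTop_mul_atTop₀ (h𝓁 2)

/-- The coefficients of the linear combination of block sums which approximates the linear
combination with coefficients `x` of the rescaled errors. -/
noncomputable def errorCoeff {κ : Type*} [Fintype κ] (x ρ : κ → ℝ) : Option κ → ℝ
  | none => -∑ a, x a * ρ a
  | some a => x a

lemma sum_errorCoeff_mul {κ : Type*} [Fintype κ] (x ρ : κ → ℝ) (y : Option κ → ℝ) :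
    ∑ i, errorCoeff x ρ i * y i = ∑ a, x a * (y (some a) - ρ a * y none) := by
  rw [Fintype.sum_option]
  simp only [errorCoeff, mul_sub, Finset.sum_sub_distrib, neg_mul, Finset.sum_mul, mul_assoc]
  ring

/-- The left side is the limiting variance of Σ x_a (S_a − ρ_a S_A); expanding the bilinear form in
each argument produces the four terms of `asymptoticCov`. -/
lemma sum_errorCoeff_limitMoment (σ : ℕ × ℕ → ℕ × ℕ → ℝ) (σ' : ℕ × ℕ → ℝ) (σ₀ : ℝ)
    (ρ : ℕ → ℕ → ℝ) (Ls Lt : ℕ) (x : Fin (Ls + 1) × Fin (Lt + 1) → ℝ) :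
    ∑ i, ∑ j, errorCoeff x (fun a => ρ a.1 a.2) i * errorCoeff x (fun a => ρ a.1 a.2) j *
      limitMoment σ σ' σ₀ (i.map fun a => ((a.1 : ℕ), (a.2 : ℕ)))
        (j.map fun a => ((a.1 : ℕ), (a.2 : ℕ))) =
      x ⬝ᵥ (asymptoticCov σ σ' σ₀ ρ Ls Lt).mulVec x := by
  have h1 : ∀ i : Option (Fin (Ls + 1) × Fin (Lt + 1)),
      ∑ j, errorCoeff x (fun a => ρ a.1 a.2) i * errorCoeff x (fun a => ρ a.1 a.2) j *
        limitMoment σ σ' σ₀ (i.map fun a => ((a.1 : ℕ), (a.2 : ℕ)))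
          (j.map fun a => ((a.1 : ℕ), (a.2 : ℕ))) =
      errorCoeff x (fun a => ρ a.1 a.2) i * ∑ b, x b *
        (limitMoment σ σ' σ₀ (i.map fun a => ((a.1 : ℕ), (a.2 : ℕ))) (some (b.1, b.2)) -
          ρ b.1 b.2 * limitMoment σ σ' σ₀ (i.map fun a => ((a.1 : ℕ), (a.2 : ℕ))) none) := by
    intro i
    simp only [mul_assoc]
    rw [← Finset.mul_sum]
    congr 1
    exact sum_errorCoeff_mul x (fun a => ρ a.1 a.2) fun j => limitMoment σ σ' σ₀
      (i.map fun a => ((a.1 : ℕ), (a.2 : ℕ))) (j.map fun a => ((a.1 : ℕ), (a.2 : ℕ)))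
  rw [Finset.sum_congr rfl fun i _ => h1 i,
    sum_errorCoeff_mul x (fun a => ρ a.1 a.2) fun i => ∑ b, x b *
        (limitMoment σ σ' σ₀ (i.map fun a => ((a.1 : ℕ), (a.2 : ℕ))) (some (b.1, b.2)) -
          ρ b.1 b.2 * limitMoment σ σ' σ₀ (i.map fun a => ((a.1 : ℕ), (a.2 : ℕ))) none)]
  simp only [dotProduct, Matrix.mulVec]
  refine Finset.sum_congr rfl fun a _ => ?_
  congr 1
  rw [Finset.mul_sum, ← Finset.sum_sub_distrib]
  refine Finset.sum_congr rfl fun b _ => ?_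
  simp only [limitMoment, asymptoticCov, Option.map_some, Option.map_none]
  ring

namespace BlockAsymptotics

variable {Ω : Type*} [MeasurableSpace Ω] {P : Measure Ω} [IsProbabilityMeasure P] {d : ℕ}
  {X : RandomField Ω d} {A B : Set (Fin d → ℝ)} {u : ℕ → ℝ} {r : Fin 3 → ℕ → ℕ}
  {𝓁 : Filter (Fin 3 → ℕ)} {σ : ℕ × ℕ → ℕ × ℕ → ℝ} {σ' : ℕ × ℕ → ℝ} {σ₀ : ℝ}
  (H : BlockAsymptotics P X A B u r 𝓁)

include H

/-- The form is a limit of block counts times second moments of linear combinations, hence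
nonnegative. -/
lemma sum_limitMoment_nonneg [𝓁.NeBot]
    (hσ : ∀ h h', Tendsto (covSum P X A B u r h h') 𝓁 (𝓝 (σ h h')))
    (hσ' : ∀ h, Tendsto (crossCovSum P X A B u r h) 𝓁 (𝓝 (σ' h)))
    (hσ₀ : Tendsto (crossCovSum P X A A u r (0, 0)) 𝓁 (𝓝 σ₀)) {ι : Type*} [Fintype ι]
    (g : ι → Option (ℕ × ℕ)) (t : ι → ℝ) :
    0 ≤ ∑ i, ∑ j, t i * t j * limitMoment σ σ' σ₀ (g i) (g j) := by
  have e := (Fintype.equivFin ι).symm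
  have h := ge_of_tendsto' (b := (0 : ℝ))
    (H.tendsto_pairing_variance hσ hσ' hσ₀ (fun i => g (e i)) fun i => t (e i)) fun n =>
      mul_nonneg (Nat.cast_nonneg _) (integral_nonneg fun ω => sq_nonneg _)
  rw [e.sum_comp fun i => ∑ j, t i * t (e j) * limitMoment σ σ' σ₀ (g i) (g (e j))] at h
  exact h.trans_eq (Finset.sum_congr rfl fun i _ =>
    e.sum_comp fun j => t i * t j * limitMoment σ σ' σ₀ (g i) (g j))

lemma tendsto_charFun_sum_blockSum
    (hσ : ∀ h h', Tendsto (covSum P X A B u r h h') 𝓁 (𝓝 (σ h h')))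
    (hσ' : ∀ h, Tendsto (crossCovSum P X A B u r h) 𝓁 (𝓝 (σ' h)))
    (hσ₀ : Tendsto (crossCovSum P X A A u r (0, 0)) 𝓁 (𝓝 σ₀))
    (hLin : Lindeberg P X A u r 𝓁 (extremalFamily A B))
    (hT : ∀ (q : ℕ) (f : Fin q → BlockFunctional d),
      (∀ i, f i ∈ extremalFamily A B) → ∀ t : Fin q → ℝ,
        Tendsto (depCoeff P X A u r f t) 𝓁 (𝓝 0)) {ι : Type*} [Fintype ι]
    (g : ι → Option (ℕ × ℕ)) (t : ι → ℝ) :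
    Tendsto (fun n => ∫ ω, Complex.exp (Complex.I *
        ((∑ i, t i * blockSum P X A B u r (g i) n ω : ℝ) : ℂ)) ∂P) 𝓁
      (𝓝 (Complex.exp
        (-((∑ i, ∑ j, t i * t j * limitMoment σ σ' σ₀ (g i) (g j) : ℝ) : ℂ) / 2))) := by
  have e := (Fintype.equivFin ι).symm
  have h := H.tendsto_charFun_blockSum hσ hσ' hσ₀ hLin hT (fun i => g (e i)) fun i => t (e i)
  rw [e.sum_comp fun i => ∑ j, t i * t (e j) * limitMoment σ σ' σ₀ (g i) (g (e j)),
    Finset.sum_congr rfl fun i _ =>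
      e.sum_comp fun j => t i * t j * limitMoment σ σ' σ₀ (g i) (g j)] at h
  refine h.congr fun n => integral_congr_ae (Eventually.of_forall fun ω => ?_)
  simp only
  rw [e.sum_comp fun i => t i * blockSum P X A B u r (g i) n ω]

/-- Symmetry of σ is inherited from the moments of which it is the limit. Semidefiniteness is needed
to use the characteristic function of `multivariateGaussian`. -/
lemma posSemidef_asymptoticCov [𝓁.NeBot]
    (hσ : ∀ h h', Tendsto (covSum P X A B u r h h') 𝓁 (𝓝 (σ h h')))
    (hσ' : ∀ h, Tendsto (crossCovSum P X A B u r h) 𝓁 (𝓝 (σ' h)))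
    (hσ₀ : Tendsto (crossCovSum P X A A u r (0, 0)) 𝓁 (𝓝 σ₀)) (ρ : ℕ → ℕ → ℝ) (Ls Lt : ℕ) :
    (asymptoticCov σ σ' σ₀ ρ Ls Lt).PosSemidef := by
  refine .of_dotProduct_mulVec_nonneg (Matrix.ext fun a b => ?_) fun x => ?_
  · have h : σ ((b.1 : ℕ), (b.2 : ℕ)) ((a.1 : ℕ), (a.2 : ℕ)) =
        σ ((a.1 : ℕ), (a.2 : ℕ)) ((b.1 : ℕ), (b.2 : ℕ)) :=
      H.limitMoment_symm hσ hσ' hσ₀ (some _) (some _)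
    simp only [Matrix.conjTranspose_apply, star_trivial, asymptoticCov, h]
    ring
  · rw [star_trivial, ← sum_errorCoeff_limitMoment]
    exact H.sum_limitMoment_nonneg hσ hσ' hσ₀ _ _

/-- The central limit theorem for the rescaled errors of the estimator. -/
theorem tendstoInDistribution_rescaledError [𝓁.NeBot] [𝓁.IsCountablyGenerated]
    (hσ : ∀ h h', Tendsto (covSum P X A B u r h h') 𝓁 (𝓝 (σ h h')))
    (hσ' : ∀ h, Tendsto (crossCovSum P X A B u r h) 𝓁 (𝓝 (σ' h)))
    (hσ₀ : Tendsto (crossCovSum P X A A u r (0, 0)) 𝓁 (𝓝 σ₀))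
    (hC : (incompleteSum P X A u r) =o[𝓁] (sizeProb P X A u))
    (hLin : Lindeberg P X A u r 𝓁 (extremalFamily A B))
    (hT : ∀ (q : ℕ) (f : Fin q → BlockFunctional d),
      (∀ i, f i ∈ extremalFamily A B) → ∀ t : Fin q → ℝ,
        Tendsto (depCoeff P X A u r f t) 𝓁 (𝓝 0)) {ρ : ℕ → ℕ → ℝ}
    (hρ : ∀ hs ht, Tendsto (fun n => preIsoExtremogram P X A B u hs ht (sampleSize n)) 𝓁
      (𝓝 (ρ hs ht))) (Ls Lt : ℕ) :
    TendstoInDistribution (rescaledError P X A B u r Ls Lt) 𝓁 id (fun _ => P)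
      (multivariateGaussian 0 (asymptoticCov σ σ' σ₀ ρ Ls Lt)) := by
  set Z : (Fin 3 → ℕ) → Ω → EuclideanSpace ℝ (Fin (Ls + 1) × Fin (Lt + 1)) := fun n ω =>
    WithLp.toLp 2 fun a => blockSum P X A B u r (some (a.1, a.2)) n ω -
      ρ a.1 a.2 * blockSum P X A B u r none n ω with hZ
  have hZm : ∀ n, Measurable (Z n) := fun n =>
    (WithLp.measurable_toLp 2 _).comp (measurable_pi_lambda _ fun a =>
      (H.measurable_blockSum _ n).sub ((H.measurable_blockSum _ n).const_mul _))
  -- The block-sum vector Z carries the limit law, obtained from its characteristic function; the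
  -- errors differ from it by a vector tending to zero in probability, coordinate by coordinate.
  refine tendstoInDistribution_of_tendstoInMeasure_sub (X := Z) _ _
    (tendstoInDistribution_of_charFun hZm _ fun x => ?_) (tendstoInMeasure_euclidean fun a => ?_)
    fun n => (measurable_rescaledError P H.meas H.measA H.measB Ls Lt).aemeasurable
  · have h := H.tendsto_charFun_sum_blockSum hσ hσ' hσ₀ hLin hT
      (fun i : Option (Fin (Ls + 1) × Fin (Lt + 1)) => i.map fun a => ((a.1 : ℕ), (a.2 : ℕ)))
      (errorCoeff x (fun a => ρ a.1 a.2))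
    rw [sum_errorCoeff_limitMoment] at h
    rw [charFun_multivariateGaussian (H.posSemidef_asymptoticCov hσ hσ' hσ₀ ρ Ls Lt)]
    have e1 : Complex.exp (((inner ℝ x 0 : ℝ) : ℂ) * Complex.I -
        ((x ⬝ᵥ (asymptoticCov σ σ' σ₀ ρ Ls Lt).mulVec x : ℝ) : ℂ) / 2) =
        Complex.exp (-((x ⬝ᵥ (asymptoticCov σ σ' σ₀ ρ Ls Lt).mulVec x : ℝ) : ℂ) / 2) := by
      rw [inner_zero_right, Complex.ofReal_zero, zero_mul, zero_sub, neg_div]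
    rw [e1]
    refine h.congr fun n => integral_congr_ae (Eventually.of_forall fun ω => ?_)
    simp only
    rw [sum_errorCoeff_mul x (fun a => ρ a.1 a.2)
      fun i => blockSum P X A B u r (i.map fun a => ((a.1 : ℕ), (a.2 : ℕ))) n ω,
      PiLp.inner_apply]
    simp [hZ, mul_comm]
  · exact H.tendstoZeroInProb_error_sub hσ hσ' hσ₀ hC hLin hT ((a.1 : ℕ), (a.2 : ℕ)) (hρ a.1 a.2)

end BlockAsymptotics

end SpaceTime

/-! ### Deducing the theorem from regular variation and the rates. -/

theorem mainTheorem2 {Ω : Type*} [MeasurableSpace Ω] (P : Measure Ω) [IsProbabilityMeasure P]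
    {d : ℕ} (X : SpaceTime.RandomField Ω d) (hX : ∀ s t, Measurable (X s t))
    -- the sets defining the extremes, the thresholds, the block lengths and the mode of convergence
    (A B : Set (Fin d → ℝ)) (hA : MeasurableSet A) (hB : MeasurableSet B)
    (hA0 : SpaceTime.BoundedAwayFromZero A) (hB0 : SpaceTime.BoundedAwayFromZero B)
    (u k : ℕ → ℝ) (r : Fin 3 → ℕ → ℕ)
    (𝓁 : Filter (Fin 3 → ℕ)) [𝓁.NeBot] [𝓁.IsCountablyGenerated]
    (h𝓁 : ∀ i, Tendsto (fun n : Fin 3 → ℕ => n i) 𝓁 atTop)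
    -- stationarity and isotropy
    (hstat : SpaceTime.Stationary P X) (hiso : SpaceTime.Isotropic P X)
    -- regular variation along the thresholds; `A` and `A × B` are continuity sets, `A` is not null
    (hu : ∀ᶠ N in atTop, 0 < u N) (hk : Tendsto k atTop atTop)
    (hk' : k =o[atTop] (fun N : ℕ => (N : ℝ)))
    (m : (p : ℕ) → (Fin p → (ℤ × ℤ) × ℝ≥0) → Measure (Fin p → Fin d → EReal))
    (hm : SpaceTime.VagueRegularVariation P X u k m)
    (hmA : 0 < m 1 ![((0, 0), 0)] (SpaceTime.toExtended '' {x | x 0 ∈ A}))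
    (hmA' : m 1 ![((0, 0), 0)] (SpaceTime.toExtended '' frontier {x | x 0 ∈ A}) = 0)
    (hmAB : ∀ hs ht : ℕ, m 2 ![((0, 0), 0), (((hs : ℤ), 0), (ht : ℝ≥0))]
      (SpaceTime.toExtended '' frontier {x | x 0 ∈ A ∧ x 1 ∈ B}) = 0)
    -- rates
    (hr : ∀ i, Tendsto (fun n : Fin 3 → ℕ => r i (n i)) 𝓁 atTop)
    (hrn : ∀ i, (fun n : Fin 3 → ℕ => (r i (n i) : ℝ)) =o[𝓁] (fun n => (n i : ℝ)))
    (hrv : (fun n => (SpaceTime.blockVol r n : ℝ)) =o[𝓁]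
      (fun n => (SpaceTime.exceedProb P X A u (SpaceTime.sampleSize n))⁻¹))
    (hvn : (fun n => (SpaceTime.exceedProb P X A u (SpaceTime.sampleSize n))⁻¹) =o[𝓁]
      (fun n => (SpaceTime.sampleSize n : ℝ)))
    (hsr : (fun n => √(SpaceTime.sizeProb P X A u n)) =o[𝓁]
      (fun n => (SpaceTime.blockVol r n : ℝ)))
    (hrr : (fun n => (SpaceTime.blockVol r n : ℝ)) =o[𝓁]
      (fun n => SpaceTime.sizeProb P X A u n * (SpaceTime.blockDim r n 2 : ℝ)))
    -- condition (Cov')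
    (σ : ℕ × ℕ → ℕ × ℕ → ℝ) (σ' : ℕ × ℕ → ℝ) (σ₀ : ℝ)
    (hσ : ∀ h h', Tendsto (SpaceTime.covSum P X A B u r h h') 𝓁 (𝓝 (σ h h')))
    (hσ' : ∀ h, Tendsto (SpaceTime.crossCovSum P X A B u r h) 𝓁 (𝓝 (σ' h)))
    (hσ₀ : Tendsto (SpaceTime.crossCovSum P X A A u r (0, 0)) 𝓁 (𝓝 σ₀))
    -- condition (C) on the incomplete time block
    (hC : (SpaceTime.incompleteSum P X A u r) =o[𝓁] (SpaceTime.sizeProb P X A u))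
    -- condition (Lin) and vanishing dependence coefficients
    (hLin : SpaceTime.Lindeberg P X A u r 𝓁 (SpaceTime.extremalFamily A B))
    (hT : ∀ (q : ℕ) (f : Fin q → SpaceTime.BlockFunctional d),
      (∀ i, f i ∈ SpaceTime.extremalFamily A B) → ∀ t : Fin q → ℝ,
        Tendsto (SpaceTime.depCoeff P X A u r f t) 𝓁 (𝓝 0)) :
    (∀ hs ht : ℕ, Tendsto (SpaceTime.preIsoExtremogram P X A B u hs ht) atTop
      (𝓝 (SpaceTime.isoExtremogram P X A B u hs ht))) ∧
    ∀ Ls Lt : ℕ,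
      (SpaceTime.asymptoticCov σ σ' σ₀ (SpaceTime.isoExtremogram P X A B u) Ls Lt).PosSemidef ∧
      TendstoInDistribution (SpaceTime.rescaledError P X A B u r Ls Lt) 𝓁 id (fun _ => P)
        (multivariateGaussian 0
          (SpaceTime.asymptoticCov σ σ' σ₀ (SpaceTime.isoExtremogram P X A B u) Ls Lt)) := by
  have hN := SpaceTime.tendsto_sampleSize h𝓁
  have hρ := fun hs ht =>
    hm.tendsto_preIsoExtremogram hX hk hA hB hA0 hmA hmA' hs ht (hmAB hs ht)
  obtain ⟨α, hα, hkα⟩ := hm.tendsto_exceedProb hX hk hA hA0 hmA hmA'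
  -- Positivity of v_n is a consequence of k_n v_n → α > 0.
  have hv : ∀ᶠ N in atTop, 0 < SpaceTime.exceedProb P X A u N := by
    filter_upwards [hkα.eventually (lt_mem_nhds hα), hk.eventually_gt_atTop 0] with N h1 h2
    exact pos_of_mul_pos_right h1 h2.le
  have hv' := hN.eventually hv
  have hsize : Tendsto (SpaceTime.sizeProb P X A u) 𝓁 atTop := by
    -- The rate v_n⁻¹ ≪ n says that (n v_n)⁻¹ → 0; together with positivity this gives n v_n → ∞.
    have h1 : Tendsto (fun n => (SpaceTime.sizeProb P X A u n)⁻¹) 𝓁 (𝓝 0) := by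
      refine hvn.tendsto_div_nhds_zero.congr fun n => ?_
      rw [SpaceTime.sizeProb, mul_inv, mul_comm, div_eq_mul_inv]
    have h2 : ∀ᶠ n in 𝓁, (SpaceTime.sizeProb P X A u n)⁻¹ ∈ Set.Ioi (0 : ℝ) := by
      filter_upwards [hv', hN.eventually_gt_atTop 0] with n h3 h4
      exact inv_pos.2 (mul_pos (Nat.cast_pos.2 h4) h3)
    refine (tendsto_inv_nhdsGT_zero.comp
      (tendsto_nhdsWithin_iff.2 ⟨h1, h2⟩)).congr fun n => ?_
    simp
  have H : SpaceTime.BlockAsymptotics P X A B u r 𝓁 :=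
    { meas := hX
      measA := hA
      measB := hB
      awayA := hA0
      awayB := hB0
      stationary := hstat
      isotropic := hiso
      threshold_pos := hN.eventually hu
      prob_pos := hv'
      dim := hr
      dim_small := hrn
      volProb_tendsto := hrv.tendsto_div_nhds_zero.congr fun n => by
        rw [SpaceTime.volProb, div_inv_eq_mul]
      sizeProb_tendsto := hsize
      sqrt_div_tendsto := hsr.tendsto_div_nhds_zero }
  exact ⟨hρ, fun Ls Lt => ⟨H.posSemidef_asymptoticCov hσ hσ' hσ₀ _ Ls Lt,
    H.tendstoInDistribution_rescaledError hσ hσ' hσ₀ hC hLin hT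
      (fun hs ht => (hρ hs ht).comp hN) Ls Lt⟩⟩
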